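/- \textbf{Setting.} Let $R$ be a commutative $\mathbb Q$-algebra and $t=(t_1=x,t_2,t_3,\dots)$. Functions of $t$ are formal power series in $R[[t]]$; spectral parameters enter through Laurent series in $\lambda^{-1}$ (or $\mu^{-1}$), so a function of $(t,\lambda)$ is an element of $R((\lambda^{-1}))[[t]]$. Put $\xi(t,\lambda)=\sum_{n\ge1}t_n\lambda^n$, $[\lambda^{-1}]=(\lambda^{-1},\tfrac12\lambda^{-2},\tfrac13\lambda^{-3},\dots)$, and let $\int d\lambda$ denote the coefficient of $\lambda^{-1}$. For a pseudo-differential operator in $D=\partial_x$, let $(\cdot)_\pm$ be its differential and purely pseudo-differential parts, $\mathrm{Res}$ its coefficient of $D^{-1}$, and $*$ the formal adjoint. Let $W=1+\sum_{n\ge1}w_n(t)D^{-n}$ be a dressing operator of the KP hierarchy: with $L=WD^rW^{-1}$ and $L^{n/r}=WD^nW^{-1}$, one has $\partial W/\partial t_n=-(L^{n/r})_-W$ for all $n\ge1$. Its Baker--Akhiezer (BA) functions are $$\psi_{BA}(t,\lambda)=W\big(e^{\xi(t,\lambda)}\big),\qquad \psi^*_{BA}(t,\lambda)=W^{*-1}\big(e^{-\xi(t,\lambda)}\big).$$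 Let $\tau\in R[[t]]$ be invertible and a tau-function of $W$: $\psi_{BA}(t,\lambda)=\dfrac{\tau(t-[\lambda^{-1}])}{\tau(t)}e^{\xi(t,\lambda)}$. An eigenfunction $\Phi$ (adjoint eigenfunction $\Psi$) satisfies $\partial\Phi/\partial t_n=(L^{n/r})_+(\Phi)$ (respectively $\partial\Psi/\partial t_n=-(L^{*\,n/r})_+(\Psi)$) for all $n\ge1$. A squared eigenfunction potential (SEP) of $(\Phi,\Psi)$ is a function $S$ with $$\frac{\partial S}{\partial t_n}=\mathrm{Res}\big(D^{-1}\Psi(L^{n/r})_+\Phi D^{-1}\big)\qquad(n\ge1).$$ "$S(\Phi,\Psi)=G$" means that the SEPs of $(\Phi,\Psi)$ are exactly the functions $G+c$ with $c$ independent of $t$. In (1)--(4) below, moreover, $G$ is the only SEP of the form $e^{-\xi(t,\lambda)}\sum_{n\le N}g_n(t)\lambda^n$ in (1), (3), and of the form $e^{\xi(t,\lambda)}\sum_{n\le N}g_n(t)\lambda^n$ in (2), (4), where $g_n$ is a power series in $t$ with coefficients in $R((\mu^{-1}))$ in (1), (2) and in $R$ in (3), (4). Let $$\hat{\mathcal X}(\lambda,\mu)=\frac1\lambda\,e^{\xi(t+[\lambda^{-1}],\mu)-\xi(t,\lambda)}\,e^{\sum_{l\ge1}\frac1l(\lambda^{-l}-\mu^{-l})\partial/\partial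 t_l}$$ be the bilocal vertex operator, expanded for $|\lambda|>|\mu|$, and let $\delta(\lambda,\mu)=\frac1\lambda\sum_{n\ge0}(\mu/\lambda)^n+\frac1\mu\sum_{n\ge0}(\lambda/\mu)^n$. \textbf{Statement.} Then: (1) $S\big(\psi_{BA}(t,\mu),\psi^*_{BA}(t,\lambda)\big)=-\frac1\lambda\psi_{BA}(t+[\lambda^{-1}],\mu)\,\psi^*_{BA}(t,\lambda)$, expanded for $|\lambda|>|\mu|$, and this function is equal to $-\dfrac{\hat{\mathcal X}(\lambda,\mu)\tau(t)}{\tau(t)}$. (2) $S\big(\psi_{BA}(t,\lambda),\psi^*_{BA}(t,\mu)\big)=\frac1\lambda\psi_{BA}(t,\lambda)\,\psi^*_{BA}(t-[\lambda^{-1}],\mu)$, expanded for $|\lambda|>|\mu|$, and as bilateral formal series in $\lambda,\mu$ this function is equal to $-\dfrac{\hat{\mathcal X}(\mu,\lambda)\tau(t)}{\tau(t)}+\delta(\mu,\lambda)$. (3) $S\big(\Phi(t),\psi^*_{BA}(t,\lambda)\big)=-\frac1\lambda\psi^*_{BA}(t,\lambda)\,\Phi(t+[\lambda^{-1}])$ for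 every eigenfunction $\Phi\in R[[t]]$. (4) $S\big(\psi_{BA}(t,\lambda),\Psi(t)\big)=\frac1\lambda\psi_{BA}(t,\lambda)\,\Psi(t-[\lambda^{-1}])$ for every adjoint eigenfunction $\Psi\in R[[t]]$. (5) For every eigenfunction $\Phi$ and adjoint eigenfunction $\Psi$ in $R[[t]]$, $$S\big(\Phi(t),\Psi(t)\big)=-\int\!\!\int d\lambda\,d\mu\;\varphi^*(\lambda)\,\varphi(\mu)\,\frac1\lambda\,\psi^*_{BA}(t,\lambda)\,\psi_{BA}(t+[\lambda^{-1}],\mu)$$ (the integrand being expanded for $|\lambda|>|\mu|$) whenever $\varphi,\varphi^*$ are spectral densities of $\Phi,\Psi$, i.e. $\Phi(t)=\int d\mu\,\varphi(\mu)\psi_{BA}(t,\mu)$ and $\Psi(t)=\int d\lambda\,\varphi^*(\lambda)\psi^*_{BA}(t,\lambda)$, where the densities are Laurent series in the inverse spectral parameter and may depend, as formal power series, on further parameters; and also for $$\varphi(\mu)=\frac1\mu\psi^*_{BA}(t',\mu)\Phi(t'+[\mu^{-1}]),\qquad \varphi^*(\lambda)=\frac1\lambda\psi_{BA}(t'',\lambda)\Psi(t''-[\lambda^{-1}])$$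 with independent formal multi-times $t',t''$. Here the additive constant may depend on the parameters, respectively on $t',t''$. -/

import Mathlib

noncomputable section

namespace KP

universe u

/-! Times and functions.  `Fun R = R⟦t₁, t₂, …⟧` are the functions of the multi-time, with an
arbitrary commutative `ℚ`-algebra `R` of coefficients.  A spectral parameter `λ` is adjoined by
passing from `R` to the Laurent series `R((λ⁻¹)) = LaurentSeries R` in the variable `λ⁻¹`: the
coefficient of `λ ^ j` is the coefficient with index `-j`.  Doing this twice,
`LaurentSeries (LaurentSeries R) = R((μ⁻¹))((λ⁻¹))` holds the functions of two spectral parameters,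
expanded for `|λ| > |μ|`: the outer variable is the larger one. -/

abbrev Fun (R : Type u) : Type u := MvPowerSeries ℕ+ R

section Basic

variable {R : Type u} [CommRing R]

/-- `∂/∂tₙ`. -/
def ddt (n : ℕ+) (f : Fun R) : Fun R := MvPowerSeries.pderiv R n f

/-- `∂ₓ ^ k`, where `x = t₁`. -/
def dx (k : ℕ) (f : Fun R) : Fun R := (ddt 1)^[k] f

/-- The weight `∑ l * α_l` of the monomial `∏ t_l ^ α_l`. -/
def weight (α : ℕ+ →₀ ℕ) : ℕ := α.sum fun l k => (l : ℕ) * k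

/-- A function that does not depend on the spectral parameter, seen as a function of `(t, λ)`. -/
def lift : Fun R →+* Fun (LaurentSeries R) :=
  MvPowerSeries.map (HahnSeries.C : R →+* LaurentSeries R)

/-- `λ⁻¹` as a function of `(t, λ)`. -/
def lamInv : Fun (LaurentSeries R) := MvPowerSeries.C (HahnSeries.single (1 : ℤ) (1 : R))

/-- `∑ₙ gₙ(t) λ⁻ⁿ`, with exponents bounded above in `λ` uniformly in `t`, as a function
of `(t, λ)`. -/
def swap (g : LaurentSeries (Fun R)) : Fun (LaurentSeries R) :=
  fun α => g.map (MvPowerSeries.coeff (R := R) α)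

end Basic

/-! Pseudo-differential operators in `D = ∂ₓ`, `x = t₁`, with coefficients in `Fun R`.  They are
stored as Laurent series in the symbol `D⁻¹`; the coefficients are written on the left. -/

abbrev PDO (R : Type u) [CommRing R] : Type u := LaurentSeries (Fun R)

namespace PDO

variable {R : Type u} [CommRing R]

/-- The coefficient of `D ^ j`. -/
def co (P : PDO R) (j : ℤ) : Fun R := P.coeff (-j)

/-- The multiplication operator by a function. -/
def ofFun (f : Fun R) : PDO R := HahnSeries.single (0 : ℤ) f

/-- `D ^ n`. -/
def D (n : ℤ) : PDO R := HahnSeries.single (-n) (1 : Fun R)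

theorem bddBelow_of_le {f : ℤ → Fun R} (N : ℤ) (h : ∀ n, n < N → f n = 0) :
    BddBelow (Function.support f) :=
  ⟨N, fun n hn => not_lt.mp fun hlt => hn (h n hlt)⟩

theorem exists_bound (P : PDO R) : ∃ N : ℤ, ∀ n, n < N → P.coeff n = 0 :=
  ⟨P.order, fun _ hn => HahnSeries.coeff_eq_zero_of_lt_order hn⟩

theorem dx_zero (k : ℕ) : dx k (0 : Fun R) = 0 := by
  induction k with
  | zero => rfl
  | succ k ih => rw [dx, Function.iterate_succ_apply', ← dx, ih, ddt, map_zero]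

/-- The coefficient of `D ^ m` in the product `P Q`, from the Leibniz rule
`D ^ i f = ∑_{k ≥ 0} (i choose k) (∂ₓ ^ k f) D ^ (i - k)`. -/
def mulCo (P Q : PDO R) (m : ℤ) : Fun R :=
  ∑ᶠ p : ℤ × ℕ, Ring.choose p.1 p.2 • (P.co p.1 * dx p.2 (Q.co (m - p.1 + p.2)))

/-- The operator product. -/
def mul (P Q : PDO R) : PDO R :=
  HahnSeries.ofSuppBddBelow (fun n : ℤ => mulCo P Q (-n)) (by
    obtain ⟨M, hM⟩ := exists_bound P
    obtain ⟨N, hN⟩ := exists_bound Q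
    refine bddBelow_of_le (M + N) fun n hn => ?_
    refine finsum_eq_zero_of_forall_eq_zero fun p => ?_
    by_cases h : -p.1 < M
    · rw [co, hM _ h, zero_mul, smul_zero]
    · rw [show Q.co (-n - p.1 + p.2) = 0 from hN _ (by omega), dx_zero, mul_zero, smul_zero])

/-- The coefficient of `D ^ m` in the formal adjoint `P⋆ = ∑ᵢ (-D) ^ i aᵢ` of `P = ∑ᵢ aᵢ D ^ i`. -/
def adjCo (P : PDO R) (m : ℤ) : Fun R :=
  ∑ᶠ k : ℕ, (((-1 : ℤˣ) ^ (m + k) : ℤˣ) : ℤ) • (Ring.choose (m + k) k • dx k (P.co (m + k)))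

/-- The formal adjoint. -/
def adj (P : PDO R) : PDO R :=
  HahnSeries.ofSuppBddBelow (fun n : ℤ => adjCo P (-n)) (by
    obtain ⟨M, hM⟩ := exists_bound P
    refine bddBelow_of_le M fun n hn => ?_
    refine finsum_eq_zero_of_forall_eq_zero fun k => ?_
    rw [show P.co (-n + k) = 0 from hM _ (by omega), dx_zero, smul_zero, smul_zero])

/-- The purely differential part `∑_{j ≥ 0} aⱼ D ^ j`. -/
def plus (P : PDO R) : PDO R :=
  HahnSeries.ofSuppBddBelow (fun n : ℤ => if n ≤ 0 then P.coeff n else 0) (by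
    obtain ⟨M, hM⟩ := exists_bound P
    refine bddBelow_of_le M fun n hn => ?_
    rw [hM n hn, ite_self])

/-- The purely pseudo-differential part `∑_{j ≥ 1} a₋ⱼ D ^ (-j)`. -/
def minus (P : PDO R) : PDO R := P - plus P

/-- The residue: the coefficient of `D⁻¹`. -/
def res (P : PDO R) : Fun R := P.co (-1)

/-- The action `∑_{j ≥ 0} aⱼ ∂ₓ ^ j f` of a differential operator on a function. -/
def act (P : PDO R) (f : Fun R) : Fun R := ∑ᶠ j : ℕ, P.co j * dx j f

/-- `P = 1 + ∑_{n ≥ 1} wₙ D⁻ⁿ`. -/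
def IsDressing (P : PDO R) : Prop := P.co 0 = 1 ∧ ∀ n : ℤ, 0 < n → P.co n = 0

/-- The inverse of an operator `P = 1 + O(D⁻¹)`, by the Neumann series `∑ₖ (1 - P) ^ k`; only the
terms with `k ≤ n` contribute to the coefficient of `D⁻ⁿ`. -/
def inv (P : PDO R) : PDO R :=
  HahnSeries.ofSuppBddBelow
    (fun n : ℤ => if n < 0 then 0 else
      ∑ k ∈ Finset.range (n.toNat + 1), ((mul (D 0 - P))^[k] (D 0)).coeff n)
    (bddBelow_of_le 0 fun _ hn => if_pos hn)

/-- Extension of the ring of constants. -/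
def baseChange {S : Type u} [CommRing S] (f : R →+* S) (P : PDO R) : PDO S :=
  HahnSeries.map P (MvPowerSeries.map (σ := ℕ+) f)

/-- The same operator with a spectral parameter adjoined to the constants. -/
def lift (P : PDO R) : PDO (LaurentSeries R) :=
  baseChange (HahnSeries.C : R →+* LaurentSeries R) P

end PDO

/-! The KP hierarchy. -/

section Hierarchy

variable {R : Type u} [CommRing R]

open PDO

/-- `L ^ (n/r)` for `L = W D ^ r W⁻¹`.  It is `W D ^ n W⁻¹`, whatever the order `r` of `L`. -/
def laxPow (W : PDO R) (n : ℕ) : PDO R := mul (mul W (D n)) (inv W)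

/-- The Wilson–Sato equations `∂W/∂tₙ = - (L ^ (n/r))₋ W`. -/
def WilsonSato (W : PDO R) : Prop :=
  ∀ n : ℕ+, HahnSeries.map W (MvPowerSeries.pderiv R n : Derivation R (Fun R) (Fun R))
    = - mul (minus (laxPow W n)) W

/-- Eigenfunctions: `∂Φ/∂tₙ = (L ^ (n/r))₊ (Φ)`. -/
def IsEigenfunction (W : PDO R) (Φ : Fun R) : Prop :=
  ∀ n : ℕ+, ddt n Φ = act (plus (laxPow W n)) Φ

/-- Adjoint eigenfunctions: `∂Ψ/∂tₙ = - (L⋆ ^ (n/r))₊ (Ψ)`. -/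
def IsAdjointEigenfunction (W : PDO R) (Ψ : Fun R) : Prop :=
  ∀ n : ℕ+, ddt n Ψ = - act (plus (adj (laxPow W n))) Ψ

/-- `S` is a squared eigenfunction potential of `Φ` and `Ψ`:
`∂S/∂tₙ = Res (D⁻¹ Ψ (L ^ (n/r))₊ Φ D⁻¹)`. -/
def IsSEP (W : PDO R) (Φ Ψ S : Fun R) : Prop :=
  ∀ n : ℕ+, ddt n S =
    res (mul (D (-1)) (mul (ofFun Ψ) (mul (plus (laxPow W n)) (mul (ofFun Φ) (D (-1))))))

/-- `S(Φ, Ψ) = G` up to the additive constant in the squared eigenfunction potential. -/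
def SEPEq (W : PDO R) (Φ Ψ G : Fun R) : Prop :=
  ∀ S : Fun R, IsSEP W Φ Ψ S ↔ ∃ c : R, S = G + MvPowerSeries.C c

end Hierarchy

section Exponentials

variable {R : Type u} [CommRing R] [Algebra ℚ R]

/-- `exp (ε ξ(t, λ)) = ∏_l exp (ε t_l λ ^ l) = ∑_α ∏_l (ε t_l λ ^ l) ^ α_l / α_l!`, for `ε = ±1`. -/
def expXi (R : Type u) [CommRing R] [Algebra ℚ R] (ε : ℤˣ) : Fun (LaurentSeries R) :=
  fun α => HahnSeries.single (-(weight α : ℤ))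
    (algebraMap ℚ R (α.prod fun _ k => ((ε : ℤ) : ℚ) ^ k / (k.factorial : ℚ)))

/-- `f(t + ε [λ⁻¹])`, where `[λ⁻¹] = (λ⁻¹, λ⁻² / 2, λ⁻³ / 3, …)`: every `t_l` in `f` is replaced by
`t_l + ε λ⁻ˡ / l`, and the result is expanded by the binomial theorem.  The coefficient of `λ⁻ⁿ`
collects the terms in which the monomial taken from the shift has weight `n`. -/
def shift (ε : ℤˣ) (f : Fun R) : Fun (LaurentSeries R) :=
  fun α => HahnSeries.ofPowerSeries ℤ R (PowerSeries.mk fun n : ℕ =>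
    ∑ᶠ (β : ℕ+ →₀ ℕ) (_ : weight β = n),
      algebraMap ℚ R (β.prod fun l k => ((α l + k).choose k : ℚ) * (((ε : ℤ) : ℚ) / (l : ℕ)) ^ k)
        * MvPowerSeries.coeff (α + β) f)

/-- `P (exp (ε ξ(t, λ))) = (∑ⱼ aⱼ(t) (ε λ) ^ j) exp (ε ξ(t, λ))` for `P = ∑ⱼ aⱼ D ^ j`. -/
def applyExp (ε : ℤˣ) (P : PDO R) : Fun (LaurentSeries R) :=
  swap (HahnSeries.ofSuppBddBelow (fun n : ℤ => ((ε ^ n : ℤˣ) : ℤ) • P.coeff n) (by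
    obtain ⟨M, hM⟩ := PDO.exists_bound P
    refine PDO.bddBelow_of_le M fun n hn => ?_
    rw [hM n hn, smul_zero])) * expXi R ε

/-- The Baker–Akhiezer function `ψ(t, λ) = W (exp ξ(t, λ))`. -/
def ba (W : PDO R) : Fun (LaurentSeries R) := applyExp 1 W

/-- The adjoint Baker–Akhiezer function `ψ⋆(t, λ) = W⋆⁻¹ (exp (-ξ(t, λ)))`. -/
def baAdj (W : PDO R) : Fun (LaurentSeries R) := applyExp (-1) (PDO.inv (PDO.adj W))

/-- `τ` is a tau-function: `τ(t) ψ(t, λ) = τ(t - [λ⁻¹]) exp ξ(t, λ)`. -/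
def IsTau (W : PDO R) (τ : (Fun R)ˣ) : Prop :=
  lift (τ : Fun R) * ba W = shift (-1) (τ : Fun R) * expXi R 1

/-- The functions of the form `exp (ε ξ(t, λ)) ∑_{n ≤ N} gₙ(t) λ ^ n`. -/
def IsOscillating (ε : ℤˣ) (S : Fun (LaurentSeries R)) : Prop :=
  ∃ g : LaurentSeries (Fun R), S = swap g * expXi R ε

/-- `S(Φ, Ψ) = G` when one argument is oscillating with exponent `ε ξ(t, λ)`: the potentials are `G`
up to a constant, and `G` is the only potential that is itself oscillating. -/
def SEPEqOsc (ε : ℤˣ) (W : PDO (LaurentSeries R)) (Φ Ψ G : Fun (LaurentSeries R)) : Prop :=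
  SEPEq W Φ Ψ G ∧ ∀ S, (IsSEP W Φ Ψ S ∧ IsOscillating ε S) ↔ S = G

/-- The action of the bilocal vertex operator
`X(λ, μ) = λ⁻¹ exp (ξ(t + [λ⁻¹], μ) - ξ(t, λ)) exp (∑ₗ (λ⁻ˡ - μ⁻ˡ) / l ∂/∂t_l)` on `f`;
the outer parameter is `λ`, the inner one `μ`. -/
def vertex (f : Fun R) : Fun (LaurentSeries (LaurentSeries R)) :=
  lamInv * (shift 1 (expXi R 1) * expXi (LaurentSeries R) (-1)) * shift 1 (shift (-1) f)

/-- `(X(λ, μ) τ)(t) / τ(t)`. -/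
def vertexRatio (τ : (Fun R)ˣ) : Fun (LaurentSeries (LaurentSeries R)) :=
  vertex (τ : Fun R) * lift (lift ((τ⁻¹ : (Fun R)ˣ) : Fun R))

/-- The coefficient of `(outer parameter) ^ i * (inner parameter) ^ j`. -/
def biCoeff (G : Fun (LaurentSeries (LaurentSeries R))) (i j : ℤ) : Fun R :=
  fun α => ((MvPowerSeries.coeff α G).coeff (-i)).coeff (-j)

/-- The coefficient of `λ ^ i μ ^ j` in
`δ(λ, μ) = λ⁻¹ ∑_{n ≥ 0} (μ / λ) ^ n + μ⁻¹ ∑_{n ≥ 0} (λ / μ) ^ n`. -/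
def deltaCoeff (R : Type u) [CommRing R] (i j : ℤ) : Fun R := if i + j = -1 then 1 else 0

end Exponentials

/-! Spectral integrals.  The densities may depend on further parameters, indexed by `σ`. -/

section Spectral

variable {R : Type u} [CommRing R] [Algebra ℚ R] {σ : Type}

/-- `∫ dλ = Res_λ`: the coefficient of `λ⁻¹`, for the outer spectral parameter. -/
def spectralInt (I : Fun (MvPowerSeries σ (LaurentSeries R))) : Fun (MvPowerSeries σ R) :=
  fun α β => (MvPowerSeries.coeff β (MvPowerSeries.coeff α I)).coeff 1

/-- A function of the times alone, as a function of the times and the parameters. -/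
def withParams (σ : Type) {F : Type u} [CommRing F] (f : Fun F) : Fun (MvPowerSeries σ F) :=
  MvPowerSeries.map (MvPowerSeries.C : F →+* MvPowerSeries σ F) f

/-- A function of `μ` as a function of `(λ, μ)` (`μ` is the inner parameter). -/
def inner (φ : MvPowerSeries σ (LaurentSeries R)) :
    MvPowerSeries σ (LaurentSeries (LaurentSeries R)) :=
  MvPowerSeries.map (HahnSeries.C : LaurentSeries R →+* LaurentSeries (LaurentSeries R)) φ

/-- A function of `λ` as a function of `(λ, μ)` (`λ` is the outer parameter). -/
def outer (φ : MvPowerSeries σ (LaurentSeries R)) :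
    MvPowerSeries σ (LaurentSeries (LaurentSeries R)) :=
  fun α => (MvPowerSeries.coeff α φ).map (HahnSeries.C : R →+* LaurentSeries R)

/-- `Φ(t) = ∫ dλ φ(λ) χ(t, λ)`. -/
def HasDensity (χ : Fun (LaurentSeries R)) (Φ : Fun R)
    (φ : MvPowerSeries σ (LaurentSeries R)) : Prop :=
  withParams σ Φ = spectralInt (MvPowerSeries.C φ * withParams σ χ)

/-- `∫∫ dλ dμ φ⋆(λ) φ(μ) λ⁻¹ ψ⋆(t, λ) ψ(t + [λ⁻¹], μ)`. -/
def doubleInt (W : PDO R) (φs φ : MvPowerSeries σ (LaurentSeries R)) : Fun (MvPowerSeries σ R) :=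
  spectralInt (spectralInt (MvPowerSeries.C (outer φs * inner φ) *
    withParams σ (lamInv * baAdj (PDO.lift W) * shift 1 (ba W))))

/-- `φ(λ) = λ⁻¹ ψ⋆(t', λ) Φ(t' + [λ⁻¹])`, a function of `(t', λ)`. -/
def density (W : PDO R) (Φ : Fun R) : Fun (LaurentSeries R) := lamInv * baAdj W * shift 1 Φ

/-- `φ⋆(λ) = λ⁻¹ ψ(t', λ) Ψ(t' - [λ⁻¹])`, a function of `(t', λ)`. -/
def densityAdj (W : PDO R) (Ψ : Fun R) : Fun (LaurentSeries R) := lamInv * ba W * shift (-1) Ψ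

/-- `S(Φ, Ψ) = G` up to a constant, for a function `G` of the times and the parameters; the constant
may depend on the parameters. -/
def SEPEqParams (σ : Type) (W : PDO R) (Φ Ψ : Fun R) (G : Fun (MvPowerSeries σ R)) : Prop :=
  SEPEq (PDO.baseChange (MvPowerSeries.C : R →+* MvPowerSeries σ R) W)
    (withParams σ Φ) (withParams σ Ψ) G

end Spectral

end KP

end

noncomputable section

namespace KP

universe u v

open Finset.HasAntidiagonal (antidiagonal mem_antidiagonal)

local notation:70 P:70 "⋆" Q:71 => PDO.mul P Q

/-! ### Differentiation in the times -/

section Derivatives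

variable {R : Type u} [CommRing R]

/-! A potential is determined up to a constant by its time derivatives. A function exp(±ξ) · ∑_{n ≤
N} gₙ(t) λⁿ with vanishing x-derivative is zero, because its leading coefficient would have to
vanish (`IsOscillating.eq_zero`). Hence in (3) and (4) only the equation in x has to be checked.
Indeed, by Lagrange's identity (`ddt_one_sepRes`) the x-derivative of Res(D⁻¹ Ψ Bₙ Φ D⁻¹) is ∂ₙ(ΦΨ).
If ∂ₓG = ΦΨ and G is oscillating, then ∂ₙG − Res(D⁻¹ Ψ Bₙ Φ D⁻¹) is oscillating and independent of
x, so it vanishes for every n.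

The equation in x (`ddt_one_potential`) compares two formulas. The first is the logarithmic
x-derivative of the wave function τ(t − ε[λ⁻¹]) exp(εξ) / τ(t), with ε = 1 for ψ and ε = −1 for ψ⋆.
The second says that the shift of an eigenfunction is given by an operator of first order
(`IsSolution.hs_succ`). The coefficients of the shift act on eigenfunctions by differential
operators Qₙ because the flows do. The product of Qₙ with the dressing operator is found from the
exponential exp(εξ(t, μ)), which the shift by −ε[λ⁻¹] multiplies by 1 − μ/λ, so Qₙ has order at most
one. In both formulas the unknown coefficient is −∂ₓ log τ, and it cancels. The tau formula for ψ⋆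
is not a hypothesis; it follows from the bilinear identity Res ψ(t′, λ) ψ⋆(t, λ) = 0 at t′ = t +
[μ⁻¹] (`shiftSeries_waveSeries_mul`).

Statements (1) and (2) are (3) and (4) over the constants R((μ⁻¹)), with the wave function in μ as
the eigenfunction. For the delta function in (2), corresponding coefficients of the two expansions
are potentials of the same pair, so they differ by constants. At t = 0 the two expansions are
complementary parts of one bilateral convolution, whose total is known because the shifts by [λ⁻¹]
and −[λ⁻¹] are inverse to each other (`constantCoeff_shiftRatio_add`).

For (5), the residue is bilinear in Φ and Ψ, so it commutes with the spectral integrals. The special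
densities are, up to sign, potentials in the variable t′; their t′-derivatives are built from ψ⋆(t′,
·) or ψ(t′, ·) and integrate to zero by the bilinear identity, so the integral can be evaluated at
t′ = t (`hasDensity_of_orthogonal`). -/

open MvPowerSeries in
theorem coeff_ddt (n : ℕ+) (f : Fun R) (α : ℕ+ →₀ ℕ) :
    coeff α (ddt n f) = coeff (α + Finsupp.single n 1) f * (α n + 1) :=
  coeff_pderiv f α

@[simp] theorem ddt_zero (n : ℕ+) : ddt n (0 : Fun R) = 0 := map_zero _
@[simp] theorem ddt_one (n : ℕ+) : ddt n (1 : Fun R) = 0 := MvPowerSeries.pderiv_one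
@[simp] theorem ddt_C (n : ℕ+) (r : R) : ddt n (MvPowerSeries.C r) = 0 := MvPowerSeries.pderiv_C
@[simp] theorem ddt_add (n : ℕ+) (f g : Fun R) : ddt n (f + g) = ddt n f + ddt n g := map_add _ _ _
@[simp] theorem ddt_sub (n : ℕ+) (f g : Fun R) : ddt n (f - g) = ddt n f - ddt n g := map_sub _ _ _
@[simp] theorem ddt_neg (n : ℕ+) (f : Fun R) : ddt n (-f) = -ddt n f := map_neg _ _
theorem ddt_zsmul (n : ℕ+) (c : ℤ) (f : Fun R) : ddt n (c • f) = c • ddt n f := map_zsmul _ _ _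
theorem ddt_nsmul (n : ℕ+) (c : ℕ) (f : Fun R) : ddt n (c • f) = c • ddt n f := map_nsmul _ _ _

theorem ddt_sum (n : ℕ+) {ι : Type*} (s : Finset ι) (f : ι → Fun R) :
    ddt n (∑ i ∈ s, f i) = ∑ i ∈ s, ddt n (f i) := map_sum _ _ _

theorem ddt_mul (n : ℕ+) (f g : Fun R) : ddt n (f * g) = ddt n f * g + f * ddt n g := by
  rw [ddt, Derivation.leibniz, smul_eq_mul, smul_eq_mul, ddt, ddt]; ring

theorem ddt_C_mul (n : ℕ+) (r : R) (f : Fun R) :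
    ddt n (MvPowerSeries.C r * f) = MvPowerSeries.C r * ddt n f := by
  rw [ddt_mul, ddt_C, zero_mul, zero_add]

theorem ddt_comm (m n : ℕ+) (f : Fun R) : ddt m (ddt n f) = ddt n (ddt m f) := by
  ext α
  simp only [coeff_ddt, Finsupp.add_apply, add_right_comm α (Finsupp.single n 1)]
  rcases eq_or_ne m n with rfl | h
  · rfl
  · rw [Finsupp.single_eq_of_ne h, Finsupp.single_eq_of_ne h.symm]; push_cast; ring

theorem ddt_map {S : Type v} [CommRing S] (φ : R →+* S) (n : ℕ+) (f : Fun R) :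
    ddt n (MvPowerSeries.map φ f) = MvPowerSeries.map φ (ddt n f) := by
  ext α
  simp only [coeff_ddt, MvPowerSeries.coeff_map, map_mul, map_add, map_natCast, map_one]

/-- Over ℚ the integer factor produced by a derivative can be cancelled. Every identification up to
a constant below rests on this. -/
theorem eq_C_of_ddt_eq_zero [Algebra ℚ R] {f : Fun R} (h : ∀ n, ddt n f = 0) :
    f = MvPowerSeries.C (MvPowerSeries.constantCoeff f) := by
  have := IsAddTorsionFree.of_module_rat R
  refine MvPowerSeries.pderiv.ext (fun n => ?_) (MvPowerSeries.constantCoeff_C _).symm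
  rw [MvPowerSeries.pderiv_C]
  exact h n

@[simp] theorem dx_zero_left (f : Fun R) : dx 0 f = f := rfl
theorem dx_succ (k : ℕ) (f : Fun R) : dx (k + 1) f = dx k (ddt 1 f) := rfl
theorem dx_succ' (k : ℕ) (f : Fun R) : dx (k + 1) f = ddt 1 (dx k f) :=
  Function.iterate_succ_apply' _ _ _

theorem dx_add (k l : ℕ) (f : Fun R) : dx (k + l) f = dx k (dx l f) :=
  Function.iterate_add_apply _ _ _ _

/-- `∂ₓ ^ k` as an additive map. -/
def dxHom (k : ℕ) : Fun R →+ Fun R where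
  toFun := dx k
  map_zero' := PDO.dx_zero k
  map_add' f g := by
    induction k generalizing f g with
    | zero => rfl
    | succ k ih => simp only [dx_succ, ddt_add, ih]

theorem dx_map_add (k : ℕ) (f g : Fun R) : dx k (f + g) = dx k f + dx k g := map_add (dxHom k) f g
theorem dx_zsmul (k : ℕ) (c : ℤ) (f : Fun R) : dx k (c • f) = c • dx k f := map_zsmul (dxHom k) c f
theorem dx_sum (k : ℕ) {ι : Type*} (s : Finset ι) (f : ι → Fun R) :
    dx k (∑ i ∈ s, f i) = ∑ i ∈ s, dx k (f i) := map_sum (dxHom k) f s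

theorem dx_one (k : ℕ) : dx k (1 : Fun R) = if k = 0 then 1 else 0 := by
  cases k with
  | zero => rfl
  | succ k => rw [dx_succ, ddt_one, PDO.dx_zero, if_neg k.succ_ne_zero]

theorem dx_mul (n : ℕ) (f g : Fun R) :
    dx n (f * g) = ∑ p ∈ antidiagonal n, n.choose p.1 • (dx p.1 f * dx p.2 g) := by
  induction n with
  | zero => simp
  | succ n ih =>
    rw [dx_succ', ih, ddt_sum]
    simp only [nsmul_eq_mul]
    rw [Finset.sum_antidiagonal_choose_succ_mul (fun i j => dx i f * dx j g),
      ← Finset.sum_add_distrib]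
    refine Finset.sum_congr rfl fun p hp => ?_
    rw [← nsmul_eq_mul, ddt_nsmul, ddt_mul, ← dx_succ', ← dx_succ', nsmul_eq_mul, mul_add,
      Nat.choose_symm_of_eq_add (mem_antidiagonal.mp hp).symm, add_comm]

theorem dx_ddt (k : ℕ) (n : ℕ+) (f : Fun R) : dx k (ddt n f) = ddt n (dx k f) := by
  induction k with
  | zero => rfl
  | succ k ih => rw [dx_succ', dx_succ', ih, ddt_comm]

theorem dx_map {S : Type v} [CommRing S] (φ : R →+* S) (k : ℕ) (f : Fun R) :
    dx k (MvPowerSeries.map φ f) = MvPowerSeries.map φ (dx k f) := by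
  induction k with
  | zero => rfl
  | succ k ih => rw [dx_succ', dx_succ', ih, ddt_map]

end Derivatives

/-! ### The coefficients of a shift of the times -/

section Shift

variable {R : Type u} [CommRing R]

theorem weight_add_single (β : ℕ+ →₀ ℕ) (l : ℕ+) :
    weight (β + Finsupp.single l 1) = weight β + l := by
  rw [weight, Finsupp.sum_add_index' (fun _ => mul_zero _) (fun _ _ _ => mul_add _ _ _),
    Finsupp.sum_single_index (mul_zero _), mul_one, weight]

theorem le_weight {β : ℕ+ →₀ ℕ} {l : ℕ+} (h : β l ≠ 0) : (l : ℕ) * β l ≤ weight β :=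
  Finset.single_le_sum (f := fun l : ℕ+ => (l : ℕ) * β l) (fun _ _ => Nat.zero_le _)
    (Finsupp.mem_support_iff.mpr h)

/-- Weight n bounds both the indices and the exponents by n; this turns the `finsum` in the
definition of the shift into a finite sum. -/
theorem finite_weight_eq (n : ℕ) : {β : ℕ+ →₀ ℕ | weight β = n}.Finite := by
  refine (Finset.finite_toSet (Finset.finsupp (Finset.Icc 1 n.succPNat)
    fun _ => Finset.range (n + 1))).subset fun β hβ => ?_
  have hβ' : weight β = n := hβ
  rw [Finset.mem_coe, Finset.mem_finsupp_iff]
  refine ⟨fun l hl => ?_, fun l _ => ?_⟩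
  · have h0 := Finsupp.mem_support_iff.mp hl
    have := le_weight h0
    rw [Finset.mem_Icc]
    refine ⟨one_le, ?_⟩
    rw [← PNat.coe_le_coe, Nat.succPNat_coe]
    nlinarith [Nat.pos_of_ne_zero h0]
  · rw [Finset.mem_range]
    by_cases h0 : β l = 0
    · omega
    · have := le_weight h0
      nlinarith [l.pos]

/-- The exponents of the monomials of weight `n`. -/
def weightFinset (n : ℕ) : Finset (ℕ+ →₀ ℕ) := (finite_weight_eq n).toFinset

theorem mem_weightFinset {n : ℕ} {β : ℕ+ →₀ ℕ} : β ∈ weightFinset n ↔ weight β = n := by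
  rw [weightFinset, Set.Finite.mem_toFinset, Set.mem_ofPred_eq]

/-- Only the times with index at most n + 1 occur. They are listed as l = p.1 + 1 so that p.2 = n +
1 − l is the weight left in `succ_smul_hs`. -/
theorem weight_eq_sum {n : ℕ} {β : ℕ+ →₀ ℕ} (h : weight β = n + 1) :
    ∑ p ∈ antidiagonal n, (p.1 + 1) * β p.1.succPNat = n + 1 := by
  rw [Finset.Nat.sum_antidiagonal_eq_sum_range_succ (fun i _ => (i + 1) * β i.succPNat) n, ← h,
    weight, Finsupp.sum]
  symm
  refine Finset.sum_of_injOn (fun l : ℕ+ => l.natPred) ?_ ?_ ?_ ?_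
  · exact fun a _ b _ hab => PNat.natPred_injective hab
  · intro l hl
    have h0 := Finsupp.mem_support_iff.mp hl
    have h1 := le_weight h0
    have h2 := PNat.natPred_add_one l
    simp only [Finset.coe_range, Set.mem_Iio]
    nlinarith [Nat.pos_of_ne_zero h0]
  · intro i _ hi
    by_contra hne
    refine hi ⟨i.succPNat, ?_, Nat.natPred_succPNat i⟩
    rw [Finset.mem_coe, Finsupp.mem_support_iff]
    exact fun h => hne (by rw [h, mul_zero])
  · intro l _
    rw [PNat.natPred_add_one, PNat.succPNat_natPred]

/-- The coefficient with which the monomial `t ^ (α + β)` contributes to `t ^ α` in the shift. -/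
def shiftWeight (ε : ℤˣ) (α β : ℕ+ →₀ ℕ) : ℚ :=
  β.prod fun l k => ((α l + k).choose k : ℚ) * (((ε : ℤ) : ℚ) / (l : ℕ)) ^ k

/-- Only the factor at l changes, and there (b + 1) C(a + b + 1, b + 1) = (a + b + 1) C(a + b, b).
The right side is the factor produced by ∂ₗ. -/
theorem shiftWeight_add_single (ε : ℤˣ) (α β : ℕ+ →₀ ℕ) (l : ℕ+) :
    shiftWeight ε α (β + Finsupp.single l 1) * ((l : ℕ) * (β l + 1))
      = ((ε : ℤ) : ℚ) * (shiftWeight ε α β * (α l + β l + 1)) := by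
  classical
  have hs : β.support ⊆ insert l β.support := Finset.subset_insert _ _
  have hs' : (β + Finsupp.single l 1).support ⊆ insert l β.support := by
    intro i hi
    by_cases h : i = l
    · exact h ▸ Finset.mem_insert_self _ _
    · refine Finset.mem_insert_of_mem ?_
      simpa [Finsupp.single_apply, Ne.symm h] using hi
  have hmem : l ∈ insert l β.support := Finset.mem_insert_self _ _
  rw [shiftWeight, shiftWeight, Finsupp.prod_of_support_subset _ hs' _ (by simp),
    Finsupp.prod_of_support_subset _ hs _ (by simp), ← Finset.mul_prod_erase _ _ hmem,
    ← Finset.mul_prod_erase _ _ hmem]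
  have hrest : ∏ i ∈ (insert l β.support).erase l,
        (((α i + (β + Finsupp.single l 1 : ℕ+ →₀ ℕ) i).choose
            ((β + Finsupp.single l 1 : ℕ+ →₀ ℕ) i) : ℚ)
          * (((ε : ℤ) : ℚ) / (i : ℕ)) ^ ((β + Finsupp.single l 1 : ℕ+ →₀ ℕ) i))
      = ∏ i ∈ (insert l β.support).erase l,
        (((α i + β i).choose (β i) : ℚ) * (((ε : ℤ) : ℚ) / (i : ℕ)) ^ (β i)) := by
    refine Finset.prod_congr rfl fun i hi => ?_
    rw [Finsupp.add_apply, Finsupp.single_eq_of_ne (Finset.ne_of_mem_erase hi), add_zero]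
  rw [hrest, Finsupp.add_apply, Finsupp.single_eq_same]
  have hc : ((α l + (β l + 1)).choose (β l + 1) : ℚ) * (β l + 1)
      = (α l + β l + 1) * (α l + β l).choose (β l) := by
    exact_mod_cast (Nat.add_one_mul_choose_eq (α l + β l) (β l)).symm
  have hl : ((l : ℕ) : ℚ) ≠ 0 := Nat.cast_ne_zero.mpr l.ne_zero
  rw [pow_succ]
  have hl2 : ((ε : ℤ) : ℚ) / ((l : ℕ) : ℚ) * ((l : ℕ) : ℚ) = ((ε : ℤ) : ℚ) := div_mul_cancel₀ _ hl
  linear_combination (((ε : ℤ) : ℚ) / (l : ℕ)) ^ (β l) * (∏ i ∈ (insert l β.support).erase l,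
    (((α i + β i).choose (β i) : ℚ) * (((ε : ℤ) : ℚ) / (i : ℕ)) ^ (β i)))
    * (((ε : ℤ) : ℚ) * hc + ((α l + (β l + 1)).choose (β l + 1) : ℚ) * (β l + 1) * hl2)

variable [Algebra ℚ R]

/-- The coefficient of `λ⁻ⁿ` in `f(t + ε [λ⁻¹])`. -/
def hs (ε : ℤˣ) (n : ℕ) (f : Fun R) : Fun R := fun α =>
  ∑ᶠ (β : ℕ+ →₀ ℕ) (_ : weight β = n),
    algebraMap ℚ R (β.prod fun l k => ((α l + k).choose k : ℚ) * (((ε : ℤ) : ℚ) / (l : ℕ)) ^ k)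
      * MvPowerSeries.coeff (α + β) f

theorem coeff_hs (ε : ℤˣ) (n : ℕ) (f : Fun R) (α : ℕ+ →₀ ℕ) :
    MvPowerSeries.coeff α (hs ε n f) = ∑ β ∈ weightFinset n,
      algebraMap ℚ R (shiftWeight ε α β) * MvPowerSeries.coeff (α + β) f := by
  rw [← finsum_mem_finset_eq_sum]
  refine finsum_congr fun β => ?_
  rw [mem_weightFinset]; rfl

theorem weight_eq_zero {β : ℕ+ →₀ ℕ} : weight β = 0 ↔ β = 0 := by
  refine ⟨fun h => ?_, fun h => by rw [h]; rfl⟩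
  ext l
  by_contra h0
  have := le_weight h0
  have : 0 < (l : ℕ) * β l := Nat.mul_pos l.pos (Nat.pos_of_ne_zero h0)
  omega

@[simp] theorem hs_zero (ε : ℤˣ) (f : Fun R) : hs ε 0 f = f := by
  ext α
  have : weightFinset 0 = {0} := by
    ext β; rw [mem_weightFinset, Finset.mem_singleton, weight_eq_zero]
  rw [coeff_hs, this, Finset.sum_singleton, shiftWeight, Finsupp.prod_zero_index, map_one, one_mul,
    add_zero]

theorem hs_add (ε : ℤˣ) (n : ℕ) (f g : Fun R) : hs ε n (f + g) = hs ε n f + hs ε n g := by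
  ext α
  simp only [coeff_hs, map_add, mul_add, Finset.sum_add_distrib]

theorem unit_mul_self (ε : ℤˣ) : (ε : ℤ) * (ε : ℤ) = 1 := by
  rcases Int.units_eq_one_or ε with rfl | rfl <;> rfl

/-- `n hₙ(f) = ε ∑ₗ hₙ₋ₗ(∂ₗ f)`. -/
theorem succ_smul_hs (ε : ℤˣ) (n : ℕ) (f : Fun R) :
    (n + 1) • hs ε (n + 1) f
      = (ε : ℤ) • ∑ p ∈ antidiagonal n, hs ε p.2 (ddt p.1.succPNat f) := by
  ext α
  -- The factor n + 1 is written as ∑ₗ l βₗ, which splits the coefficient according to the time that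
  -- is differentiated. With l = p.1 + 1, the map β ↦ β + eₗ raises the weight from n + 1 − l to n +
  -- 1; the exponents it misses have βₗ = 0 and carry the factor 0.
  have key : ∀ p ∈ antidiagonal n,
      MvPowerSeries.coeff α (hs ε p.2 (ddt p.1.succPNat f)) = ∑ β ∈ weightFinset (n + 1),
        algebraMap ℚ R (((ε : ℤ) : ℚ) * (shiftWeight ε α β * ((p.1 + 1 : ℕ) * β p.1.succPNat)))
          * MvPowerSeries.coeff (α + β) f := by
    intro p hp
    rw [coeff_hs]
    refine Finset.sum_of_injOn (fun β => β + Finsupp.single p.1.succPNat 1) ?_ ?_ ?_ ?_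
    · exact fun a _ b _ hab => add_right_cancel hab
    · intro β hβ
      rw [Finset.mem_coe, mem_weightFinset] at hβ ⊢
      rw [weight_add_single, hβ, Nat.succPNat_coe]
      have := mem_antidiagonal.mp hp
      omega
    · intro β hβ hne
      have : β p.1.succPNat = 0 := by
        by_contra h0
        refine hne ⟨β - Finsupp.single p.1.succPNat 1, ?_, ?_⟩
        · rw [mem_weightFinset] at hβ
          rw [Finset.mem_coe, mem_weightFinset]
          have h1 : β - Finsupp.single p.1.succPNat 1 + Finsupp.single p.1.succPNat 1 = β :=
            tsub_add_cancel_of_le (Finsupp.single_le_iff.mpr (Nat.one_le_iff_ne_zero.mpr h0))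
          have h2 := weight_add_single (β - Finsupp.single p.1.succPNat 1) p.1.succPNat
          rw [h1, hβ, Nat.succPNat_coe] at h2
          have := mem_antidiagonal.mp hp
          omega
        · exact tsub_add_cancel_of_le (Finsupp.single_le_iff.mpr (Nat.one_le_iff_ne_zero.mpr h0))
      simp [this]
    · intro β _
      rw [coeff_ddt, ← add_assoc]
      have h := shiftWeight_add_single ε α β p.1.succPNat
      have hε : ((ε : ℤ) : ℚ) * ((ε : ℤ) : ℚ) = 1 := by exact_mod_cast unit_mul_self ε
      have h' : ((ε : ℤ) : ℚ) * (shiftWeight ε α (β + Finsupp.single p.1.succPNat 1)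
          * ((p.1 + 1 : ℕ) * ((β + Finsupp.single p.1.succPNat 1 : ℕ+ →₀ ℕ) p.1.succPNat : ℕ)))
          = shiftWeight ε α β * (((α + β) p.1.succPNat : ℕ) + 1) := by
        rw [Nat.succPNat_coe] at h
        simp only [Finsupp.add_apply, Finsupp.single_eq_same]
        push_cast at h ⊢
        linear_combination ((ε : ℤ) : ℚ) * h + (shiftWeight ε α β *
          ((α p.1.succPNat : ℚ) + (β p.1.succPNat : ℚ) + 1)) * hε
      rw [h', map_mul, map_add, map_natCast, map_one]
      ring
  rw [map_nsmul, map_zsmul, map_sum, Finset.sum_congr rfl key, Finset.sum_comm, coeff_hs,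
    Finset.smul_sum, Finset.smul_sum]
  refine Finset.sum_congr rfl fun β hβ => ?_
  rw [← Finset.sum_mul, ← map_sum, ← Finset.mul_sum, ← Finset.mul_sum]
  have h := weight_eq_sum (mem_weightFinset.mp hβ)
  have h' : ∑ p ∈ antidiagonal n, (((p.1 + 1 : ℕ) : ℚ) * (β p.1.succPNat : ℚ)) = n + 1 := by
    exact_mod_cast h
  rw [h', zsmul_eq_mul, nsmul_eq_mul, ← map_intCast (algebraMap ℚ R), ← map_natCast (algebraMap ℚ R),
    ← mul_assoc, ← mul_assoc, ← map_mul, ← map_mul]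
  congr 2
  have hε : ((ε : ℤ) : ℚ) * ((ε : ℤ) : ℚ) = 1 := by exact_mod_cast unit_mul_self ε
  push_cast
  linear_combination -(n + 1 : ℚ) * shiftWeight ε α β * hε

end Shift

/-! ### Reindexing of convolution sums -/

section Antidiagonal

variable {M : Type*} [AddCommMonoid M]

theorem sum_antidiagonal_assoc (n : ℕ) (F : ℕ → ℕ → ℕ → M) :
    ∑ p ∈ antidiagonal n, ∑ q ∈ antidiagonal p.2, F p.1 q.1 q.2
      = ∑ p ∈ antidiagonal n, ∑ q ∈ antidiagonal p.1, F q.1 q.2 p.2 := by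
  rw [Finset.sum_sigma', Finset.sum_sigma']
  refine Finset.sum_nbij' (fun x => ⟨(x.1.1 + x.2.1, x.2.2), (x.1.1, x.2.1)⟩)
    (fun x => ⟨(x.2.1, x.2.2 + x.1.2), (x.2.2, x.1.2)⟩) ?_ ?_ ?_ ?_ ?_
  · rintro ⟨⟨a, b⟩, ⟨c, d⟩⟩ h
    simp only [Finset.mem_sigma, mem_antidiagonal] at h ⊢
    exact ⟨by omega, by trivial⟩
  · rintro ⟨⟨a, b⟩, ⟨c, d⟩⟩ h
    simp only [Finset.mem_sigma, mem_antidiagonal] at h ⊢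
    exact ⟨by omega, by trivial⟩
  · rintro ⟨⟨a, b⟩, ⟨c, d⟩⟩ h
    simp only [Finset.mem_sigma, mem_antidiagonal] at h
    obtain ⟨_, rfl⟩ := h
    rfl
  · rintro ⟨⟨a, b⟩, ⟨c, d⟩⟩ h
    simp only [Finset.mem_sigma, mem_antidiagonal] at h
    obtain ⟨_, rfl⟩ := h
    rfl
  · rintro ⟨⟨a, b⟩, ⟨c, d⟩⟩ _
    rfl

theorem sum_antidiagonal_swap (n : ℕ) (F : ℕ → ℕ → M) :
    ∑ p ∈ antidiagonal n, F p.2 p.1 = ∑ p ∈ antidiagonal n, F p.1 p.2 :=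
  Finset.Nat.sum_antidiagonal_swap (f := fun p => F p.1 p.2)

end Antidiagonal

/-! ### The shifts as ring homomorphisms -/

section ShiftAlgebra

variable {R : Type u} [CommRing R] [Algebra ℚ R]

theorem nsmul_left_cancel {n : ℕ} {f g : Fun R} (h : (n + 1) • f = (n + 1) • g) : f = g := by
  have := IsAddTorsionFree.of_module_rat (Fun R)
  exact nsmul_right_injective n.succ_ne_zero h

/-- The coefficient of `λ⁻ⁿ` in the shift, as an additive map. -/
def hsHom (ε : ℤˣ) (n : ℕ) : Fun R →+ Fun R := AddMonoidHom.mk' (hs ε n) (hs_add ε n)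

theorem hs_zero_right (ε : ℤˣ) (n : ℕ) : hs ε n (0 : Fun R) = 0 := map_zero (hsHom ε n)
theorem hs_zsmul (ε : ℤˣ) (n : ℕ) (c : ℤ) (f : Fun R) : hs ε n (c • f) = c • hs ε n f :=
  map_zsmul (hsHom ε n) c f
theorem hs_nsmul (ε : ℤˣ) (n : ℕ) (c : ℕ) (f : Fun R) : hs ε n (c • f) = c • hs ε n f :=
  map_nsmul (hsHom ε n) c f
theorem hs_sum (ε : ℤˣ) (n : ℕ) {ι : Type*} (s : Finset ι) (f : ι → Fun R) :
    hs ε n (∑ i ∈ s, f i) = ∑ i ∈ s, hs ε n (f i) := map_sum (hsHom ε n) f s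

/-- The recursion `succ_smul_hs` determines every coefficient of the shift from lower ones applied
to derivatives. Strong induction on it, followed by division by n + 1, replaces all further work
with the explicit coefficients. -/
theorem ddt_hs (m : ℕ+) (ε : ℤˣ) (n : ℕ) (f : Fun R) : ddt m (hs ε n f) = hs ε n (ddt m f) := by
  induction n using Nat.strong_induction_on generalizing f with
  | _ n ih =>
    cases n with
    | zero => rw [hs_zero, hs_zero]
    | succ n =>
      refine nsmul_left_cancel (n := n) ?_
      rw [← ddt_nsmul, succ_smul_hs, succ_smul_hs, ddt_zsmul, ddt_sum]
      congr 1
      refine Finset.sum_congr rfl fun p hp => ?_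
      rw [ih _ (Nat.lt_succ_of_le (Finset.HasAntidiagonal.antidiagonal.snd_le hp)), ddt_comm]

theorem hs_C (ε : ℤˣ) (n : ℕ) (r : R) :
    hs ε n (MvPowerSeries.C r) = if n = 0 then MvPowerSeries.C r else 0 := by
  cases n with
  | zero => rw [hs_zero, if_pos rfl]
  | succ n =>
    refine nsmul_left_cancel (n := n) ?_
    rw [succ_smul_hs, if_neg n.succ_ne_zero, smul_zero,
      Finset.sum_eq_zero fun p _ => by rw [ddt_C, hs_zero_right], smul_zero]

theorem hs_one (ε : ℤˣ) (n : ℕ) : hs ε n (1 : Fun R) = if n = 0 then 1 else 0 := hs_C ε n 1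

theorem hs_map {S : Type v} [CommRing S] [Algebra ℚ S] (φ : R →+* S) (ε : ℤˣ) (n : ℕ) (f : Fun R) :
    hs ε n (MvPowerSeries.map φ f) = MvPowerSeries.map φ (hs ε n f) := by
  induction n using Nat.strong_induction_on generalizing f with
  | _ n ih =>
    cases n with
    | zero => rw [hs_zero, hs_zero]
    | succ n =>
      refine nsmul_left_cancel (n := n) ?_
      rw [succ_smul_hs, ← map_nsmul, succ_smul_hs, map_zsmul, map_sum]
      congr 1
      refine Finset.sum_congr rfl fun p hp => ?_
      rw [ddt_map, ih _ (Nat.lt_succ_of_le (Finset.HasAntidiagonal.antidiagonal.snd_le hp))]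

/-- Multiplying by the index of the first factor, in a convolution with a shift. -/
theorem sum_fst_smul_hs {M : Type*} [AddCommGroup M] (ε : ℤˣ) (n : ℕ) (f : Fun R)
    (F : ℕ → Fun R →+ M) :
    ∑ p ∈ antidiagonal (n + 1), F p.2 (p.1 • hs ε p.1 f)
      = (ε : ℤ) • ∑ p ∈ antidiagonal n, ∑ q ∈ antidiagonal p.2,
          F q.2 (hs ε q.1 (ddt p.1.succPNat f)) := by
  rw [Finset.Nat.sum_antidiagonal_succ, zero_smul, map_zero, zero_add,
    sum_antidiagonal_assoc n (fun l a b => F b (hs ε a (ddt l.succPNat f))), Finset.smul_sum]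
  refine Finset.sum_congr rfl fun p _ => ?_
  rw [succ_smul_hs, map_zsmul, map_sum]

/-- A shift of the arguments is multiplicative. Writing n + 1 = p.1 + p.2 in the convolution, the
recursion for each factor gives the two halves of the Leibniz rule for ∂ₗ(fg). -/
theorem hs_mul (ε : ℤˣ) (n : ℕ) (f g : Fun R) :
    hs ε n (f * g) = ∑ p ∈ antidiagonal n, hs ε p.1 f * hs ε p.2 g := by
  induction n using Nat.strong_induction_on generalizing f g with
  | _ n ih =>
    cases n with
    | zero => simp
    | succ n =>
      refine nsmul_left_cancel (n := n) ?_
      have h1 := sum_fst_smul_hs ε n f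
        (fun b => (AddMonoidHom.mulRight (hs ε b g) : Fun R →+ Fun R))
      have h2 := sum_fst_smul_hs ε n g
        (fun b => (AddMonoidHom.mulLeft (hs ε b f) : Fun R →+ Fun R))
      simp only [AddMonoidHom.coe_mulRight, AddMonoidHom.coe_mulLeft] at h1 h2
      rw [sum_antidiagonal_swap (n + 1) (fun a b => hs ε a f * b • hs ε b g)] at h2
      have h3 : (n + 1) • ∑ p ∈ antidiagonal (n + 1), hs ε p.1 f * hs ε p.2 g
          = ∑ p ∈ antidiagonal (n + 1), (p.1 • hs ε p.1 f) * hs ε p.2 g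
            + ∑ p ∈ antidiagonal (n + 1), hs ε p.1 f * p.2 • hs ε p.2 g := by
        rw [← Finset.sum_add_distrib, Finset.smul_sum]
        refine Finset.sum_congr rfl fun p hp => ?_
        rw [← mem_antidiagonal.mp hp, add_smul, smul_mul_assoc, mul_smul_comm]
      rw [h3, h1, h2, ← smul_add, ← Finset.sum_add_distrib, succ_smul_hs]
      congr 1
      refine Finset.sum_congr rfl fun p hp => ?_
      have hlt := Nat.lt_succ_of_le (Finset.HasAntidiagonal.antidiagonal.snd_le hp)
      rw [ddt_mul, hs_add, ih _ hlt, ih _ hlt,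
        sum_antidiagonal_swap p.2 (fun a b => hs ε a f * hs ε b (ddt p.1.succPNat g))]

/-- The shifts by `[λ⁻¹]` and by `-[λ⁻¹]` are inverse to each other. -/
theorem sum_hs_hs_neg (ε : ℤˣ) (n : ℕ) (f : Fun R) :
    ∑ p ∈ antidiagonal n, hs ε p.1 (hs (-ε) p.2 f) = if n = 0 then f else 0 := by
  cases n with
  | zero => simp
  | succ n =>
    rw [if_neg n.succ_ne_zero]
    refine nsmul_left_cancel (n := n) ?_
    have h2 := sum_fst_smul_hs (-ε) n f (fun b => hsHom ε b)
    change ∑ p ∈ antidiagonal (n + 1), hs ε p.2 (p.1 • hs (-ε) p.1 f) = _ at h2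
    rw [sum_antidiagonal_swap (n + 1) (fun a b => hs ε a (b • hs (-ε) b f))] at h2
    have h1 : ∑ p ∈ antidiagonal (n + 1), p.1 • hs ε p.1 (hs (-ε) p.2 f)
        = (ε : ℤ) • ∑ p ∈ antidiagonal n, ∑ q ∈ antidiagonal p.2,
            hs ε q.1 (hs (-ε) q.2 (ddt p.1.succPNat f)) := by
      rw [Finset.Nat.sum_antidiagonal_succ, zero_smul, zero_add,
        sum_antidiagonal_assoc n (fun l a b => hs ε a (hs (-ε) b (ddt l.succPNat f))),
        Finset.smul_sum]
      refine Finset.sum_congr rfl fun p _ => ?_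
      rw [succ_smul_hs]
      congr 1
      refine Finset.sum_congr rfl fun q _ => ?_
      rw [ddt_hs]
    have h3 : (n + 1) • ∑ p ∈ antidiagonal (n + 1), hs ε p.1 (hs (-ε) p.2 f)
        = ∑ p ∈ antidiagonal (n + 1), p.1 • hs ε p.1 (hs (-ε) p.2 f)
          + ∑ p ∈ antidiagonal (n + 1), hs ε p.1 (p.2 • hs (-ε) p.2 f) := by
      rw [← Finset.sum_add_distrib, Finset.smul_sum]
      refine Finset.sum_congr rfl fun p hp => ?_
      rw [← mem_antidiagonal.mp hp, add_smul, hs_nsmul]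
    -- The recursion for the outer shift carries the sign ε and the one for the inner shift −ε, in
    -- front of the same double sum.
    rw [h3, h1, h2, smul_zero, Units.val_neg, neg_smul, ← sub_eq_add_neg, sub_eq_zero]
    congr 1
    refine Finset.sum_congr rfl fun p _ => ?_
    exact (sum_antidiagonal_swap p.2
      (fun a b => hs ε a (hs (-ε) b (ddt p.1.succPNat f)))).symm

/-- `f ↦ f(t + ε [λ⁻¹])`, as a ring homomorphism to the power series in `λ⁻¹`. -/
def shiftHom (R : Type u) [CommRing R] [Algebra ℚ R] (ε : ℤˣ) : Fun R →+* PowerSeries (Fun R) where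
  toFun f := PowerSeries.mk fun n => hs ε n f
  map_one' := by
    ext n : 1
    rw [PowerSeries.coeff_mk, hs_one, PowerSeries.coeff_one]
  map_zero' := by
    ext n : 1
    rw [PowerSeries.coeff_mk, hs_zero_right, map_zero]
  map_mul' f g := by
    ext n : 1
    simp only [PowerSeries.coeff_mul, PowerSeries.coeff_mk, hs_mul]
  map_add' f g := by
    ext n : 1
    simp only [map_add, PowerSeries.coeff_mk, hs_add]

@[simp] theorem coeff_shiftHom (ε : ℤˣ) (f : Fun R) (n : ℕ) :
    PowerSeries.coeff n (shiftHom R ε f) = hs ε n f :=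
  PowerSeries.coeff_mk n (fun n => hs ε n f)

/-- The shift of a power series in `λ⁻¹` by `ε [λ⁻¹]`, with the same parameter. -/
def shiftSeries (ε : ℤˣ) : PowerSeries (Fun R) →+ PowerSeries (Fun R) where
  toFun g := PowerSeries.mk fun n =>
    ∑ p ∈ antidiagonal n, hs ε p.1 (PowerSeries.coeff p.2 g)
  map_zero' := by
    ext n : 1
    simp only [PowerSeries.coeff_mk, map_zero, hs_zero_right, Finset.sum_const_zero]
  map_add' f g := by
    ext n : 1
    simp only [PowerSeries.coeff_mk, map_add, hs_add, Finset.sum_add_distrib]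

theorem coeff_shiftSeries (ε : ℤˣ) (g : PowerSeries (Fun R)) (n : ℕ) :
    PowerSeries.coeff n (shiftSeries ε g)
      = ∑ p ∈ antidiagonal n, hs ε p.1 (PowerSeries.coeff p.2 g) :=
  PowerSeries.coeff_mk n (fun n => ∑ p ∈ antidiagonal n, hs ε p.1 (PowerSeries.coeff p.2 g))

theorem shiftSeries_shiftHom_neg (ε : ℤˣ) (f : Fun R) :
    shiftSeries ε (shiftHom R (-ε) f) = PowerSeries.C f := by
  ext n : 1
  simp only [coeff_shiftSeries, coeff_shiftHom, sum_hs_hs_neg, PowerSeries.coeff_C]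

theorem shiftSeries_C (ε : ℤˣ) (f : Fun R) : shiftSeries ε (PowerSeries.C f) = shiftHom R ε f := by
  ext n : 1
  rw [coeff_shiftSeries, coeff_shiftHom, Finset.sum_eq_single (n, 0)]
  · rw [PowerSeries.coeff_C, if_pos rfl]
  · rintro ⟨a, b⟩ hp hne
    rw [mem_antidiagonal] at hp
    have : b ≠ 0 := by rintro rfl; exact hne (by rw [← hp]; rfl)
    rw [PowerSeries.coeff_C, if_neg this, hs_zero_right]
  · exact fun h => absurd (mem_antidiagonal.mpr (add_zero n)) h

theorem shiftSeries_mul_C (ε : ℤˣ) (g : PowerSeries (Fun R)) (f : Fun R) :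
    shiftSeries ε (g * PowerSeries.C f) = shiftSeries ε g * shiftHom R ε f := by
  ext n : 1
  rw [coeff_shiftSeries, PowerSeries.coeff_mul]
  simp only [coeff_shiftSeries, coeff_shiftHom, PowerSeries.coeff_mul_C, Finset.sum_mul, hs_mul]
  rw [← sum_antidiagonal_assoc n fun a b c => hs ε a (PowerSeries.coeff b g) * hs ε c f,
    ← sum_antidiagonal_assoc n fun a c b => hs ε a (PowerSeries.coeff b g) * hs ε c f]
  refine Finset.sum_congr rfl fun p _ => ?_
  exact sum_antidiagonal_swap p.2
    fun b c => hs ε p.1 (PowerSeries.coeff b g) * hs ε c f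

theorem shiftSeries_X_mul (ε : ℤˣ) (g : PowerSeries (Fun R)) :
    shiftSeries ε (PowerSeries.X * g) = PowerSeries.X * shiftSeries ε g := by
  ext n : 1
  cases n with
  | zero => simp [coeff_shiftSeries, hs_zero_right]
  | succ n =>
    rw [PowerSeries.coeff_succ_X_mul, coeff_shiftSeries, coeff_shiftSeries,
      Finset.Nat.sum_antidiagonal_succ', PowerSeries.coeff_zero_X_mul, hs_zero_right, zero_add]
    simp only [PowerSeries.coeff_succ_X_mul]

end ShiftAlgebra

namespace PDO

/-! ### Coefficients -/

section Coefficients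

variable {R : Type u} [CommRing R]

theorem ext_co {P Q : PDO R} (h : ∀ j, P.co j = Q.co j) : P = Q := by
  ext1
  funext n
  have := h (-n)
  rwa [co, co, neg_neg] at this

@[simp] theorem co_zero (m : ℤ) : (0 : PDO R).co m = 0 := rfl
@[simp] theorem co_add (P Q : PDO R) (m : ℤ) : (P + Q).co m = P.co m + Q.co m := rfl
@[simp] theorem co_sub (P Q : PDO R) (m : ℤ) : (P - Q).co m = P.co m - Q.co m := rfl
@[simp] theorem co_neg (P : PDO R) (m : ℤ) : (-P).co m = -P.co m := rfl
theorem co_zsmul (c : ℤ) (P : PDO R) (m : ℤ) : (c • P).co m = c • P.co m := rfl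

/-- The coefficient of `D ^ m`, as an additive map. -/
def coHom (m : ℤ) : PDO R →+ Fun R := AddMonoidHom.mk' (fun P => P.co m) fun _ _ => rfl

theorem co_sum (m : ℤ) {ι : Type*} (s : Finset ι) (P : ι → PDO R) :
    (∑ i ∈ s, P i).co m = ∑ i ∈ s, (P i).co m := map_sum (coHom m) P s

theorem co_D (n m : ℤ) : (D n : PDO R).co m = if m = n then 1 else 0 := by
  rw [co, D]
  split_ifs with h
  · rw [h, HahnSeries.coeff_single_same]
  · rw [HahnSeries.coeff_single_of_ne (by omega)]

theorem co_ofFun (f : Fun R) (m : ℤ) : (ofFun f).co m = if m = 0 then f else 0 := by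
  rw [co, ofFun]
  split_ifs with h
  · rw [h, neg_zero, HahnSeries.coeff_single_same]
  · rw [HahnSeries.coeff_single_of_ne (by omega)]

theorem exists_co_bound (P : PDO R) : ∃ M : ℤ, ∀ i, M < i → P.co i = 0 := by
  obtain ⟨N, hN⟩ := exists_bound P
  exact ⟨-N, fun i hi => hN _ (by omega)⟩

theorem exists_co_bound₃ (P Q S : PDO R) : ∃ M : ℤ, 0 ≤ M ∧ (∀ i, M < i → P.co i = 0) ∧
    (∀ i, M < i → Q.co i = 0) ∧ ∀ i, M < i → S.co i = 0 := by
  obtain ⟨A, hA⟩ := exists_co_bound P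
  obtain ⟨B, hB⟩ := exists_co_bound Q
  obtain ⟨C, hC⟩ := exists_co_bound S
  exact ⟨max 0 (max A (max B C)), by omega, fun i hi => hA i (by omega),
    fun i hi => hB i (by omega), fun i hi => hC i (by omega)⟩

/-- The binomial coefficient, zero for a negative lower index. -/
def ch (i k : ℤ) : ℤ := if 0 ≤ k then Ring.choose i k.toNat else 0

theorem ch_of_neg {i k : ℤ} (h : k < 0) : ch i k = 0 := if_neg (not_le.mpr h)
theorem ch_of_nonneg {i k : ℤ} (h : 0 ≤ k) : ch i k = Ring.choose i k.toNat := if_pos h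
@[simp] theorem ch_zero_right (i : ℤ) : ch i 0 = 1 := by simp [ch]

theorem ch_zero_left {k : ℤ} (h : k ≠ 0) : ch 0 k = 0 := by
  rw [ch]
  split_ifs with h0
  · rw [Ring.choose_zero_pos ℤ (by omega)]
  · rfl

/-- The index sets may be any finite sets containing the relevant intervals, so that several
products can be expanded over one common box; `ch` removes the pairs with i + j < m. -/
theorem co_mul (P Q : PDO R) (m : ℤ) {M N : ℤ} (hP : ∀ i, M < i → P.co i = 0)
    (hQ : ∀ j, N < j → Q.co j = 0) (I J : Finset ℤ) (hI : Finset.Icc (m - N) M ⊆ I)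
    (hJ : Finset.Icc (m - M) N ⊆ J) :
    (P ⋆ Q).co m = ∑ i ∈ I, ∑ j ∈ J,
      ch i (i + j - m) • (P.co i * dx (i + j - m).toNat (Q.co j)) := by
  have h0 : (P ⋆ Q).co m = mulCo P Q m := by
    rw [co, mul, HahnSeries.coeff_ofSuppBddBelow, neg_neg]
  rw [h0, mulCo, ← Finset.sum_product']
  have hsub : (Function.support fun p : ℤ × ℕ =>
      Ring.choose p.1 p.2 • (P.co p.1 * dx p.2 (Q.co (m - p.1 + p.2)))) ⊆
      (((I ×ˢ J).filter fun p => m ≤ p.1 + p.2).image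
        fun p => (p.1, (p.1 + p.2 - m).toNat) : Finset (ℤ × ℕ)) := by
    rintro ⟨i, k⟩ hp
    have h1 : i ≤ M := by
      by_contra h
      exact hp (by simp only [hP i (not_le.mp h), zero_mul, smul_zero])
    have h2 : m - i + k ≤ N := by
      by_contra h
      exact hp (by simp only [hQ _ (not_le.mp h), dx_zero, mul_zero, smul_zero])
    rw [Finset.mem_coe, Finset.mem_image]
    refine ⟨(i, m - i + k), ?_, ?_⟩
    · rw [Finset.mem_filter, Finset.mem_product]
      exact ⟨⟨hI (Finset.mem_Icc.mpr ⟨by simp only; omega, h1⟩),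
        hJ (Finset.mem_Icc.mpr ⟨by simp only; omega, h2⟩)⟩, by simp only; omega⟩
    · simp only [Prod.mk.injEq, true_and]; omega
  rw [finsum_eq_sum_of_support_subset _ hsub, Finset.sum_image, Finset.sum_filter]
  · refine Finset.sum_congr rfl fun p _ => ?_
    split_ifs with h
    · rw [ch_of_nonneg (by omega), show m - p.1 + ((p.1 + p.2 - m).toNat : ℤ) = p.2 by omega]
    · rw [ch_of_neg (by omega), zero_smul]
  · rintro ⟨i, j⟩ h ⟨i', j'⟩ h' he
    rw [Finset.mem_coe, Finset.mem_filter] at h h'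
    simp only [Prod.mk.injEq] at he h h' ⊢
    omega

theorem co_mul_eq_zero {P Q : PDO R} {M N : ℤ} (hP : ∀ i, M < i → P.co i = 0)
    (hQ : ∀ j, N < j → Q.co j = 0) {m : ℤ} (h : M + N < m) : (P ⋆ Q).co m = 0 := by
  rw [co_mul P Q m hP hQ _ _ subset_rfl subset_rfl, Finset.Icc_eq_empty (by omega),
    Finset.sum_empty]

/-- The sign `(-1) ^ i`. -/
def sg (i : ℤ) : ℤ := (((-1 : ℤˣ) ^ i : ℤˣ) : ℤ)

theorem co_adj (P : PDO R) (m : ℤ) {M : ℤ} (hP : ∀ i, M < i → P.co i = 0) (I : Finset ℤ)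
    (hI : Finset.Icc m M ⊆ I) :
    (adj P).co m = ∑ i ∈ I, sg i • (ch i (i - m) • dx (i - m).toNat (P.co i)) := by
  have h0 : (adj P).co m = adjCo P m := by
    rw [co, adj, HahnSeries.coeff_ofSuppBddBelow, neg_neg]
  rw [h0, adjCo]
  have hsub : (Function.support fun k : ℕ => (((-1 : ℤˣ) ^ (m + k) : ℤˣ) : ℤ) •
      (Ring.choose (m + k) k • dx k (P.co (m + k)))) ⊆
      ((I.filter fun i => m ≤ i).image fun i => (i - m).toNat : Finset ℕ) := by
    intro k hk
    have h1 : m + k ≤ M := by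
      by_contra h
      exact hk (by simp only [hP _ (not_le.mp h), dx_zero, smul_zero])
    rw [Finset.mem_coe, Finset.mem_image]
    exact ⟨m + k, Finset.mem_filter.mpr ⟨hI (Finset.mem_Icc.mpr ⟨by omega, h1⟩), by omega⟩,
      by omega⟩
  rw [finsum_eq_sum_of_support_subset _ hsub, Finset.sum_image, Finset.sum_filter]
  · refine Finset.sum_congr rfl fun i _ => ?_
    split_ifs with h
    · rw [ch_of_nonneg (by omega), show m + ((i - m).toNat : ℤ) = i by omega, sg]
    · rw [ch_of_neg (by omega), zero_smul, smul_zero]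
  · intro i h i' h' he
    rw [Finset.mem_coe, Finset.mem_filter] at h h'
    simp only at he
    omega

end Coefficients

/-! ### Associativity -/

section Associativity

variable {R : Type u} [CommRing R]

/-- For fixed orders of the factors, the sum over the intermediate order s is a convolution with p =
u − s and q = s − v. In this form Vandermonde's identity applies. -/
theorem sum_eq_antidiagonal {A : Type*} [AddCommMonoid A] (S : Finset ℤ) (v u : ℤ)
    (hS : Finset.Icc v u ⊆ S) (f : ℕ → ℕ → A) (g : ℤ → A)
    (hg : ∀ s, v ≤ s → s ≤ u → g s = f (u - s).toNat (s - v).toNat)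
    (hg' : ∀ s, ¬(v ≤ s ∧ s ≤ u) → g s = 0) :
    ∑ s ∈ S, g s = if v ≤ u then ∑ p ∈ antidiagonal (u - v).toNat, f p.1 p.2 else 0 := by
  rw [← Finset.sum_subset hS fun s _ hs => hg' s (by rwa [Finset.mem_Icc] at hs)]
  split_ifs with h
  · refine Finset.sum_nbij' (fun s => ((u - s).toNat, (s - v).toNat)) (fun p => v + p.2) ?_ ?_ ?_ ?_ ?_
    · intro s hs
      rw [Finset.mem_Icc] at hs
      rw [mem_antidiagonal]
      omega
    · intro p hp
      rw [mem_antidiagonal] at hp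
      rw [Finset.mem_Icc]
      omega
    · intro s hs
      rw [Finset.mem_Icc] at hs
      simp only
      omega
    · rintro ⟨a, b⟩ hp
      rw [mem_antidiagonal] at hp
      simp only [Prod.mk.injEq] at hp ⊢
      omega
    · intro s hs
      rw [Finset.mem_Icc] at hs
      exact hg s hs.1 hs.2
  · rw [Finset.Icc_eq_empty h, Finset.sum_empty]

theorem choose_add_mul_choose (i : ℤ) (a b : ℕ) :
    Ring.choose i (a + b) * ((a + b).choose a : ℤ) = Ring.choose i a * Ring.choose (i - a) b := by
  have := Ring.choose_smul_choose i (Nat.le_add_right a b)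
  rw [Nat.add_sub_cancel_left, nsmul_eq_mul] at this
  rw [← this, mul_comm]

theorem sum_choose_mul_choose (x y : ℤ) (n : ℕ) :
    ∑ p ∈ antidiagonal n, Ring.choose x p.1 * Ring.choose y p.2 = Ring.choose (x + y) n :=
  (Ring.add_choose_eq n (Commute.all x y)).symm

/-- These are the two expansions of Dⁱ f Dʲ g. After the Leibniz rule on the right, the binomials in
i − a and j, where a is the number of derivatives on f, combine by Vandermonde. -/
theorem leibniz_assoc (i j : ℤ) (n : ℕ) (f g : Fun R) :
    ∑ p ∈ antidiagonal n, (Ring.choose i p.1 * Ring.choose (i + j - p.1) p.2) •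
        (dx p.1 f * dx p.2 g)
      = ∑ p ∈ antidiagonal n, (Ring.choose i p.2 * Ring.choose j p.1) • dx p.2 (f * dx p.1 g) := by
  have h1 : ∀ p ∈ antidiagonal n,
      (Ring.choose i p.2 * Ring.choose j p.1) • dx p.2 (f * dx p.1 g)
        = ∑ q ∈ antidiagonal p.2, (Ring.choose i q.1 * (Ring.choose (i - q.1) q.2 *
            Ring.choose j p.1)) • (dx q.1 f * dx (q.2 + p.1) g) := by
    intro p _
    rw [dx_mul, Finset.smul_sum]
    refine Finset.sum_congr rfl fun q hq => ?_
    rw [← mem_antidiagonal.mp hq, ← natCast_zsmul, smul_smul, ← dx_add, mul_right_comm,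
      choose_add_mul_choose, mul_assoc]
  rw [Finset.sum_congr rfl h1, ← sum_antidiagonal_swap n (fun x y => ∑ q ∈ antidiagonal y,
    (Ring.choose i q.1 * (Ring.choose (i - q.1) q.2 *
            Ring.choose j x)) • (dx q.1 f * dx (q.2 + x) g)),
    ← sum_antidiagonal_assoc n (fun a b y => (Ring.choose i a * (Ring.choose (i - a) b *
            Ring.choose j y)) • (dx a f * dx (b + y) g))]
  refine Finset.sum_congr rfl fun p _ => ?_
  rw [show i + j - (p.1 : ℤ) = (i - p.1) + j by ring, ← sum_choose_mul_choose, Finset.mul_sum,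
    Finset.sum_smul]
  refine Finset.sum_congr rfl fun q hq => ?_
  rw [mem_antidiagonal.mp hq]

theorem mul_assoc' (P Q S : PDO R) : (P ⋆ Q) ⋆ S = P ⋆ (Q ⋆ S) := by
  obtain ⟨M, hM, hP, hQ, hS⟩ := exists_co_bound₃ P Q S
  refine ext_co fun m => ?_
  have hPQ : ∀ i, 2 * M < i → (P ⋆ Q).co i = 0 := fun i hi => co_mul_eq_zero hP hQ (by omega)
  have hQS : ∀ i, 2 * M < i → (Q ⋆ S).co i = 0 := fun i hi => co_mul_eq_zero hQ hS (by omega)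
  -- With all orders at most M, where M ≥ 0, the box B contains the orders of the three factors and
  -- T the orders of the intermediate products that can contribute to Dᵐ.
  set B := Finset.Icc (m - 2 * M) M with hB
  set T := Finset.Icc (m - M) (2 * M) with hT
  rw [co_mul (P ⋆ Q) S m hPQ hS T B (by rfl) (by rfl),
    co_mul P (Q ⋆ S) m hP hQS B T (by rfl) (by rfl)]
  have h1 : ∀ s ∈ T, (P ⋆ Q).co s = ∑ i ∈ B, ∑ j ∈ B,
      ch i (i + j - s) • (P.co i * dx (i + j - s).toNat (Q.co j)) := by
    intro s hs
    rw [hT, Finset.mem_Icc] at hs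
    exact co_mul P Q s hP hQ B B (Finset.Icc_subset_Icc (by omega) le_rfl)
      (Finset.Icc_subset_Icc (by omega) le_rfl)
  have h2 : ∀ s ∈ T, (Q ⋆ S).co s = ∑ j ∈ B, ∑ k ∈ B,
      ch j (j + k - s) • (Q.co j * dx (j + k - s).toNat (S.co k)) := by
    intro s hs
    rw [hT, Finset.mem_Icc] at hs
    exact co_mul Q S s hQ hS B B (Finset.Icc_subset_Icc (by omega) le_rfl)
      (Finset.Icc_subset_Icc (by omega) le_rfl)
  have h3 : ∑ s ∈ T, ∑ k ∈ B, ch s (s + k - m) • ((P ⋆ Q).co s * dx (s + k - m).toNat (S.co k))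
      = ∑ i ∈ B, ∑ j ∈ B, ∑ k ∈ B, ∑ s ∈ T, (ch i (i + j - s) * ch s (s + k - m)) •
        (P.co i * (dx (i + j - s).toNat (Q.co j) * dx (s + k - m).toNat (S.co k))) := by
    have : ∀ s ∈ T, ∑ k ∈ B, ch s (s + k - m) • ((P ⋆ Q).co s * dx (s + k - m).toNat (S.co k))
        = ∑ i ∈ B, ∑ j ∈ B, ∑ k ∈ B, (ch i (i + j - s) * ch s (s + k - m)) •
        (P.co i * (dx (i + j - s).toNat (Q.co j) * dx (s + k - m).toNat (S.co k))) := by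
      intro s hs
      rw [h1 s hs]
      simp only [Finset.sum_mul, Finset.smul_sum]
      rw [Finset.sum_comm]
      refine Finset.sum_congr rfl fun i _ => ?_
      rw [Finset.sum_comm]
      refine Finset.sum_congr rfl fun j _ => Finset.sum_congr rfl fun k _ => ?_
      rw [smul_mul_assoc, smul_smul, mul_comm (ch s _), mul_assoc (P.co i)]
    rw [Finset.sum_congr rfl this, Finset.sum_comm]
    refine Finset.sum_congr rfl fun i _ => ?_
    rw [Finset.sum_comm]
    refine Finset.sum_congr rfl fun j _ => ?_
    rw [Finset.sum_comm]
  have h4 : ∑ i ∈ B, ∑ s ∈ T, ch i (i + s - m) • (P.co i * dx (i + s - m).toNat ((Q ⋆ S).co s))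
      = ∑ i ∈ B, ∑ j ∈ B, ∑ k ∈ B, ∑ s ∈ T, (ch i (i + s - m) * ch j (j + k - s)) •
        (P.co i * dx (i + s - m).toNat (Q.co j * dx (j + k - s).toNat (S.co k))) := by
    refine Finset.sum_congr rfl fun i _ => ?_
    have : ∀ s ∈ T, ch i (i + s - m) • (P.co i * dx (i + s - m).toNat ((Q ⋆ S).co s))
        = ∑ j ∈ B, ∑ k ∈ B, (ch i (i + s - m) * ch j (j + k - s)) •
        (P.co i * dx (i + s - m).toNat (Q.co j * dx (j + k - s).toNat (S.co k))) := by
      intro s hs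
      rw [h2 s hs]
      simp only [dx_sum, Finset.mul_sum, Finset.smul_sum, dx_zsmul, mul_smul_comm, smul_smul]
    rw [Finset.sum_congr rfl this, Finset.sum_comm]
    refine Finset.sum_congr rfl fun j _ => ?_
    rw [Finset.sum_comm]
  rw [h3, h4]
  -- Three monomials remain fixed; only the intermediate order s is still summed.
  refine Finset.sum_congr rfl fun i hi => Finset.sum_congr rfl fun j hj =>
    Finset.sum_congr rfl fun k hk => ?_
  rw [hB, Finset.mem_Icc] at hi hj hk
  rw [sum_eq_antidiagonal T (m - k) (i + j) (Finset.Icc_subset_Icc (by omega) (by omega))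
      (fun p q => P.co i * ((Ring.choose i p * Ring.choose (i + j - p) q) •
        (dx p (Q.co j) * dx q (S.co k)))),
    sum_eq_antidiagonal T (m - i) (j + k) (Finset.Icc_subset_Icc (by omega) (by omega))
      (fun p q => P.co i * ((Ring.choose i q * Ring.choose j p) •
        (dx q (Q.co j * dx p (S.co k)))))]
  · rw [show j + k - (m - i) = i + j - (m - k) by ring]
    by_cases h : m - k ≤ i + j
    · rw [if_pos h, if_pos (by omega), ← Finset.mul_sum, ← Finset.mul_sum, leibniz_assoc]
    · rw [if_neg h, if_neg (by omega)]
  · intro s h h'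
    rw [ch_of_nonneg (by omega), ch_of_nonneg (by omega), mul_smul_comm,
      show s - (m - i) = i + s - m by ring]
  · intro s h
    rcases not_and_or.mp h with h | h
    · rw [ch_of_neg (by omega), zero_mul, zero_smul]
    · rw [ch_of_neg (k := j + k - s) (by omega), mul_zero, zero_smul]
  · intro s h h'
    rw [ch_of_nonneg (by omega), ch_of_nonneg (by omega), mul_smul_comm,
      show s - (m - k) = s + k - m by ring,
      show i + j - ((i + j - s).toNat : ℤ) = s by omega]
  · intro s h
    rcases not_and_or.mp h with h | h
    · rw [ch_of_neg (k := s + k - m) (by omega), mul_zero, zero_smul]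
    · rw [ch_of_neg (by omega), zero_mul, zero_smul]

end Associativity

/-! ### The ring structure of the operators -/

section Algebra

variable {R : Type u} [CommRing R]

theorem add_mul' (P Q S : PDO R) : (P + Q) ⋆ S = P ⋆ S + Q ⋆ S := by
  obtain ⟨M, -, hP, hQ, hS⟩ := exists_co_bound₃ P Q S
  refine ext_co fun m => ?_
  rw [co_add, co_mul P S m hP hS _ _ subset_rfl subset_rfl,
    co_mul Q S m hQ hS _ _ subset_rfl subset_rfl,
    co_mul (P + Q) S m (fun i hi => by rw [co_add, hP i hi, hQ i hi, add_zero]) hS _ _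
      subset_rfl subset_rfl]
  simp only [co_add, add_mul, smul_add, Finset.sum_add_distrib]

theorem mul_add' (P Q S : PDO R) : P ⋆ (Q + S) = P ⋆ Q + P ⋆ S := by
  obtain ⟨M, -, hP, hQ, hS⟩ := exists_co_bound₃ P Q S
  refine ext_co fun m => ?_
  rw [co_add, co_mul P S m hP hS _ _ subset_rfl subset_rfl,
    co_mul P Q m hP hQ _ _ subset_rfl subset_rfl,
    co_mul P (Q + S) m hP (fun i hi => by rw [co_add, hQ i hi, hS i hi, add_zero]) _ _
      subset_rfl subset_rfl]
  simp only [co_add, dx_map_add, mul_add, smul_add, Finset.sum_add_distrib]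

/-- Right multiplication by an operator. -/
def mulRight (S : PDO R) : PDO R →+ PDO R := AddMonoidHom.mk' (fun P => P ⋆ S) fun _ _ => add_mul' _ _ _

/-- Left multiplication by an operator. -/
def mulLeft (P : PDO R) : PDO R →+ PDO R := AddMonoidHom.mk' (fun Q => P ⋆ Q) fun _ _ => mul_add' _ _ _

theorem mul_zero' (P : PDO R) : P ⋆ 0 = 0 := map_zero (mulLeft P)
theorem neg_mul' (P S : PDO R) : (-P) ⋆ S = -(P ⋆ S) := map_neg (mulRight S) P
theorem sub_mul' (P Q S : PDO R) : (P - Q) ⋆ S = P ⋆ S - Q ⋆ S := map_sub (mulRight S) P Q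
theorem mul_sub' (P Q S : PDO R) : P ⋆ (Q - S) = P ⋆ Q - P ⋆ S := map_sub (mulLeft P) Q S
theorem zsmul_mul' (c : ℤ) (P S : PDO R) : (c • P) ⋆ S = c • (P ⋆ S) := map_zsmul (mulRight S) c P
theorem mul_zsmul' (c : ℤ) (P S : PDO R) : P ⋆ (c • S) = c • (P ⋆ S) := map_zsmul (mulLeft P) c S
theorem sum_mul' {ι : Type*} (s : Finset ι) (P : ι → PDO R) (S : PDO R) :
    (∑ i ∈ s, P i) ⋆ S = ∑ i ∈ s, P i ⋆ S := map_sum (mulRight S) P s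
theorem mul_sum' {ι : Type*} (s : Finset ι) (P : PDO R) (S : ι → PDO R) :
    P ⋆ (∑ i ∈ s, S i) = ∑ i ∈ s, P ⋆ S i := map_sum (mulLeft P) S s

theorem co_mul_D (P : PDO R) (n m : ℤ) : (P ⋆ D n).co m = P.co (m - n) := by
  obtain ⟨M, hP⟩ := exists_co_bound P
  rw [co_mul P (D n) m hP (N := n) (fun j hj => by rw [co_D, if_neg (by omega)])
    (insert (m - n) (Finset.Icc (m - n) M)) (insert n (Finset.Icc (m - M) n))
    (Finset.subset_insert _ _) (Finset.subset_insert _ _),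
    Finset.sum_eq_single_of_mem (m - n) (Finset.mem_insert_self _ _),
    Finset.sum_eq_single_of_mem n (Finset.mem_insert_self _ _)]
  · rw [show m - n + n - m = 0 by ring, ch_zero_right, one_smul, co_D, if_pos rfl]
    exact mul_one _
  · intro j _ hj
    rw [co_D, if_neg hj, dx_zero, mul_zero, smul_zero]
  · intro i _ hi
    refine Finset.sum_eq_zero fun j _ => ?_
    rw [co_D]
    split_ifs with h
    · rw [dx_one]
      split_ifs with h'
      · rw [ch_of_neg (by omega), zero_smul]
      · rw [mul_zero, smul_zero]
    · rw [dx_zero, mul_zero, smul_zero]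

theorem co_ofFun_mul (f : Fun R) (P : PDO R) (m : ℤ) : (ofFun f ⋆ P).co m = f * P.co m := by
  obtain ⟨M, hP⟩ := exists_co_bound P
  rw [co_mul (ofFun f) P m (M := 0) (fun j hj => by rw [co_ofFun, if_neg (by omega)]) hP
    (insert 0 (Finset.Icc (m - M) 0)) (insert m (Finset.Icc (m - 0) M))
    (Finset.subset_insert _ _) (Finset.subset_insert _ _),
    Finset.sum_eq_single_of_mem 0 (Finset.mem_insert_self _ _),
    Finset.sum_eq_single_of_mem m (Finset.mem_insert_self _ _)]
  · rw [zero_add, sub_self, ch_zero_right, one_smul, co_ofFun, if_pos rfl]; rfl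
  · intro j _ hj
    rw [ch_zero_left (by omega), zero_smul]
  · intro i _ hi
    refine Finset.sum_eq_zero fun j _ => ?_
    rw [co_ofFun, if_neg hi, zero_mul, smul_zero]

theorem co_D_one_mul (P : PDO R) (m : ℤ) : (D 1 ⋆ P).co m = P.co (m - 1) + ddt 1 (P.co m) := by
  obtain ⟨M, hP⟩ := exists_co_bound P
  rw [co_mul (D 1) P m (M := 1) (fun j hj => by rw [co_D, if_neg (by omega)]) hP
    (insert 1 (Finset.Icc (m - M) 1)) ({m - 1, m} ∪ (Finset.Icc (m - 1) M))
    (Finset.subset_insert _ _) Finset.subset_union_right,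
    Finset.sum_eq_single_of_mem 1 (Finset.mem_insert_self _ _),
    ← Finset.sum_subset (s₁ := {m - 1, m}) Finset.subset_union_left]
  · rw [Finset.sum_pair (by omega), co_D, if_pos rfl]
    simp only [one_mul, show 1 + (m - 1) - m = 0 by ring, show 1 + m - m = 1 by ring]
    simp [ch, dx_succ]
  · intro j _ hj
    simp only [Finset.mem_insert, Finset.mem_singleton] at hj
    rcases lt_or_ge j (m - 1) with h | h
    · rw [ch_of_neg (by omega), zero_smul]
    · have h2 : 2 ≤ (1 + j - m).toNat := by omega
      have := Ring.choose_natCast (R := ℤ) 1 (1 + j - m).toNat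
      rw [Nat.cast_one] at this
      rw [ch_of_nonneg (by omega), this, Nat.choose_eq_zero_of_lt h2, Nat.cast_zero, zero_smul]
  · intro i _ hi
    refine Finset.sum_eq_zero fun j _ => ?_
    rw [co_D, if_neg hi, zero_mul, smul_zero]

theorem mul_one' (P : PDO R) : P ⋆ D 0 = P := ext_co fun m => by rw [co_mul_D, sub_zero]

theorem D_zero_eq : (D 0 : PDO R) = ofFun 1 := rfl

theorem one_mul' (P : PDO R) : D 0 ⋆ P = P :=
  ext_co fun m => by rw [D_zero_eq, co_ofFun_mul, one_mul]

theorem D_mul_D (m n : ℤ) : (D m : PDO R) ⋆ D n = D (m + n) := by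
  refine ext_co fun k => ?_
  rw [co_mul_D, co_D, co_D]
  exact if_congr (by omega) rfl rfl

theorem ofFun_mul_ofFun (f g : Fun R) : ofFun f ⋆ ofFun g = ofFun (f * g) := by
  refine ext_co fun k => ?_
  rw [co_ofFun_mul, co_ofFun, co_ofFun]
  split_ifs <;> simp

/-! ### The adjoint -/

theorem sg_add (i j : ℤ) : sg (i + j) = sg i * sg j := by
  rw [sg, zpow_add, Units.val_mul, sg, sg]
theorem sg_mul_self (i : ℤ) : sg i * sg i = 1 := unit_mul_self _
@[simp] theorem sg_zero : sg 0 = 1 := by simp [sg]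
theorem sg_neg (i : ℤ) : sg (-i) = sg i := by
  have h := sg_add (-i) i
  rw [neg_add_cancel, sg_zero] at h
  linear_combination -sg (-i) * sg_mul_self i - sg i * h
theorem sg_sub (i j : ℤ) : sg (i - j) = sg i * sg j := by rw [sub_eq_add_neg, sg_add, sg_neg]
theorem sg_one : sg 1 = -1 := by simp [sg]

/-- Upper negation, valid for every integer x. It is used for the signs of the adjoint when orders
are negative. -/
theorem choose_eq_sg_mul (x : ℤ) (n : ℕ) :
    Ring.choose x n = sg n * Ring.choose (n - 1 - x) n := by
  have := Ring.choose_neg (-x) n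
  rw [neg_neg] at this
  rw [this, show -x + (n : ℤ) - 1 = n - 1 - x by ring]
  rfl

/-- Upper negation removes p from the upper index of the second binomial. Vandermonde then sums the
series, and a second upper negation gives the result. -/
theorem sum_sg_choose (i j : ℤ) (n : ℕ) :
    ∑ p ∈ antidiagonal n, sg (i + j - p.1) * (Ring.choose i p.1 * Ring.choose (i + j - p.1) p.2)
      = sg (i + j) * Ring.choose j n := by
  have h : ∀ p ∈ antidiagonal n,
      sg (i + j - p.1) * (Ring.choose i p.1 * Ring.choose (i + j - p.1) p.2)
        = sg (i + j) * sg n * (Ring.choose i p.1 * Ring.choose (n - 1 - i - j) p.2) := by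
    intro p hp
    have hn : (n : ℤ) = p.1 + p.2 := by exact_mod_cast (mem_antidiagonal.mp hp).symm
    rw [choose_eq_sg_mul (i + j - p.1) p.2, sg_sub, hn, sg_add (p.1 : ℤ) p.2,
      show (p.2 : ℤ) - 1 - (i + j - p.1) = p.1 + p.2 - 1 - i - j by ring]
    ring
  rw [Finset.sum_congr rfl h, ← Finset.mul_sum, sum_choose_mul_choose, choose_eq_sg_mul j n,
    mul_assoc, show i + ((n : ℤ) - 1 - i - j) = n - 1 - j by ring]

/-- This is the coefficient form of (f Dⁱ g Dʲ)⋆ = (−D)ʲ g (−D)ⁱ f. The Leibniz rule is applied on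
the left, and the terms with the same derivatives of f and g are collected by `sum_sg_choose`. -/
theorem adj_leibniz (i j : ℤ) (n : ℕ) (f g : Fun R) :
    ∑ p ∈ antidiagonal n, (sg (i + j - p.1) * (Ring.choose (i + j - p.1) p.2 * Ring.choose i p.1)) •
        dx p.2 (f * dx p.1 g)
      = ∑ p ∈ antidiagonal n, (sg (i + j) * (Ring.choose j p.1 * Ring.choose (i + j - p.1) p.2)) •
        (dx p.1 g * dx p.2 f) := by
  have h1 : ∀ p ∈ antidiagonal n,
      (sg (i + j - p.1) * (Ring.choose (i + j - p.1) p.2 * Ring.choose i p.1)) •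
        dx p.2 (f * dx p.1 g)
        = ∑ q ∈ antidiagonal p.2, (sg (i + j - p.1) * (Ring.choose i p.1 *
          Ring.choose (i + j - p.1) q.1) * Ring.choose (i + j - p.1 - q.1) q.2) •
            (dx (q.1 + p.1) g * dx q.2 f) := by
    intro p _
    rw [dx_mul, Finset.smul_sum, ← sum_antidiagonal_swap p.2 (fun a b => (sg (i + j - p.1) *
      (Ring.choose i p.1 * Ring.choose (i + j - p.1) a) * Ring.choose (i + j - p.1 - a) b) •
            (dx (a + p.1) g * dx b f))]
    refine Finset.sum_congr rfl fun q hq => ?_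
    have h := choose_add_mul_choose (i + j - p.1) q.2 q.1
    rw [add_comm q.2 q.1, mem_antidiagonal.mp hq, Nat.choose_symm_of_eq_add
      (by rw [add_comm]; exact (mem_antidiagonal.mp hq).symm)] at h
    rw [← natCast_zsmul, smul_smul, ← dx_add, mul_comm (dx q.1 f)]
    congr 1
    linear_combination sg (i + j - p.1) * Ring.choose i p.1 * h
  rw [Finset.sum_congr rfl h1, sum_antidiagonal_assoc n (fun w b a => (sg (i + j - w) *
      (Ring.choose i w * Ring.choose (i + j - w) b) * Ring.choose (i + j - w - b) a) •
            (dx (b + w) g * dx a f))]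
  refine Finset.sum_congr rfl fun p _ => ?_
  rw [← mul_assoc, ← sum_sg_choose, Finset.sum_mul, Finset.sum_smul]
  refine Finset.sum_congr rfl fun q hq => ?_
  have hn : (p.1 : ℤ) = q.1 + q.2 := by exact_mod_cast (mem_antidiagonal.mp hq).symm
  rw [add_comm q.2 q.1, mem_antidiagonal.mp hq, hn, sub_sub]

theorem co_adj_eq_zero {P : PDO R} {M : ℤ} (hP : ∀ i, M < i → P.co i = 0) {m : ℤ} (h : M < m) :
    (adj P).co m = 0 := by
  rw [co_adj P m hP _ subset_rfl, Finset.Icc_eq_empty (by omega), Finset.sum_empty]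

theorem adj_mul (P Q : PDO R) : adj (P ⋆ Q) = adj Q ⋆ adj P := by
  obtain ⟨M, hM, hP, hQ, -⟩ := exists_co_bound₃ P Q Q
  refine ext_co fun m => ?_
  have hPQ : ∀ i, 2 * M < i → (P ⋆ Q).co i = 0 := fun i hi => co_mul_eq_zero hP hQ (by omega)
  have hPa : ∀ i, M < i → (adj P).co i = 0 := fun i hi => co_adj_eq_zero hP hi
  have hQa : ∀ i, M < i → (adj Q).co i = 0 := fun i hi => co_adj_eq_zero hQ hi
  set B := Finset.Icc (m - M) M with hB
  set T := Finset.Icc m (2 * M) with hT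
  rw [co_adj (P ⋆ Q) m hPQ T (by rfl), co_mul (adj Q) (adj P) m hQa hPa B B (by rfl) (by rfl)]
  have h1 : ∀ s ∈ T, sg s • (ch s (s - m) • dx (s - m).toNat ((P ⋆ Q).co s))
      = ∑ i ∈ B, ∑ j ∈ B, (sg s * (ch s (s - m) * ch i (i + j - s))) •
        dx (s - m).toNat (P.co i * dx (i + j - s).toNat (Q.co j)) := by
    intro s hs
    rw [hT, Finset.mem_Icc] at hs
    rw [co_mul P Q s hP hQ B B (Finset.Icc_subset_Icc (by omega) le_rfl)
      (Finset.Icc_subset_Icc (by omega) le_rfl)]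
    simp only [dx_sum, Finset.smul_sum, dx_zsmul, smul_smul]
  have h2 : ∀ a ∈ B, ∑ b ∈ B,
        ch a (a + b - m) • ((adj Q).co a * dx (a + b - m).toNat ((adj P).co b))
      = ∑ i ∈ B, ∑ j ∈ B, ∑ b ∈ B, (sg (i + j) * (ch j (j - a) * (ch i (i - b) * ch a (a + b - m)))) •
        (dx (j - a).toNat (Q.co j) * dx ((i - b).toNat + (a + b - m).toNat) (P.co i)) := by
    intro a ha
    have h3 : ∀ b ∈ B, ch a (a + b - m) • ((adj Q).co a * dx (a + b - m).toNat ((adj P).co b))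
        = ∑ i ∈ B, ∑ j ∈ B,
          (sg (i + j) * (ch j (j - a) * (ch i (i - b) * ch a (a + b - m)))) •
        (dx (j - a).toNat (Q.co j) * dx ((i - b).toNat + (a + b - m).toNat) (P.co i)) := by
      intro b hb
      rw [hB, Finset.mem_Icc] at ha hb
      rw [co_adj Q a hQ B (Finset.Icc_subset_Icc (by omega) le_rfl),
        co_adj P b hP B (Finset.Icc_subset_Icc (by omega) le_rfl)]
      simp only [dx_sum, dx_zsmul, Finset.mul_sum, Finset.sum_mul, Finset.smul_sum]
      refine Finset.sum_congr rfl fun i _ => Finset.sum_congr rfl fun j _ => ?_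
      rw [add_comm (i - b).toNat, dx_add, sg_add]
      simp only [smul_mul_assoc, mul_smul_comm, smul_smul]
      congr 1
      ring
    rw [Finset.sum_congr rfl h3, Finset.sum_comm]
    refine Finset.sum_congr rfl fun i _ => ?_
    rw [Finset.sum_comm]
  rw [Finset.sum_congr rfl h1, Finset.sum_congr rfl h2, Finset.sum_comm,
    Finset.sum_comm (s := B) (t := B)]
  refine Finset.sum_congr rfl fun i hi => ?_
  rw [Finset.sum_comm, Finset.sum_comm (s := B) (t := B)]
  refine Finset.sum_congr rfl fun j hj => ?_
  rw [hB, Finset.mem_Icc] at hi hj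
  -- The derivatives from the adjoint of P and from the product both fall on the same coefficient of
  -- P, so the sum over b is a Vandermonde convolution.
  have h4 : ∀ a ∈ B, ∑ b ∈ B, (sg (i + j) * (ch j (j - a) * (ch i (i - b) * ch a (a + b - m)))) •
        (dx (j - a).toNat (Q.co j) * dx ((i - b).toNat + (a + b - m).toNat) (P.co i))
      = (sg (i + j) * (ch j (j - a) * ch (i + a) (i + a - m))) •
        (dx (j - a).toNat (Q.co j) * dx (i + a - m).toNat (P.co i)) := by
    intro a ha
    rw [hB, Finset.mem_Icc] at ha
    rw [sum_eq_antidiagonal B (m - a) i (Finset.Icc_subset_Icc (by omega) (by omega))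
      (fun p q => (sg (i + j) * (ch j (j - a) * (Ring.choose i p * Ring.choose a q))) •
        (dx (j - a).toNat (Q.co j) * dx (p + q) (P.co i)))]
    · by_cases h : m - a ≤ i
      · rw [if_pos h, ch_of_nonneg (i := i + a) (by omega), ← sum_choose_mul_choose,
          show i - (m - a) = i + a - m by ring, Finset.mul_sum, Finset.mul_sum, Finset.sum_smul]
        refine Finset.sum_congr rfl fun p hp => ?_
        rw [mem_antidiagonal.mp hp]
      · rw [if_neg h, ch_of_neg (i := i + a) (by omega), mul_zero, mul_zero, zero_smul]
    · intro b h h'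
      rw [ch_of_nonneg (i := i) (by omega), ch_of_nonneg (i := a) (by omega),
        show b - (m - a) = a + b - m by ring]
    · intro b h
      rcases not_and_or.mp h with h | h
      · rw [ch_of_neg (i := a) (by omega), mul_zero, mul_zero, mul_zero, zero_smul]
      · rw [ch_of_neg (i := i) (by omega), zero_mul, mul_zero, mul_zero, zero_smul]
  rw [Finset.sum_congr rfl h4,
    sum_eq_antidiagonal B (m - i) j (Finset.Icc_subset_Icc (by omega) (by omega))
      (fun p q => (sg (i + j) * (Ring.choose j p * Ring.choose (i + j - p) q)) •
        (dx p (Q.co j) * dx q (P.co i))),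
    sum_eq_antidiagonal T m (i + j) (Finset.Icc_subset_Icc le_rfl (by omega))
      (fun p q => (sg (i + j - p) * (Ring.choose (i + j - p) q * Ring.choose i p)) •
        dx q (P.co i * dx p (Q.co j)))]
  · rw [show j - (m - i) = i + j - m by ring, adj_leibniz]
    exact if_congr (by omega) rfl rfl
  · intro s h h'
    rw [ch_of_nonneg (by omega), ch_of_nonneg (by omega),
      show i + j - ((i + j - s).toNat : ℤ) = s by omega]
  · intro s h
    rcases not_and_or.mp h with h | h
    · rw [ch_of_neg (k := s - m) (by omega), zero_mul, mul_zero, zero_smul]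
    · rw [ch_of_neg (k := i + j - s) (by omega), mul_zero, mul_zero, zero_smul]
  · intro a h h'
    rw [ch_of_nonneg (by omega), ch_of_nonneg (by omega), show a - (m - i) = i + a - m by ring,
      show i + j - ((j - a).toNat : ℤ) = i + a by omega]
  · intro a h
    rcases not_and_or.mp h with h | h
    · rw [ch_of_neg (k := i + a - m) (by omega), mul_zero, mul_zero, zero_smul]
    · rw [ch_of_neg (k := j - a) (by omega), zero_mul, mul_zero, zero_smul]

end Algebra

section Adjoint

variable {R : Type u} [CommRing R]

theorem adj_add (P Q : PDO R) : adj (P + Q) = adj P + adj Q := by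
  obtain ⟨M, -, hP, hQ, -⟩ := exists_co_bound₃ P Q Q
  refine ext_co fun m => ?_
  rw [co_add, co_adj P m hP _ subset_rfl, co_adj Q m hQ _ subset_rfl, co_adj (P + Q) m
    (fun i hi => by rw [co_add, hP i hi, hQ i hi, add_zero]) _ subset_rfl]
  simp only [co_add, dx_map_add, smul_add, Finset.sum_add_distrib]

/-- The adjoint as an additive map. -/
def adjHom : PDO R →+ PDO R := AddMonoidHom.mk' adj adj_add

theorem adj_sub (P Q : PDO R) : adj (P - Q) = adj P - adj Q := map_sub adjHom P Q
theorem adj_sum {ι : Type*} (s : Finset ι) (P : ι → PDO R) :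
    adj (∑ i ∈ s, P i) = ∑ i ∈ s, adj (P i) := map_sum adjHom P s

theorem adj_D (n : ℤ) : adj (D n : PDO R) = sg n • (D n : PDO R) := by
  refine ext_co fun m => ?_
  rw [co_adj (D n) m (M := n) (fun i hi => by rw [co_D, if_neg (by omega)])
    (insert n (Finset.Icc m n)) (Finset.subset_insert _ _),
    Finset.sum_eq_single_of_mem n (Finset.mem_insert_self _ _), co_D, if_pos rfl, dx_one, co_zsmul,
    co_D]
  · congr 1
    rcases lt_trichotomy m n with h | rfl | h
    · rw [if_neg (by omega), if_neg (by omega), smul_zero]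
    · simp
    · rw [ch_of_neg (by omega), zero_smul, if_neg (by omega)]
  · intro i _ hi
    rw [co_D, if_neg hi, dx_zero, smul_zero, smul_zero]

theorem adj_ofFun (f : Fun R) : adj (ofFun f) = ofFun f := by
  refine ext_co fun m => ?_
  rw [co_adj (ofFun f) m (M := 0) (fun i hi => by rw [co_ofFun, if_neg (by omega)])
    (insert 0 (Finset.Icc m 0)) (Finset.subset_insert _ _),
    Finset.sum_eq_single_of_mem 0 (Finset.mem_insert_self _ _), sg_zero, one_smul, co_ofFun,
    if_pos rfl, co_ofFun]
  · split_ifs with h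
    · rw [h]; simp
    · rw [ch_zero_left (by omega), zero_smul]
  · intro i _ hi
    rw [co_ofFun, if_neg hi, dx_zero, smul_zero, smul_zero]

end Adjoint

/-! ### Differential operators -/

section Differential

variable {R : Type u} [CommRing R]

/-- Differential operators: there are no negative powers of `D`. -/
def IsDiff (P : PDO R) : Prop := ∀ j : ℤ, j < 0 → P.co j = 0

theorem co_plus (P : PDO R) (m : ℤ) : (plus P).co m = if 0 ≤ m then P.co m else 0 := by
  rw [co, plus, HahnSeries.coeff_ofSuppBddBelow, co]
  exact if_congr (by omega) rfl rfl

theorem isDiff_plus (P : PDO R) : IsDiff (plus P) := fun j hj => by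
  rw [co_plus, if_neg (by omega)]

theorem isDiff_D (n : ℕ) : IsDiff (D n : PDO R) := fun j hj => by rw [co_D, if_neg (by omega)]
theorem isDiff_ofFun (f : Fun R) : IsDiff (ofFun f) := fun j hj => by
  rw [co_ofFun, if_neg (by omega)]

theorem IsDiff.add {P Q : PDO R} (hP : IsDiff P) (hQ : IsDiff Q) : IsDiff (P + Q) :=
  fun j hj => by rw [co_add, hP j hj, hQ j hj, add_zero]

theorem IsDiff.neg {P : PDO R} (hP : IsDiff P) : IsDiff (-P) :=
  fun j hj => by rw [co_neg, hP j hj, neg_zero]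

theorem IsDiff.sum {ι : Type*} {s : Finset ι} {P : ι → PDO R} (h : ∀ i ∈ s, IsDiff (P i)) :
    IsDiff (∑ i ∈ s, P i) := fun j hj => by
  rw [co_sum, Finset.sum_eq_zero fun i hi => h i hi j hj]

theorem ch_eq_zero {i k : ℤ} (h0 : 0 ≤ i) (h : i < k) : ch i k = 0 := by
  lift i to ℕ using h0
  have := Ring.choose_natCast (R := ℤ) i k.toNat
  rw [ch_of_nonneg (by omega)]
  exact this.trans (by rw [Nat.choose_eq_zero_of_lt (by omega), Nat.cast_zero])

theorem IsDiff.mul {P Q : PDO R} (hP : IsDiff P) (hQ : IsDiff Q) : IsDiff (P ⋆ Q) := by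
  intro m hm
  obtain ⟨M, -, hP', hQ', -⟩ := exists_co_bound₃ P Q Q
  rw [co_mul P Q m hP' hQ' _ _ subset_rfl subset_rfl]
  refine Finset.sum_eq_zero fun i _ => Finset.sum_eq_zero fun j _ => ?_
  rcases lt_or_ge i 0 with hi | hi
  · rw [hP i hi, zero_mul, smul_zero]
  rcases lt_or_ge j 0 with hj | hj
  · rw [hQ j hj, dx_zero, mul_zero, smul_zero]
  rw [ch_eq_zero hi (by omega), zero_smul]

/-- A term of order i contributes only to orders m ≤ i, so negative orders never reach m ≥ 0.
Conversely the binomial C(i, i − m) vanishes when m < 0 ≤ i, so a differential operator has a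
differential adjoint. -/
theorem adj_plus (P : PDO R) : plus (adj P) = adj (plus P) := by
  obtain ⟨M, hP⟩ := exists_co_bound P
  refine ext_co fun m => ?_
  rw [co_plus, co_adj P m hP _ subset_rfl, co_adj (plus P) m
    (fun i hi => by rw [co_plus, hP i hi, ite_self]) _ subset_rfl]
  split_ifs with h
  · refine Finset.sum_congr rfl fun i hi => ?_
    rw [Finset.mem_Icc] at hi
    rw [co_plus, if_pos (by omega)]
  · symm
    refine Finset.sum_eq_zero fun i _ => ?_
    rw [co_plus]
    split_ifs with hi
    · rw [ch_eq_zero hi (by omega), zero_smul, smul_zero]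
    · rw [dx_zero, smul_zero, smul_zero]

theorem IsDiff.adj {P : PDO R} (hP : IsDiff P) : IsDiff (PDO.adj P) := by
  have : plus P = P := ext_co fun m => by
    rw [co_plus]
    split_ifs with h
    · rfl
    · rw [hP m (by omega)]
  rw [← this, ← adj_plus]
  exact isDiff_plus _

theorem IsDiff.eq_sum {P : PDO R} (hP : IsDiff P) {K : ℕ} (hK : ∀ i : ℤ, K ≤ i → P.co i = 0) :
    P = ∑ j ∈ Finset.range K, ofFun (P.co j) ⋆ D j := by
  refine ext_co fun m => ?_
  rw [co_sum]
  simp only [co_ofFun_mul, co_D, mul_ite, mul_one, mul_zero]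
  by_cases h : 0 ≤ m ∧ m < K
  · rw [Finset.sum_eq_single m.toNat]
    · rw [if_pos (by omega), Int.toNat_of_nonneg h.1]
    · intro j _ hj
      rw [if_neg (by omega)]
    · intro h'
      rw [Finset.mem_range] at h'
      omega
  · rw [Finset.sum_eq_zero]
    · rcases not_and_or.mp h with h | h
      · exact hP m (by omega)
      · exact hK m (by omega)
    · intro j hj
      rw [Finset.mem_range] at hj
      rw [if_neg (by omega)]

theorem exists_nat_bound (P : PDO R) : ∃ K : ℕ, ∀ i : ℤ, K ≤ i → P.co i = 0 := by
  obtain ⟨M, hM⟩ := exists_co_bound P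
  exact ⟨(M + 1).toNat, fun i hi => hM i (by omega)⟩

theorem act_eq_sum (P : PDO R) {K : ℕ} (hK : ∀ i : ℤ, K ≤ i → P.co i = 0) (f : Fun R) :
    act P f = ∑ j ∈ Finset.range K, P.co j * dx j f := by
  rw [act, finsum_eq_sum_of_support_subset]
  intro j hj
  rw [Finset.coe_range, Set.mem_Iio]
  by_contra h
  exact hj (by simp only [hK j (by omega), zero_mul])

theorem act_add (P Q : PDO R) (f : Fun R) : act (P + Q) f = act P f + act Q f := by
  obtain ⟨K, hK⟩ := exists_nat_bound P
  obtain ⟨K', hK'⟩ := exists_nat_bound Q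
  rw [act_eq_sum P (K := K + K') (fun i hi => hK i (by omega)),
    act_eq_sum Q (K := K + K') (fun i hi => hK' i (by omega)), act_eq_sum (P + Q) (K := K + K')
    (fun i hi => by rw [co_add, hK i (by omega), hK' i (by omega), add_zero]),
    ← Finset.sum_add_distrib]
  simp only [co_add, add_mul]

/-- The action on a fixed function, as an additive map. -/
def actHom (f : Fun R) : PDO R →+ Fun R := AddMonoidHom.mk' (fun P => act P f) fun _ _ => act_add _ _ _

theorem act_neg (P : PDO R) (f : Fun R) : act (-P) f = -act P f := map_neg (actHom f) P
theorem act_zsmul (c : ℤ) (P : PDO R) (f : Fun R) : act (c • P) f = c • act P f :=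
  map_zsmul (actHom f) c P
theorem act_sum {ι : Type*} (s : Finset ι) (P : ι → PDO R) (f : Fun R) :
    act (∑ i ∈ s, P i) f = ∑ i ∈ s, act (P i) f := map_sum (actHom f) P s

theorem act_D_zero (f : Fun R) : act (D 0) f = f := by
  rw [act_eq_sum (D 0) (K := 1) (fun i hi => by rw [co_D, if_neg (by omega)])]
  simp [co_D]

theorem act_ofFun_mul (b : Fun R) (P : PDO R) (f : Fun R) : act (ofFun b ⋆ P) f = b * act P f := by
  obtain ⟨K, hK⟩ := exists_nat_bound P
  rw [act_eq_sum P hK, act_eq_sum (ofFun b ⋆ P) (K := K)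
    (fun i hi => by rw [co_ofFun_mul, hK i hi, mul_zero]), Finset.mul_sum]
  simp only [co_ofFun_mul, mul_assoc]

theorem act_D_one_mul {P : PDO R} (hP : IsDiff P) (f : Fun R) :
    act (D 1 ⋆ P) f = ddt 1 (act P f) := by
  obtain ⟨K, hK⟩ := exists_nat_bound P
  rw [act_eq_sum P (K := K) hK, act_eq_sum (D 1 ⋆ P) (K := K + 1) (fun i hi => by
      rw [co_D_one_mul, hK _ (by omega), hK _ (by omega), ddt_zero, add_zero]), ddt_sum]
  simp only [co_D_one_mul, add_mul, Finset.sum_add_distrib, ddt_mul, ← dx_succ']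
  rw [Finset.sum_range_succ', Finset.sum_range_succ (fun j : ℕ => ddt 1 (P.co j) * dx j f),
    hK K le_rfl, hP _ (by simp), ddt_zero, zero_mul, zero_mul, add_zero, add_zero, add_comm]
  simp

theorem D_succ (j : ℕ) : (D ((j + 1 : ℕ) : ℤ) : PDO R) = D 1 ⋆ D j := by
  rw [D_mul_D, Nat.cast_add, add_comm, Nat.cast_one]

theorem act_D_mul {P : PDO R} (hP : IsDiff P) (j : ℕ) (f : Fun R) :
    act (D j ⋆ P) f = dx j (act P f) := by
  induction j with
  | zero => rw [Nat.cast_zero, one_mul']; rfl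
  | succ j ih => rw [D_succ, mul_assoc', act_D_one_mul ((isDiff_D j).mul hP), ih, dx_succ']

/-- Both operators have to be differential: `act` discards negative powers, so already D · D⁻¹ = 1
would be a counterexample. -/
theorem act_mul {P Q : PDO R} (hP : IsDiff P) (hQ : IsDiff Q) (f : Fun R) :
    act (P ⋆ Q) f = act P (act Q f) := by
  obtain ⟨K, hK⟩ := exists_nat_bound P
  conv_lhs => rw [hP.eq_sum hK]
  rw [sum_mul', act_sum, act_eq_sum P hK]
  refine Finset.sum_congr rfl fun j _ => ?_
  rw [mul_assoc', act_ofFun_mul, act_D_mul hQ]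

theorem act_ofFun (b f : Fun R) : act (ofFun b) f = b * f := by
  rw [← mul_one' (ofFun b), act_ofFun_mul, act_D_zero]

theorem act_adj {P : PDO R} (hP : IsDiff P) {K : ℕ} (hK : ∀ i : ℤ, K ≤ i → P.co i = 0) (f : Fun R) :
    act (adj P) f = ∑ j ∈ Finset.range K, sg j • dx j (P.co j * f) := by
  conv_lhs => rw [hP.eq_sum hK]
  rw [adj_sum, act_sum]
  refine Finset.sum_congr rfl fun j _ => ?_
  rw [adj_mul, adj_D, adj_ofFun, zsmul_mul', act_zsmul, act_D_mul (isDiff_ofFun _), act_ofFun]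

/-! ### The residue in the definition of the squared eigenfunction potentials -/

/-- `Res (D⁻¹ f D ^ j g D⁻¹)`. -/
def resTerm : ℕ → Fun R → Fun R → Fun R
  | 0, _, _ => 0
  | j + 1, f, g => f * dx j g - resTerm j (ddt 1 f) g

theorem co_zero_D_mul_ofFun (j : ℕ) (g : Fun R) : (D j ⋆ ofFun g).co 0 = dx j g := by
  induction j with
  | zero => rw [Nat.cast_zero, one_mul', co_ofFun, if_pos rfl]; rfl
  | succ j ih =>
    rw [D_succ, mul_assoc', co_D_one_mul, ih, ((isDiff_D j).mul (isDiff_ofFun g)) _ (by norm_num),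
      zero_add, dx_succ']

theorem ofFun_mul_D_one (f : Fun R) : ofFun f ⋆ D 1 = D 1 ⋆ ofFun f - ofFun (ddt 1 f) := by
  refine ext_co fun m => ?_
  rw [co_mul_D, co_sub, co_D_one_mul, co_ofFun, co_ofFun, co_ofFun]
  split_ifs <;> simp

/-- One factor D is moved to the left by f D = D f − f′. In the first term it cancels D⁻¹ and leaves
the order-zero coefficient of f Dʲ g; the second is the same residue with f′ and one power less. -/
theorem res_eq_resTerm (j : ℕ) (f g : Fun R) :
    res (D (-1) ⋆ (ofFun f ⋆ (D j ⋆ (ofFun g ⋆ D (-1))))) = resTerm j f g := by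
  induction j generalizing f with
  | zero =>
    rw [Nat.cast_zero, one_mul', ← mul_assoc' (ofFun f), ofFun_mul_ofFun, res]
    refine co_mul_eq_zero (M := -1) (N := -1) (fun i hi => ?_) (fun i hi => ?_) (by norm_num)
    · rw [co_D, if_neg (by omega)]
    · rw [co_mul_D, co_ofFun, if_neg (by omega)]
  | succ j ih =>
    rw [D_succ, mul_assoc', ← mul_assoc' (ofFun f), ofFun_mul_D_one, sub_mul', mul_sub', res,
      co_sub, ← res, ← res, ih, mul_assoc' (D 1), ← mul_assoc' (D (-1)), D_mul_D, neg_add_cancel,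
      one_mul', ← mul_assoc' (D j), res, co_ofFun_mul, co_mul_D, sub_self, co_zero_D_mul_ofFun,
      resTerm]

/-- Integration by parts: f ∂ʲg − ((−∂)ʲf) g is a total derivative, and `resTerm` is its primitive.
The recursion telescopes. -/
theorem ddt_one_resTerm (j : ℕ) (f g : Fun R) :
    ddt 1 (resTerm j f g) = f * dx j g - sg j • dx j f * g := by
  induction j generalizing f with
  | zero => simp [resTerm]
  | succ j ih =>
    rw [resTerm, ddt_sub, ih, ddt_mul, Nat.cast_add, Nat.cast_one, sg_add, sg_one, dx_succ j f,
      ← dx_succ']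
    simp only [mul_neg, mul_one, neg_smul]
    ring

/-- `Res (D⁻¹ g B f D⁻¹)`. -/
def sepRes (B : PDO R) (f g : Fun R) : Fun R :=
  res (D (-1) ⋆ (ofFun g ⋆ (B ⋆ (ofFun f ⋆ D (-1)))))

theorem res_sum {ι : Type*} (s : Finset ι) (P : ι → PDO R) :
    res (∑ i ∈ s, P i) = ∑ i ∈ s, res (P i) := co_sum _ s P

theorem sepRes_eq_sum {B : PDO R} (hB : IsDiff B) {K : ℕ} (hK : ∀ i : ℤ, K ≤ i → B.co i = 0)
    (f g : Fun R) : sepRes B f g = ∑ j ∈ Finset.range K, resTerm j (g * B.co j) f := by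
  conv_lhs => rw [sepRes, hB.eq_sum hK]
  rw [sum_mul', mul_sum', mul_sum', res_sum]
  refine Finset.sum_congr rfl fun j _ => ?_
  rw [mul_assoc' (ofFun (B.co j)), ← mul_assoc' (ofFun g), ofFun_mul_ofFun, res_eq_resTerm]

/-- Lagrange's identity, summed over the monomials of B. It allows the equations in all times to be
reduced to the one in x. -/
theorem ddt_one_sepRes {B : PDO R} (hB : IsDiff B) (f g : Fun R) :
    ddt 1 (sepRes B f g) = act B f * g - f * act (adj B) g := by
  obtain ⟨K, hK⟩ := exists_nat_bound B
  rw [sepRes_eq_sum hB hK, ddt_sum, act_eq_sum B hK, act_adj hB hK, Finset.sum_mul, Finset.mul_sum,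
    ← Finset.sum_sub_distrib]
  refine Finset.sum_congr rfl fun j _ => ?_
  rw [ddt_one_resTerm, mul_comm g, smul_mul_assoc, mul_smul_comm]
  ring

end Differential

/-! ### Inverses -/

section Inverse

variable {R : Type u} [CommRing R]

/-- Each factor 1 − P lowers the order by one, which makes the Neumann series finite in every
coefficient. -/
theorem co_iterate_eq_zero {N : PDO R} (hN : ∀ i : ℤ, -1 < i → N.co i = 0) (k : ℕ) (j : ℤ)
    (hj : -(k : ℤ) < j) : ((mul N)^[k] (D 0)).co j = 0 := by
  induction k generalizing j with
  | zero => rw [Function.iterate_zero, id, co_D, if_neg (by simpa using hj.ne')]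
  | succ k ih =>
    rw [Function.iterate_succ_apply']
    exact co_mul_eq_zero (M := -1) (N := -(k : ℤ)) hN (fun i hi => ih i hi) (by push_cast at hj; omega)

theorem IsDressing.co_sub {P : PDO R} (hP : IsDressing P) (i : ℤ) (hi : -1 < i) :
    (D 0 - P).co i = 0 := by
  rw [PDO.co_sub, co_D]
  rcases eq_or_ne i 0 with rfl | h
  · rw [if_pos rfl, hP.1, sub_self]
  · rw [if_neg h, hP.2 i (by omega), sub_zero]

theorem co_inv (P : PDO R) (j : ℤ) : (inv P).co j = if 0 < j then 0 else
    ∑ k ∈ Finset.range ((-j).toNat + 1), ((mul (D 0 - P))^[k] (D 0)).co j := by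
  rw [co, inv, HahnSeries.coeff_ofSuppBddBelow]
  exact if_congr (by omega) rfl rfl

theorem IsDressing.co_inv_sub {P : PDO R} (hP : IsDressing P) (K : ℕ) (j : ℤ) (hj : -(K : ℤ) < j) :
    (inv P - ∑ k ∈ Finset.range K, (mul (D 0 - P))^[k] (D 0 : PDO R)).co j = 0 := by
  rw [PDO.co_sub, co_inv, co_sum, sub_eq_zero]
  split_ifs with h
  · symm
    refine Finset.sum_eq_zero fun k _ => ?_
    exact co_iterate_eq_zero hP.co_sub k j (by omega)
  · refine Finset.sum_subset (Finset.range_subset_range.mpr (by omega)) fun k _ hk => ?_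
    rw [Finset.mem_range] at hk
    exact co_iterate_eq_zero hP.co_sub k j (by omega)

theorem mul_sum_iterate (P : PDO R) (K : ℕ) :
    P ⋆ ∑ k ∈ Finset.range K, (mul (D 0 - P))^[k] (D 0 : PDO R) = D 0 - (mul (D 0 - P))^[K] (D 0) := by
  induction K with
  | zero => simp [mul_zero']
  | succ K ih =>
    rw [Finset.sum_range_succ, mul_add', ih, Function.iterate_succ_apply', sub_mul', one_mul']
    abel

theorem IsDressing.mul_inv {P : PDO R} (hP : IsDressing P) : P ⋆ inv P = D 0 := by
  refine ext_co fun m => ?_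
  -- With K terms of the Neumann series the errors have order at most −K, and this K satisfies −K <
  -- m.
  set K := (-m).toNat + 1 with hK
  set S := ∑ k ∈ Finset.range K, (mul (D 0 - P))^[k] (D 0 : PDO R)
  have h : P ⋆ inv P = P ⋆ (inv P - S) + (D 0 - (mul (D 0 - P))^[K] (D 0)) := by
    rw [← mul_sum_iterate, ← mul_add', sub_add_cancel]
  rw [h, co_add, PDO.co_sub, co_iterate_eq_zero hP.co_sub K m (by omega), sub_zero,
    co_mul_eq_zero (M := 0) (N := -(K : ℤ)) hP.2 (hP.co_inv_sub K) (by omega), zero_add]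

theorem isDressing_inv (P : PDO R) : IsDressing (inv P) := by
  refine ⟨?_, fun n hn => by rw [co_inv, if_pos hn]⟩
  rw [co_inv, if_neg (lt_irrefl 0), neg_zero, Int.toNat_zero, zero_add, Finset.sum_range_one,
    Function.iterate_zero, id, co_D, if_pos rfl]

/-- The right inverse is itself a dressing operator and has a right inverse, which by associativity
can only be P. -/
theorem IsDressing.inv_mul {P : PDO R} (hP : IsDressing P) : PDO.inv P ⋆ P = D 0 := by
  have h := (isDressing_inv P).mul_inv
  have h2 : P = PDO.inv (PDO.inv P) :=
    calc P = P ⋆ (PDO.inv P ⋆ PDO.inv (PDO.inv P)) := by rw [h, mul_one']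
      _ = PDO.inv (PDO.inv P) := by rw [← mul_assoc', hP.mul_inv, one_mul']
  rwa [← h2] at h

theorem IsDressing.eq_inv {P Q : PDO R} (hP : IsDressing P) (h : Q ⋆ P = D 0) : Q = PDO.inv P := by
  rw [← mul_one' Q, ← hP.mul_inv, ← mul_assoc', h, one_mul']

theorem IsDressing.mul_right_cancel {P Q S : PDO R} (hP : IsDressing P) (h : Q ⋆ P = S ⋆ P) :
    Q = S := by
  rw [← mul_one' Q, ← hP.mul_inv, ← mul_assoc', h, mul_assoc', hP.mul_inv, mul_one']

theorem IsDressing.adj {P : PDO R} (hP : IsDressing P) : IsDressing (adj P) := by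
  refine ⟨?_, fun n hn => co_adj_eq_zero hP.2 hn⟩
  rw [co_adj P 0 hP.2 {0} (by simp), Finset.sum_singleton, sub_zero, sg_zero, one_smul,
    ch_zero_right, one_smul, hP.1]
  rfl

theorem IsDressing.adj_inv {P : PDO R} (hP : IsDressing P) :
    PDO.adj (PDO.inv P) = PDO.inv (PDO.adj P) := by
  refine hP.adj.eq_inv ?_
  rw [← adj_mul, hP.mul_inv, adj_D, sg_zero, one_smul]

end Inverse

/-! ### Derivatives of operators and extension of constants -/

section Derivation

variable {R : Type u} [CommRing R]

/-- The derivative of the coefficients. -/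
def dt (n : ℕ+) (P : PDO R) : PDO R :=
  HahnSeries.map P (MvPowerSeries.pderiv R n : Derivation R (Fun R) (Fun R))

@[simp] theorem co_dt (n : ℕ+) (P : PDO R) (m : ℤ) : (dt n P).co m = ddt n (P.co m) := rfl

theorem dt_D (n : ℕ+) (m : ℤ) : dt n (D m : PDO R) = 0 := by
  refine ext_co fun k => ?_
  rw [co_dt, co_D]
  split_ifs <;> simp

theorem dt_mul (n : ℕ+) (P Q : PDO R) : dt n (P ⋆ Q) = dt n P ⋆ Q + P ⋆ dt n Q := by
  obtain ⟨M, -, hP, hQ, -⟩ := exists_co_bound₃ P Q Q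
  have hP' : ∀ i, M < i → (dt n P).co i = 0 := fun i hi => by rw [co_dt, hP i hi, ddt_zero]
  have hQ' : ∀ i, M < i → (dt n Q).co i = 0 := fun i hi => by rw [co_dt, hQ i hi, ddt_zero]
  refine ext_co fun m => ?_
  rw [co_add, co_dt, co_mul P Q m hP hQ _ _ subset_rfl subset_rfl,
    co_mul _ Q m hP' hQ _ _ subset_rfl subset_rfl, co_mul P _ m hP hQ' _ _ subset_rfl subset_rfl]
  simp only [co_dt, ddt_sum, ddt_zsmul, ddt_mul, smul_add, Finset.sum_add_distrib, dx_ddt]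

theorem dt_adj (n : ℕ+) (P : PDO R) : dt n (adj P) = adj (dt n P) := by
  obtain ⟨M, hP⟩ := exists_co_bound P
  refine ext_co fun m => ?_
  rw [co_dt, co_adj P m hP _ subset_rfl, co_adj (dt n P) m
    (fun i hi => by rw [co_dt, hP i hi, ddt_zero]) _ subset_rfl]
  simp only [co_dt, ddt_sum, ddt_zsmul, dx_ddt]

theorem IsDiff.dt {P : PDO R} (hP : IsDiff P) (n : ℕ+) : IsDiff (dt n P) := fun j hj => by
  rw [co_dt, hP j hj, ddt_zero]

theorem ddt_act (n : ℕ+) (P : PDO R) (f : Fun R) :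
    ddt n (act P f) = act (dt n P) f + act P (ddt n f) := by
  obtain ⟨K, hK⟩ := exists_nat_bound P
  rw [act_eq_sum P hK, act_eq_sum P hK, act_eq_sum (dt n P) (K := K)
    (fun i hi => by rw [co_dt, hK i hi, ddt_zero]), ddt_sum, ← Finset.sum_add_distrib]
  simp only [co_dt, ddt_mul, dx_ddt]

end Derivation

section BaseChange

variable {R S : Type u} [CommRing R] [CommRing S] (φ : R →+* S)

@[simp] theorem co_baseChange (P : PDO R) (m : ℤ) :
    (baseChange φ P).co m = MvPowerSeries.map φ (P.co m) := rfl

theorem baseChange_bound {P : PDO R} {M : ℤ} (hP : ∀ i, M < i → P.co i = 0) (i : ℤ) (hi : M < i) :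
    (baseChange φ P).co i = 0 := by rw [co_baseChange, hP i hi, map_zero]

theorem baseChange_mul (P Q : PDO R) :
    baseChange φ (P ⋆ Q) = baseChange φ P ⋆ baseChange φ Q := by
  obtain ⟨M, -, hP, hQ, -⟩ := exists_co_bound₃ P Q Q
  refine ext_co fun m => ?_
  rw [co_baseChange, co_mul P Q m hP hQ _ _ subset_rfl subset_rfl, co_mul _ _ m
    (baseChange_bound φ hP) (baseChange_bound φ hQ) _ _ subset_rfl subset_rfl]
  simp only [map_sum, map_zsmul, map_mul, co_baseChange, dx_map]

theorem baseChange_adj (P : PDO R) : baseChange φ (adj P) = adj (baseChange φ P) := by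
  obtain ⟨M, hP⟩ := exists_co_bound P
  refine ext_co fun m => ?_
  rw [co_baseChange, co_adj P m hP _ subset_rfl, co_adj _ m (baseChange_bound φ hP) _ subset_rfl]
  simp only [map_sum, map_zsmul, co_baseChange, dx_map]

theorem baseChange_D (n : ℤ) : baseChange φ (D n : PDO R) = D n := by
  refine ext_co fun m => ?_
  rw [co_baseChange, co_D, co_D]
  split_ifs <;> simp

theorem baseChange_plus (P : PDO R) : baseChange φ (plus P) = plus (baseChange φ P) := by
  refine ext_co fun m => ?_
  rw [co_baseChange, co_plus, co_plus, co_baseChange]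
  split_ifs <;> simp

theorem baseChange_sub (P Q : PDO R) :
    baseChange φ (P - Q) = baseChange φ P - baseChange φ Q :=
  ext_co fun m => by simp only [co_baseChange, co_sub, map_sub]

theorem baseChange_neg (P : PDO R) : baseChange φ (-P) = -baseChange φ P :=
  ext_co fun m => by simp only [co_baseChange, co_neg, map_neg]

theorem baseChange_dt (n : ℕ+) (P : PDO R) : baseChange φ (dt n P) = dt n (baseChange φ P) :=
  ext_co fun m => by simp only [co_baseChange, co_dt, ddt_map]

theorem IsDressing.baseChange {P : PDO R} (hP : IsDressing P) : IsDressing (baseChange φ P) :=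
  ⟨by rw [co_baseChange, hP.1, map_one], fun n hn => by rw [co_baseChange, hP.2 n hn, map_zero]⟩

theorem IsDressing.baseChange_inv {P : PDO R} (hP : IsDressing P) :
    PDO.baseChange φ (PDO.inv P) = PDO.inv (PDO.baseChange φ P) := by
  refine (hP.baseChange φ).eq_inv ?_
  rw [← baseChange_mul, hP.inv_mul, baseChange_D]

theorem act_baseChange (P : PDO R) (f : Fun R) :
    act (baseChange φ P) (MvPowerSeries.map φ f) = MvPowerSeries.map φ (act P f) := by
  obtain ⟨K, hK⟩ := exists_nat_bound P
  rw [act_eq_sum P hK, act_eq_sum (baseChange φ P) (K := K)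
    (fun i hi => by rw [co_baseChange, hK i hi, map_zero])]
  simp only [map_sum, map_mul, co_baseChange, dx_map]

theorem resTerm_map (j : ℕ) (f g : Fun R) :
    resTerm j (MvPowerSeries.map φ f) (MvPowerSeries.map φ g)
      = MvPowerSeries.map φ (resTerm j f g) := by
  induction j generalizing f with
  | zero => exact (map_zero _).symm
  | succ j ih => rw [resTerm, resTerm, ddt_map, ih, dx_map, map_sub, map_mul]

theorem IsDiff.baseChange {P : PDO R} (hP : IsDiff P) : IsDiff (baseChange φ P) := fun j hj => by
  rw [co_baseChange, hP j hj, map_zero]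

theorem sepRes_map {B : PDO R} (hB : IsDiff B) (f g : Fun R) :
    sepRes (PDO.baseChange φ B) (MvPowerSeries.map φ f) (MvPowerSeries.map φ g)
      = MvPowerSeries.map φ (sepRes B f g) := by
  obtain ⟨K, hK⟩ := exists_nat_bound B
  rw [sepRes_eq_sum hB hK, sepRes_eq_sum (hB.baseChange φ) (K := K)
    (fun i hi => by rw [co_baseChange, hK i hi, map_zero]), map_sum]
  refine Finset.sum_congr rfl fun j _ => ?_
  rw [co_baseChange, ← map_mul, resTerm_map]

end BaseChange

end PDO

open PDO

/-! ### The flows of the dressing operator -/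

section Flows

variable {R : Type u} [CommRing R]

/-- The operators `Bₙ = (Lⁿ)₊` for `ε = 1` and `-Bₙ⋆` for `ε = -1`. -/
def flow (ε : ℤˣ) (W : PDO R) (n : ℕ+) : PDO R :=
  if ε = 1 then plus (laxPow W n) else -adj (plus (laxPow W n))

theorem flow_one (W : PDO R) (n : ℕ+) : flow 1 W n = plus (laxPow W n) := if_pos rfl
theorem flow_neg_one (W : PDO R) (n : ℕ+) : flow (-1) W n = -adj (plus (laxPow W n)) :=
  if_neg (by decide)

theorem isDiff_flow (ε : ℤˣ) (W : PDO R) (n : ℕ+) : IsDiff (flow ε W n) := by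
  rw [flow]
  split_ifs
  · exact isDiff_plus _
  · exact (isDiff_plus _).adj.neg

/-- The operator `W` for `ε = 1` and `W⋆⁻¹` for `ε = -1`. -/
def dress (ε : ℤˣ) (W : PDO R) : PDO R := if ε = 1 then W else inv (adj W)

theorem dress_one (W : PDO R) : dress 1 W = W := if_pos rfl
theorem dress_neg_one (W : PDO R) : dress (-1) W = inv (adj W) := if_neg (by decide)

theorem isDressing_dress (ε : ℤˣ) {W : PDO R} (hW : IsDressing W) : IsDressing (dress ε W) := by
  rw [dress]
  split_ifs
  · exact hW
  · exact isDressing_inv _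

theorem laxPow_mul {W : PDO R} (hW : IsDressing W) (n : ℕ) : laxPow W n ⋆ W = W ⋆ D n := by
  rw [laxPow, mul_assoc', hW.inv_mul, mul_one']

/-- Since Lⁿ W = W Dⁿ, replacing (Lⁿ)₋ by Lⁿ − (Lⁿ)₊ leaves only a differential operator on the
right. -/
theorem WilsonSato.dt_eq {W : PDO R} (hKP : WilsonSato W) (hW : IsDressing W) (n : ℕ+) :
    dt n W + W ⋆ D (n : ℕ) = plus (laxPow W n) ⋆ W := by
  have h : dt n W = -(minus (laxPow W n) ⋆ W) := hKP n
  rw [h, minus, sub_mul', laxPow_mul hW]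
  abel

theorem WilsonSato.dt_inv {W : PDO R} (hKP : WilsonSato W) (hW : IsDressing W) (n : ℕ+) :
    dt n (inv W) = D (n : ℕ) ⋆ inv W - inv W ⋆ plus (laxPow W n) := by
  refine hW.mul_right_cancel ?_
  have h : dt n (inv W) ⋆ W + inv W ⋆ dt n W = 0 := by
    rw [← dt_mul, hW.inv_mul, dt_D]
  rw [sub_mul', mul_assoc', hW.inv_mul, mul_one', mul_assoc' (inv W), ← hKP.dt_eq hW, mul_add',
    ← mul_assoc' (inv W), hW.inv_mul, one_mul', eq_neg_of_add_eq_zero_left h]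
  abel

/-- The evolution of the dressing operators. -/
theorem WilsonSato.dt_dress {W : PDO R} (hKP : WilsonSato W) (hW : IsDressing W) (ε : ℤˣ)
    (n : ℕ+) : dt n (dress ε W) + ((ε : ℤ) * (ε : ℤ) ^ (n : ℕ)) • (dress ε W ⋆ D (n : ℕ))
      = flow ε W n ⋆ dress ε W := by
  -- The factor ε · εⁿ arises because ∂ₙ multiplies exp(εξ) by ελⁿ, whereas Dⁿ multiplies it by
  -- (ελ)ⁿ.
  rcases Int.units_eq_one_or ε with rfl | rfl
  · rw [dress_one, flow_one, Units.val_one, one_pow, one_mul, one_smul, hKP.dt_eq hW]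
  · rw [dress_neg_one, flow_neg_one, ← hW.adj_inv, dt_adj, hKP.dt_inv hW, adj_sub, adj_mul, adj_mul,
      adj_D, PDO.mul_zsmul', neg_mul', show sg (n : ℕ) = (-1) ^ (n : ℕ) by simp [sg]]
    simp only [Units.val_neg, Units.val_one, neg_mul, one_mul, neg_smul]
    abel

/-- `∂Φ/∂tₙ = Bₙ Φ` for `ε = 1`, `∂Φ/∂tₙ = -Bₙ⋆ Φ` for `ε = -1`. -/
def IsSolution (ε : ℤˣ) (W : PDO R) (Φ : Fun R) : Prop := ∀ n : ℕ+, ddt n Φ = act (flow ε W n) Φ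

theorem isEigenfunction_iff {W : PDO R} {Φ : Fun R} : IsEigenfunction W Φ ↔ IsSolution 1 W Φ := by
  simp only [IsEigenfunction, IsSolution, flow_one]

theorem isAdjointEigenfunction_iff {W : PDO R} {Ψ : Fun R} :
    IsAdjointEigenfunction W Ψ ↔ IsSolution (-1) W Ψ := by
  simp only [IsAdjointEigenfunction, IsSolution, flow_neg_one, act_neg, adj_plus]

theorem isSEP_iff {W : PDO R} {Φ Ψ S : Fun R} :
    IsSEP W Φ Ψ S ↔ ∀ n : ℕ+, ddt n S = sepRes (plus (laxPow W n)) Φ Ψ := Iff.rfl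

/-- The flows of Φ and Ψ use Bₙ and −Bₙ⋆, exactly the two terms of Lagrange's identity. Hence the
prescribed ∂ₙS has x-derivative ∂ₙ(ΦΨ), compatible with ∂ₓS = ΦΨ. -/
theorem ddt_one_sepRes_eq {W : PDO R} {Φ Ψ : Fun R} (hΦ : IsSolution 1 W Φ)
    (hΨ : IsSolution (-1) W Ψ) (n : ℕ+) :
    ddt 1 (sepRes (plus (laxPow W n)) Φ Ψ) = ddt n (Φ * Ψ) := by
  rw [ddt_one_sepRes (isDiff_plus _), ddt_mul, hΦ n, hΨ n, flow_one, flow_neg_one, act_neg]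
  ring

section BaseChange

variable {S : Type u} [CommRing S] (φ : R →+* S)

theorem laxPow_baseChange {W : PDO R} (hW : IsDressing W) (n : ℕ) :
    laxPow (baseChange φ W) n = baseChange φ (laxPow W n) := by
  rw [laxPow, laxPow, baseChange_mul, baseChange_mul, baseChange_D, hW.baseChange_inv]

theorem WilsonSato.baseChange {W : PDO R} (hKP : WilsonSato W) (hW : IsDressing W) :
    WilsonSato (baseChange φ W) := by
  intro n
  have h : dt n W = -(minus (laxPow W n) ⋆ W) := hKP n
  change dt n (PDO.baseChange φ W) = _
  rw [← baseChange_dt, h, baseChange_neg, baseChange_mul, laxPow_baseChange φ hW, minus, minus,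
    baseChange_sub, baseChange_plus]

theorem flow_baseChange {W : PDO R} (hW : IsDressing W) (ε : ℤˣ) (n : ℕ+) :
    flow ε (baseChange φ W) n = baseChange φ (flow ε W n) := by
  rw [flow, flow, laxPow_baseChange φ hW]
  split_ifs
  · rw [baseChange_plus]
  · rw [baseChange_neg, baseChange_adj, baseChange_plus]

theorem dress_baseChange {W : PDO R} (hW : IsDressing W) (ε : ℤˣ) :
    dress ε (baseChange φ W) = baseChange φ (dress ε W) := by
  rw [dress, dress]
  split_ifs
  · rfl
  · rw [hW.adj.baseChange_inv, baseChange_adj]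

theorem IsSolution.map {W : PDO R} (hW : IsDressing W) {ε : ℤˣ} {Φ : Fun R}
    (hΦ : IsSolution ε W Φ) : IsSolution ε (baseChange φ W) (MvPowerSeries.map φ Φ) := fun n => by
  rw [flow_baseChange φ hW, act_baseChange, ddt_map, hΦ n]

end BaseChange

end Flows

/-! ### Laurent series in `λ⁻¹` -/

section Laurent

variable {A : Type*} [CommRing A]

theorem exists_coeff_bound (x : LaurentSeries A) : ∃ N : ℤ, ∀ n, n < N → x.coeff n = 0 :=
  ⟨x.order, fun _ hn => HahnSeries.coeff_eq_zero_of_lt_order hn⟩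

theorem laurent_coeff_mul (x y : LaurentSeries A) (n : ℤ) {M N : ℤ} (hx : ∀ i, i < M → x.coeff i = 0)
    (hy : ∀ i, i < N → y.coeff i = 0) (I : Finset ℤ) (hI : Finset.Icc M (n - N) ⊆ I) :
    (x * y).coeff n = ∑ i ∈ I, x.coeff i * y.coeff (n - i) := by
  rw [HahnSeries.coeff_mul]
  refine Finset.sum_of_injOn Prod.fst ?_ ?_ ?_ ?_
  · rintro ⟨a, b⟩ h ⟨a', b'⟩ h' he
    simp only [Finset.mem_coe, Finset.mem_antidiagonal] at h h' he
    simp only [Prod.mk.injEq]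
    omega
  · rintro ⟨a, b⟩ h
    simp only [Finset.mem_coe, Finset.mem_antidiagonal, HahnSeries.mem_support] at h
    refine hI (Finset.mem_Icc.mpr ⟨?_, ?_⟩)
    · by_contra hlt
      exact h.1 (hx _ (not_le.mp hlt))
    · by_contra hlt
      exact h.2.1 (hy _ (by simp only at hlt; omega))
  · intro i _ hi
    by_contra hne
    refine hi ⟨(i, n - i), ?_, rfl⟩
    simp only [Finset.mem_coe, Finset.mem_antidiagonal, HahnSeries.mem_support]
    exact ⟨left_ne_zero_of_mul hne, right_ne_zero_of_mul hne, by ring⟩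
  · rintro ⟨a, b⟩ h
    simp only [Finset.mem_antidiagonal] at h
    rw [← h.2.2, add_sub_cancel_left]

end Laurent

section Swap

variable {R : Type u} [CommRing R]

theorem coeff_swap (g : LaurentSeries (Fun R)) (α : ℕ+ →₀ ℕ) (n : ℤ) :
    (MvPowerSeries.coeff α (swap g)).coeff n = MvPowerSeries.coeff α (g.coeff n) := rfl

theorem ext_coeff {f g : Fun (LaurentSeries R)}
    (h : ∀ α n, (MvPowerSeries.coeff α f).coeff n = (MvPowerSeries.coeff α g).coeff n) : f = g :=
  MvPowerSeries.ext fun α => HahnSeries.ext (funext fun n => h α n)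

theorem swap_injective : Function.Injective (swap : LaurentSeries (Fun R) → Fun (LaurentSeries R)) := by
  intro g g' h
  refine HahnSeries.ext (funext fun n => MvPowerSeries.ext fun α => ?_)
  rw [← coeff_swap, ← coeff_swap, h]

theorem coeff_sum_laurent {ι : Type*} (s : Finset ι) (f : ι → LaurentSeries R) (n : ℤ) :
    (∑ i ∈ s, f i).coeff n = ∑ i ∈ s, (f i).coeff n :=
  map_sum (HahnSeries.coeff.addMonoidHom n) f s

theorem swap_mul (g g' : LaurentSeries (Fun R)) : swap (g * g') = swap g * swap g' := by
  obtain ⟨M, hM⟩ := exists_coeff_bound g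
  obtain ⟨N, hN⟩ := exists_coeff_bound g'
  refine ext_coeff fun α n => ?_
  classical
  rw [coeff_swap, laurent_coeff_mul g g' n hM hN _ subset_rfl, MvPowerSeries.coeff_mul, map_sum,
    coeff_sum_laurent]
  simp only [MvPowerSeries.coeff_mul]
  rw [Finset.sum_comm]
  refine Finset.sum_congr rfl fun p _ => ?_
  rw [laurent_coeff_mul _ _ n (M := M) (N := N) (fun i hi => by rw [coeff_swap, hM i hi, map_zero])
    (fun i hi => by rw [coeff_swap, hN i hi, map_zero]) _ subset_rfl]
  rfl

/-- `swap` as a ring homomorphism. -/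
def swapHom (R : Type u) [CommRing R] : LaurentSeries (Fun R) →+* Fun (LaurentSeries R) where
  toFun := swap
  map_one' := by
    refine ext_coeff fun α n => ?_
    classical
    rw [coeff_swap, MvPowerSeries.coeff_one, HahnSeries.coeff_one]
    by_cases hn : n = 0 <;> by_cases hα : α = 0 <;>
      simp [hn, hα, MvPowerSeries.coeff_one, HahnSeries.coeff_one]
  map_mul' := swap_mul
  map_zero' := ext_coeff fun α n => by rw [coeff_swap]; simp
  map_add' g g' := ext_coeff fun α n => by rw [coeff_swap, map_add]; simp [coeff_swap]

theorem swapHom_apply (g : LaurentSeries (Fun R)) : swapHom R g = swap g := rfl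

theorem lift_eq_swap (f : Fun R) : lift f = swap (HahnSeries.C f) := by
  refine ext_coeff fun α n => ?_
  rw [coeff_swap, lift, MvPowerSeries.coeff_map]
  by_cases hn : n = 0 <;> simp [hn]

/-- `λ ^ k` as a function of `(t, λ)`. -/
def lam (R : Type u) [CommRing R] (k : ℤ) : Fun (LaurentSeries R) :=
  MvPowerSeries.C (HahnSeries.single (-k) (1 : R))

theorem lam_mul_lam (j k : ℤ) : lam R j * lam R k = lam R (j + k) := by
  rw [lam, lam, lam, ← map_mul, HahnSeries.single_mul_single, mul_one, neg_add]

@[simp] theorem lam_zero : lam R 0 = 1 := by rw [lam, neg_zero, HahnSeries.single_zero_one, map_one]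
theorem lamInv_eq : (lamInv : Fun (LaurentSeries R)) = lam R (-1) := by rw [lamInv, lam, neg_neg]

theorem lamInv_mul_lam_one : (lamInv : Fun (LaurentSeries R)) * lam R 1 = 1 := by
  rw [lamInv_eq, lam_mul_lam, neg_add_cancel, lam_zero]

theorem lam_eq_swap (k : ℤ) : lam R k = swap (D k) := by
  refine ext_coeff fun α n => ?_
  classical
  rw [coeff_swap, lam, MvPowerSeries.coeff_C, D]
  by_cases hn : n = -k <;> by_cases hα : α = 0 <;>
      simp [hn, hα, MvPowerSeries.coeff_one, HahnSeries.coeff_single_of_ne]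

theorem coeff_lam_mul (k : ℤ) (f : Fun (LaurentSeries R)) (α : ℕ+ →₀ ℕ) (n : ℤ) :
    (MvPowerSeries.coeff α (lam R k * f)).coeff n = (MvPowerSeries.coeff α f).coeff (n + k) := by
  rw [lam, MvPowerSeries.coeff_C_mul, HahnSeries.coeff_single_mul, one_mul, sub_neg_eq_add]

theorem ddt_lift (n : ℕ+) (f : Fun R) : ddt n (lift f) = lift (ddt n f) := ddt_map _ _ _
theorem ddt_lam_mul (n : ℕ+) (k : ℤ) (f : Fun (LaurentSeries R)) :
    ddt n (lam R k * f) = lam R k * ddt n f := ddt_C_mul _ _ _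

theorem ddt_swap (n : ℕ+) (g : LaurentSeries (Fun R)) : ddt n (swap g) = swap (dt n g) := by
  refine ext_coeff fun α k => ?_
  rw [coeff_ddt, coeff_swap]
  have : ((α n : LaurentSeries R) + 1) = HahnSeries.C ((α n : R) + 1) := by
    rw [map_add, map_natCast, map_one]
  rw [this, mul_comm, HahnSeries.C_mul_eq_smul, HahnSeries.coeff_smul, coeff_swap, smul_eq_mul,
    mul_comm]
  exact (coeff_ddt n (g.coeff k) α).symm

end Swap

/-! ### The exponentials -/

section Exponential

variable {R : Type u} [CommRing R] [Algebra ℚ R]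

/-- The coefficients of `exp (ε ξ)`. -/
def expCoeff (ε : ℤˣ) (α : ℕ+ →₀ ℕ) : ℚ := α.prod fun _ k => ((ε : ℤ) : ℚ) ^ k / (k.factorial : ℚ)

theorem coeff_expXi (ε : ℤˣ) (α : ℕ+ →₀ ℕ) : MvPowerSeries.coeff α (expXi R ε)
    = HahnSeries.single (-(weight α : ℤ)) (algebraMap ℚ R (expCoeff ε α)) := rfl

theorem expCoeff_add_single (ε : ℤˣ) (α : ℕ+ →₀ ℕ) (n : ℕ+) :
    expCoeff ε (α + Finsupp.single n 1) * (α n + 1) = ((ε : ℤ) : ℚ) * expCoeff ε α := by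
  classical
  have hs : α.support ⊆ insert n α.support := Finset.subset_insert _ _
  have hs' : (α + Finsupp.single n 1).support ⊆ insert n α.support := by
    intro i hi
    by_cases h : i = n
    · exact h ▸ Finset.mem_insert_self _ _
    · refine Finset.mem_insert_of_mem ?_
      simpa [Finsupp.single_apply, Ne.symm h] using hi
  have hmem : n ∈ insert n α.support := Finset.mem_insert_self _ _
  rw [expCoeff, expCoeff, Finsupp.prod_of_support_subset _ hs' _ (by simp),
    Finsupp.prod_of_support_subset _ hs _ (by simp), ← Finset.mul_prod_erase _ _ hmem,
    ← Finset.mul_prod_erase _ _ hmem]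
  have hrest : ∏ i ∈ (insert n α.support).erase n,
        (((ε : ℤ) : ℚ) ^ ((α + Finsupp.single n 1 : ℕ+ →₀ ℕ) i)
          / (((α + Finsupp.single n 1 : ℕ+ →₀ ℕ) i).factorial : ℚ))
      = ∏ i ∈ (insert n α.support).erase n, (((ε : ℤ) : ℚ) ^ (α i) / ((α i).factorial : ℚ)) := by
    refine Finset.prod_congr rfl fun i hi => ?_
    rw [Finsupp.add_apply, Finsupp.single_eq_of_ne (Finset.ne_of_mem_erase hi), add_zero]
  rw [hrest, Finsupp.add_apply, Finsupp.single_eq_same, Nat.factorial_succ, pow_succ]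
  have h1 : ((α n).factorial : ℚ) ≠ 0 := Nat.cast_ne_zero.mpr (Nat.factorial_ne_zero _)
  have h2 : ((α n : ℚ) + 1) ≠ 0 := by positivity
  push_cast
  field_simp

theorem ddt_expXi (n : ℕ+) (ε : ℤˣ) :
    ddt n (expXi R ε) = (ε : ℤ) • (lam R (n : ℕ) * expXi R ε) := by
  refine MvPowerSeries.ext fun α => ?_
  rw [coeff_ddt, map_zsmul, lam, MvPowerSeries.coeff_C_mul, coeff_expXi, coeff_expXi,
    HahnSeries.single_mul_single, one_mul, weight_add_single]
  have : ((α n : LaurentSeries R) + 1) = HahnSeries.C ((α n : R) + 1) := by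
    rw [map_add, map_natCast, map_one]
  have hC : HahnSeries.C ((α n : R) + 1) = (HahnSeries.single (0 : ℤ) ((α n : R) + 1)) := rfl
  have hz : ∀ (k : ℤ) (r : R), (ε : ℤ) • HahnSeries.single k r = HahnSeries.single k ((ε : ℤ) • r) :=
    fun k r => (map_zsmul (HahnSeries.single.addMonoidHom k) (ε : ℤ) r).symm
  have h := congrArg (algebraMap ℚ R) (expCoeff_add_single ε α n)
  rw [map_mul, map_mul, map_add, map_natCast, map_one, map_intCast] at h
  rw [this, hC, HahnSeries.single_mul_single, Nat.cast_add, neg_add_rev, hz, h, zsmul_eq_mul,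
    add_zero]

theorem constantCoeff_expXi (ε : ℤˣ) : MvPowerSeries.constantCoeff (expXi R ε) = 1 := by
  rw [← MvPowerSeries.coeff_zero_eq_constantCoeff_apply, coeff_expXi, expCoeff,
    Finsupp.prod_zero_index, map_one]
  rfl

/-- All time derivatives of the product vanish, so it equals its value 1 at t = 0. -/
theorem expXi_mul_expXi_neg (ε : ℤˣ) : expXi R ε * expXi R (-ε) = 1 := by
  have h : ∀ n, ddt n (expXi R ε * expXi R (-ε)) = 0 := fun n => by
    rw [ddt_mul, ddt_expXi, ddt_expXi, Units.val_neg, neg_smul]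
    simp only [zsmul_eq_mul]
    ring
  rw [eq_C_of_ddt_eq_zero h, map_mul, constantCoeff_expXi, constantCoeff_expXi, mul_one, map_one]

theorem expXi_mul_cancel {ε : ℤˣ} {f g : Fun (LaurentSeries R)}
    (h : f * expXi R ε = g * expXi R ε) : f = g := by
  rw [← mul_one f, ← expXi_mul_expXi_neg ε, ← mul_assoc, h, mul_assoc, expXi_mul_expXi_neg, mul_one]

theorem hs_C_mul (ε : ℤˣ) (n : ℕ) (r : R) (f : Fun R) :
    hs ε n (MvPowerSeries.C r * f) = MvPowerSeries.C r * hs ε n f := by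
  rw [hs_mul, Finset.sum_eq_single (0, n)]
  · rw [hs_zero]
  · rintro ⟨a, b⟩ hp hne
    rw [mem_antidiagonal] at hp
    have : a ≠ 0 := by rintro rfl; exact hne (by rw [← hp, zero_add])
    rw [hs_C, if_neg this, zero_mul]
  · exact fun h => absurd (mem_antidiagonal.mpr (zero_add n)) h

/-- The shift by ε[μ⁻¹] multiplies exp(εξ(t, λ)) by exp ∑ₗ (λ/μ)ˡ/l = ∑ₙ (λ/μ)ⁿ, because ε² = 1. In
the recursion all n + 1 terms are equal. -/
theorem hs_expXi (ε : ℤˣ) (n : ℕ) : hs ε n (expXi R ε) = lam R n * expXi R ε := by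
  induction n using Nat.strong_induction_on with
  | _ n ih =>
    cases n with
    | zero => simp
    | succ n =>
      refine nsmul_left_cancel (n := n) ?_
      have h : ∀ p ∈ antidiagonal n, hs ε p.2 (ddt p.1.succPNat (expXi R ε))
          = (ε : ℤ) • (lam R ((n + 1 : ℕ) : ℤ) * expXi R ε) := by
        intro p hp
        have hp' := mem_antidiagonal.mp hp
        rw [ddt_expXi, hs_zsmul, lam, hs_C_mul, ← lam, ih _ (by omega), ← mul_assoc, lam_mul_lam,
          ← hp', Nat.succPNat_coe]
        congr 3
        push_cast
        ring
      rw [succ_smul_hs, Finset.sum_congr rfl h, Finset.sum_const, Finset.Nat.card_antidiagonal,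
        smul_comm, smul_smul, unit_mul_self, one_smul]

end Exponential

/-! ### Shifts as functions of `(t, λ)` -/

section ShiftFunction

variable {R : Type u} [CommRing R]

theorem ofPowerSeries_coeff (g : PowerSeries R) (n : ℤ) :
    (HahnSeries.ofPowerSeries ℤ R g).coeff n = if n < 0 then 0 else PowerSeries.coeff n.natAbs g :=
  PowerSeries.coeff_coe g n

/-- A power series in `λ⁻¹` as a function of `(t, λ)`. -/
def seriesHom (R : Type u) [CommRing R] : PowerSeries (Fun R) →+* Fun (LaurentSeries R) :=
  (swapHom R).comp (HahnSeries.ofPowerSeries ℤ (Fun R))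

theorem seriesHom_apply (g : PowerSeries (Fun R)) :
    seriesHom R g = swap (HahnSeries.ofPowerSeries ℤ (Fun R) g) := rfl

theorem seriesHom_C (f : Fun R) : seriesHom R (PowerSeries.C f) = lift f := by
  rw [seriesHom_apply, HahnSeries.ofPowerSeries_C, lift_eq_swap]

theorem seriesHom_X : seriesHom R PowerSeries.X = lamInv := by
  rw [seriesHom_apply, HahnSeries.ofPowerSeries_X, lamInv_eq, lam_eq_swap]
  rfl

variable [Algebra ℚ R]

theorem coeff_shift (ε : ℤˣ) (f : Fun R) (α : ℕ+ →₀ ℕ) (n : ℤ) :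
    (MvPowerSeries.coeff α (shift ε f)).coeff n
      = if n < 0 then 0 else MvPowerSeries.coeff α (hs ε n.natAbs f) :=
  (ofPowerSeries_coeff _ n).trans (if_congr Iff.rfl rfl (PowerSeries.coeff_mk _ _))

theorem shift_eq (ε : ℤˣ) (f : Fun R) : shift ε f = seriesHom R (shiftHom R ε f) := by
  refine ext_coeff fun α n => ?_
  rw [coeff_shift, seriesHom_apply, coeff_swap, ofPowerSeries_coeff, coeff_shiftHom]
  split_ifs <;> simp

theorem shift_mul (ε : ℤˣ) (f g : Fun R) : shift ε (f * g) = shift ε f * shift ε g := by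
  simp only [shift_eq, map_mul]

theorem ddt_shift (n : ℕ+) (ε : ℤˣ) (f : Fun R) : ddt n (shift ε f) = shift ε (ddt n f) := by
  rw [shift_eq, seriesHom_apply, ddt_swap, shift_eq, seriesHom_apply]
  congr 1
  ext1
  funext k
  change ddt n ((HahnSeries.ofPowerSeries ℤ (Fun R) (shiftHom R ε f)).coeff k) = _
  rw [ofPowerSeries_coeff, ofPowerSeries_coeff]
  split_ifs
  · exact ddt_zero n
  · rw [coeff_shiftHom, coeff_shiftHom, ddt_hs]

end ShiftFunction

/-! ### Operators applied to the exponentials -/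

section ApplyExp

variable {R : Type u} [CommRing R]

theorem units_zpow_add (ε : ℤˣ) (j k : ℤ) :
    ((ε ^ (j + k) : ℤˣ) : ℤ) = ((ε ^ j : ℤˣ) : ℤ) * ((ε ^ k : ℤˣ) : ℤ) := by
  rw [zpow_add, Units.val_mul]

/-- The substitution `λ ↦ ε λ`. -/
def twist (ε : ℤˣ) (P : LaurentSeries (Fun R)) : LaurentSeries (Fun R) :=
  HahnSeries.ofSuppBddBelow (fun n : ℤ => ((ε ^ n : ℤˣ) : ℤ) • P.coeff n) (by
    obtain ⟨M, hM⟩ := exists_bound P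
    refine bddBelow_of_le M fun n hn => ?_
    rw [hM n hn, smul_zero])

theorem coeff_twist (ε : ℤˣ) (P : LaurentSeries (Fun R)) (n : ℤ) :
    (twist ε P).coeff n = ((ε ^ n : ℤˣ) : ℤ) • P.coeff n := by
  rw [twist, HahnSeries.coeff_ofSuppBddBelow]

theorem twist_one (P : LaurentSeries (Fun R)) : twist 1 P = P := by
  ext1
  funext n
  rw [coeff_twist, one_zpow, Units.val_one, one_smul]

theorem twist_add (ε : ℤˣ) (P Q : LaurentSeries (Fun R)) :
    twist ε (P + Q) = twist ε P + twist ε Q := by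
  ext1
  funext n
  simp only [coeff_twist, HahnSeries.coeff_add, smul_add]

/-- The substitution `λ ↦ ε λ`, as an additive map. -/
def twistHom (ε : ℤˣ) : LaurentSeries (Fun R) →+ LaurentSeries (Fun R) :=
  AddMonoidHom.mk' (twist ε) (twist_add ε)

theorem twist_mul_D (ε : ℤˣ) (P : PDO R) (n : ℕ) :
    twist ε (P ⋆ D n) = ((ε : ℤ) ^ n) • ((D n : LaurentSeries (Fun R)) * twist ε P) := by
  ext1
  funext k
  have h1 : (P ⋆ D n).coeff k = P.coeff (k + n) := by
    have := co_mul_D P n (-k)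
    rw [co, co, neg_neg, neg_sub, sub_neg_eq_add, add_comm] at this
    exact this
  rw [coeff_twist, h1, HahnSeries.coeff_smul, D, HahnSeries.coeff_single_mul, one_mul, coeff_twist,
    sub_neg_eq_add, smul_smul, units_zpow_add, zpow_natCast, Units.val_pow_eq_pow_val, mul_left_comm,
    ← mul_pow, unit_mul_self, one_pow, mul_one]

/-- This is Res_λ (P e^ξ)(X⋆ e^{−ξ}) = Res_D (P X), with the exponentials cancelled. The signed
binomials of the adjoint become those of the operator product by upper negation. -/
theorem coeff_one_mul_twist_adj (P X : PDO R) :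
    (P * twist (-1) (adj X) : LaurentSeries (Fun R)).coeff 1 = res (P ⋆ X) := by
  obtain ⟨M, -, hP, hX, -⟩ := exists_co_bound₃ P X X
  have hP' : ∀ i, i < -M → P.coeff i = 0 := fun i hi => by
    have := hP (-i) (by omega); rwa [co, neg_neg] at this
  have hX' : ∀ i, i < -M → (twist (-1) (adj X)).coeff i = 0 := fun i hi => by
    have := co_adj_eq_zero hX (m := -i) (by omega)
    rw [co, neg_neg] at this
    rw [coeff_twist, this, smul_zero]
  set B := Finset.Icc (-1 - M) M with hB
  rw [laurent_coeff_mul _ _ 1 hP' hX' (Finset.Icc (-M) (1 + M)) (Finset.Icc_subset_Icc le_rfl (by omega)),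
    res, co_mul P X (-1) hP hX B B subset_rfl subset_rfl]
  refine Finset.sum_nbij' (fun i => -i) (fun i => -i) ?_ ?_ ?_ ?_ ?_
  · intro i hi
    rw [Finset.mem_Icc] at hi
    rw [hB, Finset.mem_Icc]; omega
  · intro i hi
    rw [hB, Finset.mem_Icc] at hi
    rw [Finset.mem_Icc]; omega
  · exact fun i _ => neg_neg i
  · exact fun i _ => neg_neg i
  · intro i hi
    rw [Finset.mem_Icc] at hi
    have h := co_adj X (i - 1) hX B (Finset.Icc_subset_Icc (by omega) le_rfl)
    rw [co, neg_sub] at h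
    rw [coeff_twist, h, Finset.smul_sum, Finset.mul_sum]
    refine Finset.sum_congr rfl fun j _ => ?_
    rw [show P.co (-i) = P.coeff i by rw [co, neg_neg], mul_smul_comm, mul_smul_comm, mul_smul_comm,
      smul_smul, smul_smul,
      show -i + j - -1 = j - (i - 1) by ring]
    congr 1
    change sg (1 - i) * sg j * _ = _
    by_cases hk : 0 ≤ j - (i - 1)
    · rw [ch_of_nonneg hk, ch_of_nonneg hk, choose_eq_sg_mul (-i), Int.toNat_of_nonneg hk,
        show j - (i - 1) - 1 - -i = j by ring, ← sg_add,
        show 1 - i + j = j - (i - 1) by ring]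
    · rw [ch_of_neg (by omega), ch_of_neg (by omega), mul_zero]

theorem D_one_mul_eq (P : PDO R) : D 1 ⋆ P = dt 1 P + P ⋆ D 1 :=
  ext_co fun m => by rw [co_D_one_mul, co_add, co_dt, co_mul_D, add_comm]

variable [Algebra ℚ R]

theorem applyExp_eq (ε : ℤˣ) (P : PDO R) : applyExp ε P = swap (twist ε P) * expXi R ε := rfl

theorem applyExp_add (ε : ℤˣ) (P Q : PDO R) :
    applyExp ε (P + Q) = applyExp ε P + applyExp ε Q := by
  rw [applyExp_eq, twist_add, ← swapHom_apply, map_add, add_mul]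
  rfl

/-- Application to the exponential, as an additive map. -/
def applyExpHom (ε : ℤˣ) : PDO R →+ Fun (LaurentSeries R) :=
  AddMonoidHom.mk' (applyExp ε) (applyExp_add ε)

theorem applyExp_sum (ε : ℤˣ) {ι : Type*} (s : Finset ι) (P : ι → PDO R) :
    applyExp ε (∑ i ∈ s, P i) = ∑ i ∈ s, applyExp ε (P i) := map_sum (applyExpHom ε) P s

/-- Besides differentiating the coefficients, ∂ₙ multiplies the exponential by ελⁿ, and (P
Dⁿ)(e^{εξ}) = (ελ)ⁿ P(e^{εξ}). -/
theorem ddt_applyExp (n : ℕ+) (ε : ℤˣ) (P : PDO R) : ddt n (applyExp ε P)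
    = applyExp ε (dt n P + ((ε : ℤ) * (ε : ℤ) ^ (n : ℕ)) • (P ⋆ D (n : ℕ))) := by
  have h1 : twist ε (dt n P) = dt n (twist ε P) := by
    ext1
    funext k
    rw [coeff_twist]
    change _ = ddt n ((twist ε P).coeff k)
    rw [coeff_twist, ddt_zsmul]
    rfl
  have h2 : twist ε (((ε : ℤ) * (ε : ℤ) ^ (n : ℕ)) • (P ⋆ D (n : ℕ)))
      = (ε : ℤ) • ((D (n : ℕ) : LaurentSeries (Fun R)) * twist ε P) := by
    have := map_zsmul (twistHom ε) ((ε : ℤ) * (ε : ℤ) ^ (n : ℕ)) (P ⋆ D (n : ℕ))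
    refine this.trans ?_
    change _ • twist ε (P ⋆ D (n : ℕ)) = _
    rw [twist_mul_D, smul_smul, mul_assoc, ← mul_pow, unit_mul_self, one_pow, mul_one]
  rw [applyExp_eq, applyExp_eq, ddt_mul, ddt_swap, ddt_expXi, twist_add, h1, h2, ← swapHom_apply,
    ← swapHom_apply, ← swapHom_apply, map_add, map_zsmul, map_mul, swapHom_apply (D _), ← lam_eq_swap]
  simp only [zsmul_eq_mul]
  ring

theorem applyExp_D_one_mul (ε : ℤˣ) (P : PDO R) : applyExp ε (D 1 ⋆ P) = ddt 1 (applyExp ε P) := by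
  rw [ddt_applyExp, PNat.one_coe, pow_one, unit_mul_self, one_smul, Nat.cast_one, D_one_mul_eq]

theorem applyExp_D_mul (ε : ℤˣ) (j : ℕ) (P : PDO R) :
    applyExp ε (D j ⋆ P) = dx j (applyExp ε P) := by
  induction j with
  | zero => rw [Nat.cast_zero, one_mul']; rfl
  | succ j ih => rw [D_succ, mul_assoc', applyExp_D_one_mul, ih, dx_succ']

theorem applyExp_ofFun_mul (ε : ℤˣ) (b : Fun R) (P : PDO R) :
    applyExp ε (ofFun b ⋆ P) = lift b * applyExp ε P := by
  have : twist ε (ofFun b ⋆ P) = HahnSeries.C b * twist ε P := by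
    ext1
    funext n
    have h := co_ofFun_mul b P (-n)
    rw [co, co, neg_neg] at h
    rw [coeff_twist, h, HahnSeries.C_mul_eq_smul, HahnSeries.coeff_smul, coeff_twist, smul_eq_mul,
      mul_smul_comm]
  rw [applyExp_eq, this, swap_mul, ← lift_eq_swap, mul_assoc, ← applyExp_eq]

theorem act_lift_applyExp {B : PDO R} (hB : IsDiff B) (ε : ℤˣ) (P : PDO R) :
    act (PDO.lift B) (applyExp ε P) = applyExp ε (B ⋆ P) := by
  obtain ⟨K, hK⟩ := exists_nat_bound B
  conv_rhs => rw [hB.eq_sum hK]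
  rw [act_eq_sum (PDO.lift B) (K := K) (fun i hi => by rw [PDO.lift, co_baseChange, hK i hi, map_zero]),
    sum_mul', applyExp_sum]
  refine Finset.sum_congr rfl fun j _ => ?_
  rw [mul_assoc', applyExp_ofFun_mul, applyExp_D_mul]
  rfl

/-- The Baker–Akhiezer function for `ε = 1`, the adjoint one for `ε = -1`. -/
def wave (ε : ℤˣ) (W : PDO R) : Fun (LaurentSeries R) := applyExp ε (dress ε W)

theorem wave_one (W : PDO R) : wave 1 W = ba W := by rw [wave, dress_one, ba]
theorem wave_neg_one (W : PDO R) : wave (-1) W = baAdj W := by rw [wave, dress_neg_one, baAdj]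

theorem WilsonSato.isSolution_wave {W : PDO R} (hKP : WilsonSato W) (hW : IsDressing W) (ε : ℤˣ) :
    IsSolution ε (PDO.lift W) (wave ε W) := fun n => by
  rw [wave, ddt_applyExp, hKP.dt_dress hW, PDO.lift, flow_baseChange _ hW, ← PDO.lift,
    act_lift_applyExp (isDiff_flow ε W n)]

/-- The map of Laurent series induced by a map of the coefficients. -/
def laurentMap {S : Type v} [CommRing S] (φ : R →+* S) : LaurentSeries R →+* LaurentSeries S where
  toFun x := x.map φ
  map_one' := by
    ext1
    funext n
    change φ ((1 : LaurentSeries R).coeff n) = _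
    rw [HahnSeries.coeff_one, HahnSeries.coeff_one]
    split_ifs <;> simp
  map_mul' x y := HahnSeries.map_mul (φ : R →ₙ+* S)
  map_zero' := HahnSeries.ext (funext fun _ => map_zero φ)
  map_add' x y := HahnSeries.map_add (φ : R →+ S)

end ApplyExp

/-! ### Shifts of eigenfunctions -/

section EigenfunctionShift

variable {R : Type u} [CommRing R]

theorem co_mul_dressing {P U : PDO R} (hP : ∀ i : ℤ, 1 < i → P.co i = 0) (hU : IsDressing U) :
    (P ⋆ U).co 1 = P.co 1 ∧ (P ⋆ U).co 0 = P.co 0 + P.co 1 * U.co (-1) := by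
  refine ⟨?_, ?_⟩
  · rw [co_mul P U 1 hP hU.2 {1} {0} (by simp) (by simp), Finset.sum_singleton, Finset.sum_singleton,
      hU.1]
    simp
  · rw [co_mul P U 0 hP hU.2 {0, 1} {-1, 0} (by decide) (by decide), Finset.sum_pair (by decide),
      Finset.sum_pair (by decide), Finset.sum_pair (by decide), hU.1]
    simp [ch, dx_succ]

variable [Algebra ℚ R]

/-- The coefficients of the operator whose application to `exp (ε ξ)` is the coefficient of `λ⁻ⁿ`
in the shift by `-ε [λ⁻¹]` of the application of `∑ⱼ pⱼ D ^ j`. -/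
def shiftSymbol (ε : ℤˣ) : ℕ → (ℤ → Fun R) → ℤ → Fun R
  | 0, p, j => p j
  | n + 1, p, j => hs (-ε) (n + 1) (p j) - (ε : ℤ) • hs (-ε) n (p (j - 1))

theorem sum_ddt_hs (ε : ℤˣ) (n : ℕ) (f : Fun R) :
    ∑ p ∈ antidiagonal n, ddt p.1.succPNat (hs ε p.2 f)
      = (ε : ℤ) • (n + 1) • hs ε (n + 1) f := by
  rw [succ_smul_hs, smul_smul, unit_mul_self, one_smul]
  exact Finset.sum_congr rfl fun p _ => ddt_hs _ _ _ _

/-- The recursion `succ_smul_hs` for the shift by −ε[λ⁻¹], written for operators applied to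
exp(εξ(t, μ)): each ∂ₗ differentiates the coefficients and moves the order by l, with sign ε · εˡ.
The solution has two terms because the exponential is multiplied by 1 − μ/λ. -/
theorem succ_smul_shiftSymbol (ε : ℤˣ) (n : ℕ) (p : ℤ → Fun R) (j : ℤ) :
    (n + 1) • shiftSymbol ε (n + 1) p j = -(ε : ℤ) • ∑ q ∈ antidiagonal n,
      (ddt q.1.succPNat (shiftSymbol ε q.2 p j)
        + ((ε : ℤ) * (ε : ℤ) ^ (q.1 + 1)) • shiftSymbol ε q.2 p (j - (q.1 + 1 : ℕ))) := by
  have hε := unit_mul_self ε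
  cases n with
  | zero =>
    have h := sum_ddt_hs (-ε) 0 (p j)
    simp only [Finset.Nat.antidiagonal_zero, Finset.sum_singleton, hs_zero, zero_add, one_smul] at h ⊢
    simp only [shiftSymbol, hs_zero, h, zero_add, pow_one, hε, one_smul, Units.val_neg, smul_add,
      smul_smul, neg_mul_neg]
    rw [neg_smul, ← sub_eq_add_neg, Nat.cast_one]
  | succ n =>
    have h1 := sum_ddt_hs (-ε) (n + 1) (p j)
    have h2 := sum_ddt_hs (-ε) n (p (j - 1))
    rw [Finset.sum_add_distrib, Finset.Nat.sum_antidiagonal_succ',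
      Finset.Nat.sum_antidiagonal_succ'
        (f := fun q : ℕ × ℕ => ((ε : ℤ) * (ε : ℤ) ^ (q.1 + 1)) • shiftSymbol ε q.2 p (j - (q.1 + 1 : ℕ)))]
    rw [Finset.Nat.sum_antidiagonal_succ'] at h1
    -- The order-moving terms telescope: the first term of the symbol for l + 1 cancels the second
    -- term for l, leaving only the one with p (j − 1).
    have h3 : ∑ q ∈ antidiagonal n, ((ε : ℤ) * (ε : ℤ) ^ (q.1 + 1)) •
          hs (-ε) (q.2 + 1) (p (j - (q.1 + 1 : ℕ)))
        + ((ε : ℤ) * (ε : ℤ) ^ (n + 1 + 1)) • p (j - (n + 1 + 1 : ℕ))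
        = hs (-ε) (n + 1) (p (j - 1)) + (ε : ℤ) • ∑ q ∈ antidiagonal n,
          ((ε : ℤ) * (ε : ℤ) ^ (q.1 + 1)) • hs (-ε) q.2 (p (j - (q.1 + 1 : ℕ) - 1)) := by
      have h4 := Finset.Nat.sum_antidiagonal_succ (n := n)
        (f := fun q : ℕ × ℕ => ((ε : ℤ) * (ε : ℤ) ^ (q.1 + 1)) • hs (-ε) q.2 (p (j - (q.1 + 1 : ℕ))))
      rw [Finset.Nat.sum_antidiagonal_succ'] at h4
      simp only [zero_add, pow_one, hε, one_smul, hs_zero, Nat.cast_one] at h4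
      rw [add_comm, h4, Finset.smul_sum]
      congr 1
      refine Finset.sum_congr rfl fun q _ => ?_
      rw [smul_smul, pow_succ _ (q.1 + 1), mul_comm _ (ε : ℤ),
        show j - ((q.1 + 1 + 1 : ℕ) : ℤ) = j - (q.1 + 1 : ℕ) - 1 by push_cast; ring]
    simp only [shiftSymbol, ddt_sub, ddt_zsmul, smul_sub, Finset.sum_sub_distrib, hs_zero] at h1 h3 ⊢
    rw [← Finset.smul_sum, h2]
    simp only [smul_comm _ (ε : ℤ)] at h3 ⊢
    rw [← Finset.smul_sum]
    have hsq : (((ε : ℤ) : ℤ) : Fun R) * ((ε : ℤ) : Fun R) = 1 := by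
      rw [← Int.cast_mul, hε, Int.cast_one]
    generalize ∑ q ∈ antidiagonal n, ((ε : ℤ) * (ε : ℤ) ^ (q.1 + 1)) •
      hs (-ε) (q.2 + 1) (p (j - (q.1 + 1 : ℕ))) = A at h3 ⊢
    generalize ∑ q ∈ antidiagonal n, ((ε : ℤ) * (ε : ℤ) ^ (q.1 + 1)) •
      hs (-ε) q.2 (p (j - (q.1 + 1 : ℕ) - 1)) = B at h3 ⊢
    generalize ∑ q ∈ antidiagonal n, ddt q.1.succPNat (hs (-ε) (q.2 + 1) (p j)) = E at h1 ⊢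
    generalize ((ε : ℤ) * (ε : ℤ) ^ (n + 1 + 1)) • p (j - (n + 1 + 1 : ℕ)) = F at h3 ⊢
    generalize ddt (n + 1).succPNat (p j) = G at h1 ⊢
    rw [Units.val_neg] at h1 ⊢
    simp only [zsmul_eq_mul, nsmul_eq_mul] at h1 h3 ⊢
    push_cast at h1 h3 ⊢
    linear_combination ((ε : ℤ) : Fun R) * h1 + ((ε : ℤ) : Fun R) * h3
      - (((n : Fun R) + 2) * hs (-ε) (n + 1 + 1) (p j)
        - ((ε : ℤ) : Fun R) * (n + 1) * hs (-ε) (n + 1) (p (j - 1))) * hsq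

/-- The shift by `-ε [λ⁻¹]` acts on eigenfunctions by differential operators. -/
theorem exists_shift_operator {W : PDO R} (hKP : WilsonSato W) (hW : IsDressing W) (ε : ℤˣ) (n : ℕ) :
    ∃ Q : PDO R, IsDiff Q ∧ (∀ j, (Q ⋆ dress ε W).co j = shiftSymbol ε n (dress ε W).co j) ∧
      ∀ Φ, IsSolution ε W Φ → hs (-ε) n Φ = act Q Φ := by
  induction n using Nat.strong_induction_on with
  | _ n ih =>
    cases n with
    | zero =>
      refine ⟨D 0, isDiff_D 0, fun j => by rw [one_mul']; rfl, fun Φ _ => ?_⟩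
      rw [hs_zero, act_D_zero]
    | succ n =>
      -- The dummy operator 0 beyond n lets `choose` produce a family indexed by all of ℕ.
      have ih' : ∀ m : ℕ, ∃ Q : PDO R, m ≤ n → IsDiff Q ∧
          (∀ j, (Q ⋆ dress ε W).co j = shiftSymbol ε m (dress ε W).co j) ∧
          ∀ Φ, IsSolution ε W Φ → hs (-ε) m Φ = act Q Φ := fun m => by
        by_cases h : m ≤ n
        · obtain ⟨Q, hQ⟩ := ih m (Nat.lt_succ_of_le h)
          exact ⟨Q, fun _ => hQ⟩
        · exact ⟨0, fun h' => absurd h' h⟩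
      choose Q hQ using ih'
      have hmem : ∀ p ∈ antidiagonal n, p.2 ≤ n := fun p hp =>
        Finset.HasAntidiagonal.antidiagonal.snd_le hp
      set c : Fun R := MvPowerSeries.C (algebraMap ℚ R (1 / (n + 1))) with hc
      have hc' : ∀ f : Fun R, c * (n + 1) • f = f := fun f => by
        rw [nsmul_eq_mul, ← mul_assoc]
        have : c * ((n + 1 : ℕ) : Fun R) = 1 := by
          rw [hc, ← map_natCast (MvPowerSeries.C : R →+* Fun R), ← map_natCast (algebraMap ℚ R),
            ← map_mul, ← map_mul]
          rw [show (1 / ((n : ℚ) + 1) * ((n + 1 : ℕ) : ℚ)) = 1 by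
            push_cast; exact one_div_mul_cancel (by positivity), map_one, map_one]
        rw [this, one_mul]
      -- On eigenfunctions ∂ₗ(QΦ) = (∂ₗQ + Q Bₗ)Φ, with Bₗ the flow operator. The recursion
      -- therefore gives the next operator as −ε/(n + 1) times this sum, with l = p.1 + 1 and c
      -- supplying 1/(n + 1).
      set A : PDO R := ∑ p ∈ antidiagonal n,
        (dt p.1.succPNat (Q p.2) + Q p.2 ⋆ flow ε W p.1.succPNat) with hA
      have hAd : IsDiff A := IsDiff.sum fun p hp =>
        ((hQ p.2 (hmem p hp)).1.dt _).add ((hQ p.2 (hmem p hp)).1.mul (isDiff_flow _ _ _))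
      have hA' : IsDiff ((-(ε : ℤ)) • A) := fun j hj => by rw [co_zsmul, hAd j hj, smul_zero]
      refine ⟨ofFun c ⋆ ((-(ε : ℤ)) • A), (isDiff_ofFun c).mul hA', fun j => ?_, fun Φ hΦ => ?_⟩
      · rw [mul_assoc', co_ofFun_mul, zsmul_mul', co_zsmul, hA, sum_mul', co_sum,
          ← hc' (shiftSymbol ε (n + 1) _ _), succ_smul_shiftSymbol]
        congr 2
        refine Finset.sum_congr rfl fun p hp => ?_
        obtain ⟨-, h, -⟩ := hQ p.2 (hmem p hp)
        -- On the dressing operator U the flow is Bₗ U = ∂ₗU + ε εˡ U Dˡ, so the same sum reproduces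
        -- the recursion for the symbols.
        have h' := congrArg (fun P : PDO R => P.co j) (congrArg (Q p.2 ⋆ ·)
          (hKP.dt_dress hW ε p.1.succPNat))
        simp only [PDO.mul_add', PDO.mul_zsmul', co_add, co_zsmul, ← mul_assoc', co_mul_D] at h'
        rw [PDO.add_mul', co_add, ← h', h, ← h j, ← co_dt, dt_mul, co_add, Nat.succPNat_coe]
        exact (add_assoc _ _ _).symm
      · rw [act_ofFun_mul, act_zsmul, hA, act_sum, ← hc' (hs (-ε) (n + 1) Φ), succ_smul_hs,
          Units.val_neg]
        congr 2
        refine Finset.sum_congr rfl fun p hp => ?_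
        obtain ⟨hd, -, h⟩ := hQ p.2 (hmem p hp)
        rw [act_add, act_mul hd (isDiff_flow _ _ _), ← hΦ, ← ddt_act, ← h Φ hΦ, ddt_hs]

/-- The symbol of Q U has no order above one, and neither has Q = (Q U) U⁻¹. Its coefficients at D
and 1 are read off from Q U, using U = 1 + w D⁻¹ + ⋯; so one formula holds for every eigenfunction.
-/
theorem IsSolution.hs_succ {W : PDO R} (hKP : WilsonSato W) (hW : IsDressing W) {ε : ℤˣ} {Φ : Fun R}
    (hΦ : IsSolution ε W Φ) (n : ℕ) : hs (-ε) (n + 1) Φ = (ε : ℤ) •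
      (((if n = 0 then (dress ε W).co (-1) else 0) - hs (-ε) n ((dress ε W).co (-1))) * Φ
        - if n = 0 then ddt 1 Φ else 0) := by
  obtain ⟨Q, -, hQ, hact⟩ := exists_shift_operator hKP hW ε (n + 1)
  have hU := isDressing_dress ε hW
  set U := dress ε W
  have hbound : ∀ i : ℤ, 1 < i → Q.co i = 0 := by
    intro i hi
    have h1 : Q = (Q ⋆ U) ⋆ inv U := by rw [mul_assoc', hU.mul_inv, mul_one']
    rw [h1]
    refine co_mul_eq_zero (M := 1) (N := 0) (fun k hk => ?_) (isDressing_inv U).2 (by omega)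
    rw [hQ, shiftSymbol, hU.2 k (by omega), hU.2 (k - 1) (by omega), hs_zero_right, hs_zero_right,
      smul_zero, sub_zero]
  obtain ⟨h1, h0⟩ := co_mul_dressing hbound hU
  rw [hQ, shiftSymbol, hU.2 1 (by norm_num), sub_self, hU.1, hs_one, hs_zero_right, zero_sub] at h1
  rw [hQ, shiftSymbol, hU.1, hs_one, if_neg n.succ_ne_zero, zero_sub, zero_sub, ← h1] at h0
  have h0' := eq_sub_of_add_eq h0.symm
  rw [hact Φ hΦ, act_eq_sum Q (K := 2) (fun i hi => hbound i (by omega)), Finset.sum_range_succ,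
    Finset.sum_range_one, Nat.cast_zero, Nat.cast_one, h0', ← h1, dx_zero_left, dx_succ,
    dx_zero_left]
  split_ifs
  · simp only [zsmul_eq_mul]; ring
  · simp only [zsmul_eq_mul]; ring

/-- The linear problem of the shift, for `ε`-eigenfunctions. -/
theorem IsSolution.lift_eq {W : PDO R} (hKP : WilsonSato W) (hW : IsDressing W) {ε : ℤˣ}
    {Φ : Fun R} (hΦ : IsSolution ε W Φ) : lift Φ = shift ε Φ + (ε : ℤ) • (lamInv *
      ((shift ε ((dress ε W).co (-1)) - lift ((dress ε W).co (-1))) * shift ε Φ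
        - shift ε (ddt 1 Φ))) := by
  set w := (dress ε W).co (-1) with hw
  have h : shiftHom R (-ε) Φ = PowerSeries.C Φ + (ε : ℤ) • (PowerSeries.X *
      ((PowerSeries.C w - shiftHom R (-ε) w) * PowerSeries.C Φ - PowerSeries.C (ddt 1 Φ))) := by
    ext n : 1
    cases n with
    | zero =>
      rw [coeff_shiftHom, map_add, map_zsmul, PowerSeries.coeff_zero_X_mul, PowerSeries.coeff_C,
        hs_zero, if_pos rfl, smul_zero, add_zero]
    | succ n =>
      rw [coeff_shiftHom, hΦ.hs_succ hKP hW, map_add, map_zsmul, PowerSeries.coeff_succ_X_mul,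
        PowerSeries.coeff_C, if_neg n.succ_ne_zero, zero_add, map_sub, PowerSeries.coeff_mul_C,
        map_sub, PowerSeries.coeff_C, PowerSeries.coeff_C, coeff_shiftHom]
  -- The relation h expresses Φ(t − ε[λ⁻¹]) through Φ(t); moving t by ε[λ⁻¹] with the same λ gives
  -- Φ(t) in terms of shifted functions.
  have h2 := congrArg (shiftSeries ε) h
  rw [shiftSeries_shiftHom_neg, map_add, map_zsmul, shiftSeries_X_mul, map_sub, shiftSeries_mul_C,
    map_sub, shiftSeries_shiftHom_neg, shiftSeries_C, shiftSeries_C, shiftSeries_C] at h2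
  have h3 := congrArg (seriesHom R) h2
  rwa [map_add, map_zsmul, map_mul, map_sub, map_mul, map_sub, ← shift_eq, ← shift_eq, ← shift_eq,
    seriesHom_C, seriesHom_C, seriesHom_X] at h3

end EigenfunctionShift

/-! ### Coefficients of powers of the spectral parameter -/

section LamCoeff

variable {R : Type u} [CommRing R]

/-- The coefficient of `λ⁻ⁿ`. -/
def lamCoeff (n : ℤ) : Fun (LaurentSeries R) →+ Fun R where
  toFun f := fun α => (MvPowerSeries.coeff α f).coeff n
  map_zero' := rfl
  map_add' _ _ := rfl

theorem coeff_lamCoeff (n : ℤ) (f : Fun (LaurentSeries R)) (α : ℕ+ →₀ ℕ) :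
    MvPowerSeries.coeff α (lamCoeff n f) = (MvPowerSeries.coeff α f).coeff n := rfl

theorem ext_lamCoeff {f g : Fun (LaurentSeries R)} (h : ∀ n, lamCoeff n f = lamCoeff n g) : f = g :=
  ext_coeff fun α n => by rw [← coeff_lamCoeff, h, coeff_lamCoeff]

theorem lamCoeff_swap (n : ℤ) (g : LaurentSeries (Fun R)) : lamCoeff n (swap g) = g.coeff n := rfl

theorem lamCoeff_lam_mul (n k : ℤ) (f : Fun (LaurentSeries R)) :
    lamCoeff n (lam R k * f) = lamCoeff (n + k) f :=
  MvPowerSeries.ext fun α => by rw [coeff_lamCoeff, coeff_lam_mul, coeff_lamCoeff]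

theorem lamCoeff_ddt (n : ℤ) (m : ℕ+) (f : Fun (LaurentSeries R)) :
    lamCoeff n (ddt m f) = ddt m (lamCoeff n f) := by
  ext α
  rw [coeff_lamCoeff, coeff_ddt, coeff_ddt, coeff_lamCoeff]
  have : ((α m : LaurentSeries R) + 1) = HahnSeries.C ((α m : R) + 1) := by
    rw [map_add, map_one, map_natCast]
  rw [this, mul_comm, HahnSeries.C_mul_eq_smul, HahnSeries.coeff_smul, smul_eq_mul, mul_comm]

theorem lamCoeff_dx (n : ℤ) (k : ℕ) (f : Fun (LaurentSeries R)) :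
    lamCoeff n (dx k f) = dx k (lamCoeff n f) := by
  induction k with
  | zero => rfl
  | succ k ih => rw [dx_succ', dx_succ', lamCoeff_ddt, ih]

theorem lamCoeff_lift_mul (n : ℤ) (f : Fun R) (g : Fun (LaurentSeries R)) :
    lamCoeff n (lift f * g) = f * lamCoeff n g := by
  classical
  ext α
  rw [coeff_lamCoeff, MvPowerSeries.coeff_mul, MvPowerSeries.coeff_mul, coeff_sum_laurent]
  refine Finset.sum_congr rfl fun p _ => ?_
  rw [lift, MvPowerSeries.coeff_map, HahnSeries.C_mul_eq_smul, HahnSeries.coeff_smul, smul_eq_mul,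
    coeff_lamCoeff]

theorem lamCoeff_seriesHom (n : ℕ) (g : PowerSeries (Fun R)) :
    lamCoeff n (seriesHom R g) = PowerSeries.coeff n g := by
  rw [seriesHom_apply, lamCoeff_swap, ofPowerSeries_coeff, if_neg (by omega), Int.natAbs_natCast]

theorem seriesHom_injective : Function.Injective (seriesHom R) := fun g g' h =>
  PowerSeries.ext fun n => by rw [← lamCoeff_seriesHom, h, lamCoeff_seriesHom]

theorem lamCoeff_hs [Algebra ℚ R] (ε : ℤˣ) (n : ℤ) (m : ℕ) (f : Fun (LaurentSeries R)) :
    lamCoeff n (hs ε m f) = hs ε m (lamCoeff n f) := by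
  induction m using Nat.strong_induction_on generalizing f with
  | _ m ih =>
    cases m with
    | zero => rw [hs_zero, hs_zero]
    | succ m =>
      refine nsmul_left_cancel (n := m) ?_
      rw [← map_nsmul, succ_smul_hs, succ_smul_hs, map_zsmul, map_sum]
      congr 1
      refine Finset.sum_congr rfl fun p hp => ?_
      rw [ih p.2 (Nat.lt_succ_of_le (Finset.HasAntidiagonal.antidiagonal.snd_le hp)), lamCoeff_ddt]

end LamCoeff

/-! ### The bilinear identity -/

section Bilinear

variable {R : Type u} [CommRing R] [Algebra ℚ R]

/-- The differential operators applied to the Baker–Akhiezer function. -/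
def IsWaveMultiple (W : PDO R) (f : Fun (LaurentSeries R)) : Prop :=
  ∃ Q : PDO R, IsDiff Q ∧ f = applyExp 1 (Q ⋆ W)

theorem isWaveMultiple_ba (W : PDO R) : IsWaveMultiple W (ba W) :=
  ⟨D 0, isDiff_D 0, by rw [one_mul', ba]⟩

/-- By the Sato equations ∂ₙ replaces Q by ∂ₙQ + Q Bₙ. Closure under all the flows turns the residue
at equal times into the bilinear identity at different times. -/
theorem IsWaveMultiple.ddt {W : PDO R} (hKP : WilsonSato W) (hW : IsDressing W)
    {f : Fun (LaurentSeries R)} (hf : IsWaveMultiple W f) (n : ℕ+) : IsWaveMultiple W (ddt n f) := by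
  obtain ⟨Q, hQ, rfl⟩ := hf
  refine ⟨dt n Q + Q ⋆ flow 1 W n, (hQ.dt n).add (hQ.mul (isDiff_flow _ _ _)), ?_⟩
  have h := hKP.dt_dress hW 1 n
  rw [dress_one] at h
  rw [ddt_applyExp, dt_mul, PDO.add_mul', mul_assoc' Q (flow 1 W n), ← h, PDO.mul_add',
    PDO.mul_zsmul', mul_assoc', add_assoc]

/-- The residue in λ equals Res_D (Q W W⁻¹) = Res_D Q, and a differential operator has no residue.
-/
theorem IsWaveMultiple.residue {W : PDO R} (hW : IsDressing W) {f : Fun (LaurentSeries R)}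
    (hf : IsWaveMultiple W f) : lamCoeff 1 (f * baAdj W) = 0 := by
  obtain ⟨Q, hQ, rfl⟩ := hf
  have h : applyExp 1 (Q ⋆ W) * baAdj W = swap ((Q ⋆ W) * twist (-1) (adj (PDO.inv W))) := by
    rw [baAdj, applyExp_eq, applyExp_eq, twist_one, mul_mul_mul_comm, expXi_mul_expXi_neg, mul_one,
      swap_mul, hW.adj_inv]
  rw [h, lamCoeff_swap, coeff_one_mul_twist_adj, mul_assoc', hW.mul_inv, mul_one', res, hQ _ (by norm_num)]

theorem IsWaveMultiple.residue_hs {W : PDO R} (hKP : WilsonSato W) (hW : IsDressing W) (ε : ℤˣ) (n : ℕ)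
    {f : Fun (LaurentSeries R)} (hf : IsWaveMultiple W f) :
    lamCoeff 1 (hs ε n f * baAdj W) = 0 := by
  induction n using Nat.strong_induction_on generalizing f with
  | _ n ih =>
    cases n with
    | zero => rw [hs_zero, hf.residue hW]
    | succ n =>
      refine nsmul_left_cancel (n := n) ?_
      rw [smul_zero, ← map_nsmul, ← smul_mul_assoc, succ_smul_hs, smul_mul_assoc, map_zsmul,
        Finset.sum_mul, map_sum, Finset.sum_eq_zero, smul_zero]
      exact fun p hp => ih p.2 (Nat.lt_succ_of_le (Finset.HasAntidiagonal.antidiagonal.snd_le hp))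
        (hf.ddt hKP hW _)

/-- The bilinear identity Res ψ(t, λ) ψ⋆(t′, λ) = 0, coefficient by coefficient. Induction is on the
degree of β, then of α. For α = 0 the β-coefficient of the equal-time identity is used, whose other
terms have smaller degree in t′. For α ≠ 0 a power of tₙ is removed by passing to ∂ₙf, and the
resulting integer is cancelled. -/
theorem IsWaveMultiple.residue_coeff {W : PDO R} (hKP : WilsonSato W) (hW : IsDressing W)
    {f : Fun (LaurentSeries R)} (hf : IsWaveMultiple W f) (α β : ℕ+ →₀ ℕ) :
    (MvPowerSeries.coeff α f * MvPowerSeries.coeff β (baAdj W)).coeff 1 = 0 := by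
  classical
  have := IsAddTorsionFree.of_module_rat R
  suffices H : ∀ (N : ℕ) (β : ℕ+ →₀ ℕ), β.degree = N → ∀ (M : ℕ) (α : ℕ+ →₀ ℕ), α.degree = M →
      ∀ f, IsWaveMultiple W f →
        (MvPowerSeries.coeff α f * MvPowerSeries.coeff β (baAdj W)).coeff 1 = 0 from
    H _ β rfl _ α rfl f hf
  intro N
  induction N using Nat.strong_induction_on with
  | _ N ih =>
    intro β hβ M
    induction M with
    | zero =>
      intro α hα f hf
      obtain rfl : α = 0 := (Finsupp.degree_eq_zero_iff α).mp hα
      have h := congrArg (MvPowerSeries.coeff β) (hf.residue hW)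
      rw [coeff_lamCoeff, MvPowerSeries.coeff_mul, coeff_sum_laurent, map_zero,
        Finset.sum_eq_single_of_mem (0, β) (by simp)] at h
      · exact h
      · rintro ⟨a, b⟩ hab hne
        rw [mem_antidiagonal] at hab
        refine ih b.degree ?_ b rfl _ a rfl f hf
        have ha : a.degree ≠ 0 := fun h0 => hne (by
          rw [Finsupp.degree_eq_zero_iff] at h0
          simp only at hab
          rw [h0, zero_add] at hab
          rw [h0, hab])
        have := congrArg Finsupp.degree hab
        simp only [map_add] at this
        omega
    | succ M ihM =>
      intro α hα f hf
      obtain ⟨n, hn⟩ : ∃ n, α n ≠ 0 := by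
        by_contra! h
        rw [show α = 0 from Finsupp.ext h, map_zero] at hα
        omega
      obtain ⟨α', rfl⟩ : ∃ α', α = α' + Finsupp.single n 1 :=
        ⟨α - Finsupp.single n 1, (tsub_add_cancel_of_le (by
          rw [Finsupp.single_le_iff]; omega)).symm⟩
      have h := ihM α' (by simpa using hα) _ (hf.ddt hKP hW n)
      rw [coeff_ddt, mul_right_comm, ← Nat.cast_succ, mul_comm _ ((_ : ℕ) : LaurentSeries R),
        ← nsmul_eq_mul, HahnSeries.coeff_smul] at h
      exact (smul_eq_zero.mp h).resolve_left (by omega)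

end Bilinear

/-! ### Tau-functions -/

section Tau

variable {R : Type u} [CommRing R]

theorem coeff_zero_mul (f g : PowerSeries R) :
    PowerSeries.coeff 0 (f * g) = PowerSeries.coeff 0 f * PowerSeries.coeff 0 g := by
  simp

/-- The power series `∑ₙ wₙ (ε λ)⁻ⁿ` in `λ⁻¹` for the dressing operator `∑ₙ wₙ D⁻ⁿ` of the wave
function. -/
def waveSeries (ε : ℤˣ) (W : PDO R) : PowerSeries (Fun R) :=
  PowerSeries.mk fun n => (twist ε (dress ε W)).coeff n

theorem coeff_waveSeries (ε : ℤˣ) (W : PDO R) (n : ℕ) :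
    PowerSeries.coeff n (waveSeries ε W) = (twist ε (dress ε W)).coeff n := PowerSeries.coeff_mk _ _

theorem coeff_zero_waveSeries (ε : ℤˣ) {W : PDO R} (hW : IsDressing W) :
    PowerSeries.coeff 0 (waveSeries ε W) = 1 := by
  rw [coeff_waveSeries, coeff_twist, Nat.cast_zero, zpow_zero, Units.val_one, one_smul]
  exact (isDressing_dress ε hW).1

theorem waveSeries_baseChange {S : Type u} [CommRing S] (φ : R →+* S) {W : PDO R}
    (hW : IsDressing W) (ε : ℤˣ) :
    waveSeries ε (baseChange φ W) = PowerSeries.map (MvPowerSeries.map φ) (waveSeries ε W) := by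
  ext n : 1
  rw [PowerSeries.coeff_map, coeff_waveSeries, coeff_waveSeries, coeff_twist, coeff_twist,
    dress_baseChange φ hW, map_zsmul]
  rfl

variable [Algebra ℚ R]

theorem wave_eq (ε : ℤˣ) {W : PDO R} (hW : IsDressing W) :
    wave ε W = seriesHom R (waveSeries ε W) * expXi R ε := by
  rw [wave, applyExp_eq, seriesHom_apply]
  congr 2
  ext1
  funext n
  rw [ofPowerSeries_coeff]
  split_ifs with h
  · have := (isDressing_dress ε hW).2 (-n) (by omega)
    rw [co, neg_neg] at this
    rw [coeff_twist, this, smul_zero]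
  · rw [coeff_waveSeries, Int.natCast_natAbs, abs_of_nonneg (by omega)]

theorem hs_wave (ε : ℤˣ) {W : PDO R} (hW : IsDressing W) (n : ℕ) :
    hs ε n (wave ε W) = (∑ p ∈ antidiagonal n, lam R p.2 * hs ε p.1 (seriesHom R (waveSeries ε W)))
      * expXi R ε := by
  rw [wave_eq ε hW, hs_mul, Finset.sum_mul]
  refine Finset.sum_congr rfl fun p _ => ?_
  rw [hs_expXi]
  ring

theorem hs_seriesHom (ε : ℤˣ) (n : ℕ) (g : PowerSeries (Fun R)) : hs ε n (seriesHom R g)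
    = seriesHom R (PowerSeries.mk fun k => hs ε n (PowerSeries.coeff k g)) := by
  refine ext_lamCoeff fun k => ?_
  rw [lamCoeff_hs, seriesHom_apply, lamCoeff_swap, seriesHom_apply, lamCoeff_swap,
    ofPowerSeries_coeff, ofPowerSeries_coeff]
  split_ifs
  · exact hs_zero_right _ _
  · rw [PowerSeries.coeff_mk]

/-- The bilinear identity between the times t + [μ⁻¹] and t. The exponentials contribute ∑ (λ/μ)ᵏ,
so the residue in λ of the coefficient of μ⁻ⁿ is the coefficient n + 1 of the product, except for
the term with constant second factor, which vanishes because the leading coefficient of ψ is 1. -/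
theorem shiftSeries_waveSeries_mul {W : PDO R} (hKP : WilsonSato W) (hW : IsDressing W) :
    shiftSeries 1 (waveSeries 1 W) * waveSeries (-1) W = 1 := by
  set w := waveSeries 1 W
  set v := waveSeries (-1) W
  have key : ∀ m, PowerSeries.coeff m (shiftSeries 1 w * v) = ∑ p ∈ antidiagonal m,
      PowerSeries.coeff p.2 (PowerSeries.mk (fun k => hs 1 p.1 (PowerSeries.coeff k w)) * v) := by
    intro m
    rw [PowerSeries.coeff_mul]
    simp only [coeff_shiftSeries, PowerSeries.coeff_mul, PowerSeries.coeff_mk, Finset.sum_mul]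
    exact (sum_antidiagonal_assoc m fun a b c =>
      hs 1 a (PowerSeries.coeff b w) * PowerSeries.coeff c v).symm
  ext m : 1
  rw [key]
  cases m with
  | zero =>
    rw [Finset.Nat.antidiagonal_zero, Finset.sum_singleton, coeff_zero_mul,
      PowerSeries.coeff_mk, hs_zero, coeff_zero_waveSeries 1 hW, coeff_zero_waveSeries (-1) hW,
      one_mul, PowerSeries.coeff_zero_one]
  | succ n =>
    rw [Finset.Nat.sum_antidiagonal_succ', coeff_zero_mul, PowerSeries.coeff_mk,
      coeff_zero_waveSeries 1 hW, hs_one, if_neg n.succ_ne_zero, zero_mul, zero_add,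
      PowerSeries.coeff_one, if_neg n.succ_ne_zero]
    have h := (isWaveMultiple_ba W).residue_hs hKP hW 1 n
    rw [← wave_one, ← wave_neg_one, hs_wave 1 hW n, wave_eq (-1) hW, mul_mul_mul_comm,
      expXi_mul_expXi_neg, mul_one, Finset.sum_mul, map_sum] at h
    rw [← h]
    refine Finset.sum_congr rfl fun p _ => ?_
    rw [mul_assoc, lamCoeff_lam_mul, hs_seriesHom, ← map_mul,
      show (1 : ℤ) + (p.2 : ℤ) = ((p.2 + 1 : ℕ) : ℤ) by push_cast; ring, lamCoeff_seriesHom]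

/-- The wave functions in terms of the tau-function: `τ(t) ψ(t, λ) = τ(t - ε [λ⁻¹]) exp (ε ξ)`, in
terms of the power series in `λ⁻¹`. -/
def TauForm (W : PDO R) (τ : Fun R) : Prop :=
  ∀ ε : ℤˣ, waveSeries ε W * PowerSeries.C τ = shiftHom R (-ε) τ

/-- For ψ this is the hypothesis without its exponential. Shifted by [λ⁻¹] it reads w(t + [λ⁻¹]) τ(t
+ [λ⁻¹]) = τ(t), with w the series of ψ, and the product identity replaces 1 / w(t + [λ⁻¹]) by the
series of ψ⋆. -/
theorem IsTau.tauForm {W : PDO R} (hKP : WilsonSato W) (hW : IsDressing W) {τ : (Fun R)ˣ}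
    (hτ : IsTau W τ) : TauForm W τ := by
  have h1 : waveSeries 1 W * PowerSeries.C (τ : Fun R) = shiftHom R (-1) τ := by
    rw [IsTau, ← wave_one, wave_eq 1 hW, ← mul_assoc, shift_eq, ← seriesHom_C, ← map_mul] at hτ
    rw [mul_comm]
    exact seriesHom_injective (expXi_mul_cancel hτ)
  intro ε
  rcases Int.units_eq_one_or ε with rfl | rfl
  · exact h1
  · have h2 := congrArg (shiftSeries 1) h1
    rw [shiftSeries_mul_C, shiftSeries_shiftHom_neg] at h2
    rw [← h2, mul_comm, mul_right_comm, shiftSeries_waveSeries_mul hKP hW, one_mul, neg_neg]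

theorem TauForm.wave {W : PDO R} (hW : IsDressing W) {τ : Fun R} (h : TauForm W τ) (ε : ℤˣ) :
    lift τ * wave ε W = shift (-ε) τ * expXi R ε := by
  rw [wave_eq ε hW, shift_eq, ← h ε, map_mul, seriesHom_C]
  ring

/-- The coefficient of λ⁻¹ in the tau formula. W and W⋆⁻¹ thus have the same first coefficient −∂ₓ
log τ, which is what later cancels between a wave function and an eigenfunction of the opposite
type. -/
theorem TauForm.co_dress {W : PDO R} {τ : Fun R} (h : TauForm W τ) (ε : ℤˣ) :
    (dress ε W).co (-1) * τ = -ddt 1 τ := by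
  have h1 := congrArg (PowerSeries.coeff 1) (h ε)
  have h2 := succ_smul_hs (-ε) 0 τ
  simp only [Finset.Nat.antidiagonal_zero, Finset.sum_singleton, hs_zero, zero_add, one_smul] at h2
  rw [PowerSeries.coeff_mul_C, coeff_waveSeries, coeff_shiftHom, h2, coeff_twist, Nat.cast_one,
    zpow_one] at h1
  have h3 := congrArg ((ε : ℤ) • ·) h1
  simp only [smul_mul_assoc, smul_smul, unit_mul_self, one_smul, Units.val_neg, neg_smul, smul_neg] at h3
  exact h3

theorem TauForm.map {S : Type u} [CommRing S] [Algebra ℚ S] (φ : R →+* S) {W : PDO R}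
    (hW : IsDressing W) {τ : Fun R} (h : TauForm W τ) :
    TauForm (baseChange φ W) (MvPowerSeries.map φ τ) := fun ε => by
  rw [waveSeries_baseChange φ hW, ← PowerSeries.map_C, ← map_mul, h ε]
  ext n : 1
  rw [PowerSeries.coeff_map, coeff_shiftHom, coeff_shiftHom, hs_map]

end Tau

/-! ### Oscillating functions -/

section Oscillating

theorem dx_lift {R : Type u} [CommRing R] (k : ℕ) (a : Fun R) : dx k (lift a) = lift (dx k a) :=
  dx_map _ _ _

variable {R : Type u} [CommRing R] [Algebra ℚ R] {ε : ℤˣ} {f g : Fun (LaurentSeries R)}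

theorem isOscillating_applyExp (ε : ℤˣ) (P : PDO R) : IsOscillating ε (applyExp ε P) := ⟨_, rfl⟩

theorem IsOscillating.swap_mul (hf : IsOscillating ε f) (a : LaurentSeries (Fun R)) :
    IsOscillating ε (swap a * f) := by
  obtain ⟨b, rfl⟩ := hf
  exact ⟨a * b, by rw [KP.swap_mul, mul_assoc]⟩

theorem IsOscillating.lift_mul (hf : IsOscillating ε f) (a : Fun R) :
    IsOscillating ε (lift a * f) := lift_eq_swap a ▸ hf.swap_mul _

theorem IsOscillating.sub (hf : IsOscillating ε f) (hg : IsOscillating ε g) :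
    IsOscillating ε (f - g) := by
  obtain ⟨a, rfl⟩ := hf
  obtain ⟨b, rfl⟩ := hg
  exact ⟨a - b, by rw [← swapHom_apply, ← swapHom_apply, ← swapHom_apply, map_sub, sub_mul]⟩

theorem isOscillating_zero (ε : ℤˣ) : IsOscillating ε (0 : Fun (LaurentSeries R)) :=
  ⟨0, by rw [← swapHom_apply, map_zero, zero_mul]⟩

theorem IsOscillating.neg (hf : IsOscillating ε f) : IsOscillating ε (-f) := by
  rw [← zero_sub]; exact (isOscillating_zero ε).sub hf

theorem IsOscillating.add (hf : IsOscillating ε f) (hg : IsOscillating ε g) :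
    IsOscillating ε (f + g) := by
  rw [← sub_neg_eq_add]; exact hf.sub hg.neg

theorem IsOscillating.sum {ι : Type*} {s : Finset ι} {F : ι → Fun (LaurentSeries R)}
    (h : ∀ i ∈ s, IsOscillating ε (F i)) : IsOscillating ε (∑ i ∈ s, F i) :=
  Finset.sum_induction F _ (fun _ _ ha hb => ha.add hb) (isOscillating_zero ε) h

theorem ddt_swap_mul_expXi (n : ℕ+) (ε : ℤˣ) (a : LaurentSeries (Fun R)) :
    ddt n (swap a * expXi R ε)
      = swap (dt n a + (ε : ℤ) • ((D (n : ℕ) : LaurentSeries (Fun R)) * a)) * expXi R ε := by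
  rw [ddt_mul, ddt_swap, ddt_expXi, ← swapHom_apply (_ + _), map_add, map_zsmul, map_mul,
    swapHom_apply, swapHom_apply, swapHom_apply, ← lam_eq_swap]
  simp only [zsmul_eq_mul]
  ring

theorem IsOscillating.ddt (hf : IsOscillating ε f) (n : ℕ+) : IsOscillating ε (ddt n f) := by
  obtain ⟨a, rfl⟩ := hf
  exact ⟨_, ddt_swap_mul_expXi n ε a⟩

theorem IsOscillating.dx (hf : IsOscillating ε f) (k : ℕ) : IsOscillating ε (dx k f) := by
  induction k with
  | zero => exact hf
  | succ k ih => rw [dx_succ']; exact ih.ddt 1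

/-- A nonzero oscillating function depends on `x`. -/
theorem IsOscillating.eq_zero (hf : IsOscillating ε f) (h : KP.ddt 1 f = 0) : f = 0 := by
  obtain ⟨a, rfl⟩ := hf
  rw [ddt_swap_mul_expXi] at h
  have h1 := swap_injective (expXi_mul_cancel (h.trans (zero_mul _).symm) |>.trans
    (map_zero (swapHom R)).symm)
  -- Vanishing of the x-derivative of a e^{εξ} means ελ a = −∂ₓa, so each coefficient is determined
  -- by the one at the next higher power of λ; these vanish from some power on.
  have h2 : ∀ k, a.coeff (k + 1) = -((ε : ℤ) • KP.ddt 1 (a.coeff k)) := fun k => by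
    have h3 := congrArg (fun x : LaurentSeries (Fun R) => (ε : ℤ) • x.coeff k) h1
    simp only [HahnSeries.coeff_add, HahnSeries.coeff_smul, HahnSeries.coeff_zero, smul_zero, D,
      HahnSeries.coeff_single_mul, one_mul, PNat.one_coe, Nat.cast_one, sub_neg_eq_add, smul_add,
      smul_smul, unit_mul_self, one_smul] at h3
    exact eq_neg_of_add_eq_zero_right h3
  obtain ⟨N, hN⟩ := exists_coeff_bound a
  have h4 : ∀ k : ℕ, a.coeff (N - 1 + k) = 0 := fun k => by
    induction k with
    | zero => exact hN _ (by simp)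
    | succ k ih => rw [Nat.cast_succ, ← add_assoc, h2, ih, ddt_zero, smul_zero, neg_zero]
  have h5 : a = 0 := by
    ext1
    funext k
    by_cases hk : k < N
    · exact hN k hk
    · have := h4 (k - (N - 1)).toNat
      rwa [Int.toNat_of_nonneg (by omega), add_sub_cancel] at this
  rw [h5, ← swapHom_apply, map_zero, zero_mul]

theorem IsOscillating.resTerm_lift (hf : IsOscillating ε f) (j : ℕ) (a : Fun R) :
    IsOscillating ε (resTerm j f (lift a)) := by
  induction j generalizing f with
  | zero => exact isOscillating_zero ε
  | succ j ih =>
    rw [resTerm, dx_lift, mul_comm]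
    exact (hf.lift_mul _).sub (ih (hf.ddt 1))

theorem IsOscillating.resTerm_lift_left (hf : IsOscillating ε f) (j : ℕ) (a : Fun R) :
    IsOscillating ε (resTerm j (lift a) f) := by
  induction j generalizing a with
  | zero => exact isOscillating_zero ε
  | succ j ih =>
    rw [resTerm, ddt_lift]
    exact ((hf.dx j).lift_mul _).sub (ih _)

/-- The prescribed time derivatives of the potential are oscillating, so `IsOscillating.eq_zero` can
be applied to the error in each time equation. -/
theorem IsOscillating.sepRes {B : PDO R} (hB : IsDiff B) (hf : IsOscillating ε f) (a : Fun R) :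
    IsOscillating ε (sepRes (PDO.lift B) f (lift a)) ∧
      IsOscillating ε (sepRes (PDO.lift B) (lift a) f) := by
  obtain ⟨K, hK⟩ := exists_nat_bound B
  have hB' : IsDiff (PDO.lift B) := hB.baseChange _
  have hK' : ∀ i : ℤ, K ≤ i → (PDO.lift B).co i = 0 := fun i hi => by
    rw [PDO.lift, co_baseChange, hK i hi, map_zero]
  have hco : ∀ i, (PDO.lift B).co i = lift (B.co i) := fun i => co_baseChange _ _ _
  refine ⟨?_, ?_⟩
  · rw [sepRes_eq_sum hB' hK']
    refine IsOscillating.sum fun j _ => ?_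
    rw [hco, ← map_mul]
    exact hf.resTerm_lift_left _ _
  · rw [sepRes_eq_sum hB' hK']
    refine IsOscillating.sum fun j _ => ?_
    rw [hco, mul_comm]
    exact (hf.lift_mul _).resTerm_lift _ _

end Oscillating

/-! ### Squared eigenfunction potentials -/

section Potentials

variable {R : Type u} [CommRing R]

theorem IsSolution.lift {W : PDO R} (hW : IsDressing W) {ε : ℤˣ} {Φ : Fun R} (hΦ : IsSolution ε W Φ) :
    IsSolution ε (PDO.lift W) (KP.lift Φ) := hΦ.map _ hW

theorem plus_laxPow_lift {W : PDO R} (hW : IsDressing W) (n : ℕ) :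
    plus (laxPow (PDO.lift W) n) = PDO.lift (plus (laxPow W n)) := by
  rw [PDO.lift, PDO.lift, laxPow_baseChange _ hW, baseChange_plus]

variable [Algebra ℚ R]

theorem IsSEP.sepEq {W : PDO R} {Φ Ψ G : Fun R} (hG : IsSEP W Φ Ψ G) : SEPEq W Φ Ψ G := by
  intro S
  refine ⟨fun hS => ⟨MvPowerSeries.constantCoeff (S - G), ?_⟩, ?_⟩
  · rw [← eq_C_of_ddt_eq_zero (f := S - G) fun n => by rw [ddt_sub, hS n, hG n, sub_self],
      add_sub_cancel]
  · rintro ⟨c, rfl⟩ n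
    rw [ddt_add, ddt_C, add_zero, hG n]

theorem IsSEP.sepEqOsc {ε : ℤˣ} {W : PDO (LaurentSeries R)} {Φ Ψ G : Fun (LaurentSeries R)}
    (hG : IsSEP W Φ Ψ G) (hosc : IsOscillating ε G) : SEPEqOsc ε W Φ Ψ G := by
  refine ⟨hG.sepEq, fun S => ⟨?_, ?_⟩⟩
  · rintro ⟨hS, hS'⟩
    refine sub_eq_zero.mp ((hS'.sub hosc).eq_zero ?_)
    rw [ddt_sub, hS 1, hG 1, sub_self]
  · rintro rfl
    exact ⟨hG, hosc⟩

variable {W : PDO R} {τ : (Fun R)ˣ}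

/-- The logarithmic x-derivative of τ(t − ε[λ⁻¹]) e^{εξ} / τ(t). The coefficient −∂ₓ log τ is taken
from `dress (-ε)` to match the equation for eigenfunctions of type −ε. -/
theorem ddt_one_wave (hW : IsDressing W) (hτ : TauForm W τ) (ε : ℤˣ) : ddt 1 (wave ε W)
    = wave ε W * ((ε : ℤ) • lam R 1 - (shift (-ε) ((dress (-ε) W).co (-1))
      - lift ((dress (-ε) W).co (-1)))) := by
  have h := hτ.wave hW ε
  have hd := congrArg (ddt 1) h
  rw [ddt_mul, ddt_mul, ddt_lift, ddt_shift, ddt_expXi, PNat.one_coe, Nat.cast_one] at hd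
  have hu := congrArg lift (hτ.co_dress (-ε))
  have hus := congrArg (shift (-ε)) (hτ.co_dress (-ε))
  rw [map_mul, map_neg] at hu
  rw [shift_mul, shift_eq (-ε) (-_), map_neg, map_neg, ← shift_eq] at hus
  refine ((Units.isUnit τ).map lift).mul_left_cancel ?_
  simp only [zsmul_eq_mul] at hd ⊢
  linear_combination hd - (((ε : ℤ) : Fun (LaurentSeries R)) * lam R 1
      - shift (-ε) ((dress (-ε) W).co (-1))) * h - wave ε W * hu + expXi R ε * hus

/-- Write Θ₋ and w₋ for the functions at t − ε[λ⁻¹], with w = −∂ₓ log τ. Differentiating ελ⁻¹ψΘ₋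
gives ψ(Θ₋ − ελ⁻¹((w₋ − w)Θ₋ − ∂ₓΘ₋)), and by the linear problem of the shift the bracket is Θ(t).
-/
theorem ddt_one_potential (hKP : WilsonSato W) (hW : IsDressing W) (hτ : TauForm W τ) {ε : ℤˣ}
    {Θ : Fun R} (hΘ : IsSolution (-ε) W Θ) :
    ddt 1 ((ε : ℤ) • (lamInv * wave ε W * shift (-ε) Θ)) = wave ε W * lift Θ := by
  have hl : (lamInv : Fun (LaurentSeries R)) * lam R 1 = 1 := lamInv_mul_lam_one
  have hε : (((ε : ℤ) : ℤ) : Fun (LaurentSeries R)) * ((ε : ℤ) : Fun (LaurentSeries R)) = 1 := by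
    rw [← Int.cast_mul, unit_mul_self, Int.cast_one]
  rw [hΘ.lift_eq hKP hW, ddt_zsmul, mul_assoc, lamInv_eq, ddt_lam_mul, ← lamInv_eq, ddt_mul,
    ddt_one_wave hW hτ, ddt_shift, Units.val_neg]
  simp only [zsmul_eq_mul]
  push_cast
  linear_combination wave ε W * shift (-ε) Θ * hl * ((ε : ℤ) : Fun (LaurentSeries R)) ^ 2
    + wave ε W * shift (-ε) Θ * hε

theorem isOscillating_potential (ε : ℤˣ) (Θ : Fun R) :
    IsOscillating ε ((ε : ℤ) • (lamInv * wave ε W * shift (-ε) Θ)) := by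
  have h : IsOscillating ε (lamInv * wave ε W * shift (-ε) Θ) := by
    rw [shift_eq, seriesHom_apply, mul_comm, lamInv_eq, lam_eq_swap]
    exact ((isOscillating_applyExp ε _).swap_mul _).swap_mul _
  rcases Int.units_eq_one_or ε with rfl | rfl
  · simpa using h
  · simpa using h.neg

/-- The error in the n-th equation is oscillating, and by commuting ∂ₓ with ∂ₙ its x-derivative is
∂ₙ(ψΨ) − ∂ₙ(ψΨ) = 0. -/
theorem isSEP_ba (hKP : WilsonSato W) (hW : IsDressing W) (hτ : TauForm W τ) {Ψ : Fun R}
    (hΨ : IsSolution (-1) W Ψ) :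
    IsSEP (PDO.lift W) (ba W) (lift Ψ) (lamInv * ba W * shift (-1) Ψ) := by
  have h1 := ddt_one_potential hKP hW hτ hΨ
  have h2 := isOscillating_potential (W := W) 1 Ψ
  rw [wave_one, Units.val_one, one_smul] at h1 h2
  have hba : IsOscillating 1 (ba W) := isOscillating_applyExp 1 _
  refine isSEP_iff.mpr fun n => sub_eq_zero.mp (((h2.ddt n).sub ?_).eq_zero ?_)
  · rw [plus_laxPow_lift hW]
    exact (hba.sepRes (isDiff_plus _) Ψ).1
  · have h3 := hKP.isSolution_wave hW 1
    rw [wave_one] at h3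
    rw [ddt_sub, ddt_comm, h1, ddt_one_sepRes_eq h3 (hΨ.lift hW), sub_eq_zero]

theorem isSEP_baAdj (hKP : WilsonSato W) (hW : IsDressing W) (hτ : TauForm W τ) {Φ : Fun R}
    (hΦ : IsSolution 1 W Φ) :
    IsSEP (PDO.lift W) (lift Φ) (baAdj W) (-(lamInv * baAdj W * shift 1 Φ)) := by
  have h1 := ddt_one_potential hKP hW hτ (ε := -1) (by rwa [neg_neg])
  have h2 := isOscillating_potential (W := W) (-1) Φ
  rw [wave_neg_one, Units.val_neg, Units.val_one, neg_smul, one_smul, neg_neg] at h1 h2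
  have hba : IsOscillating (-1) (baAdj W) := isOscillating_applyExp (-1) _
  refine isSEP_iff.mpr fun n => sub_eq_zero.mp (((h2.ddt n).sub ?_).eq_zero ?_)
  · rw [plus_laxPow_lift hW]
    exact (hba.sepRes (isDiff_plus _) Φ).2
  · have h3 := hKP.isSolution_wave hW (-1)
    rw [wave_neg_one] at h3
    rw [ddt_sub, ddt_comm, h1, ddt_one_sepRes_eq (hΦ.lift hW) h3, sub_eq_zero, mul_comm]

theorem sepEqOsc_ba (hKP : WilsonSato W) (hW : IsDressing W) (hτ : TauForm W τ) {Ψ : Fun R}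
    (hΨ : IsSolution (-1) W Ψ) :
    SEPEqOsc 1 (PDO.lift W) (ba W) (lift Ψ) (lamInv * ba W * shift (-1) Ψ) := by
  have h := isOscillating_potential (W := W) 1 Ψ
  rw [wave_one, Units.val_one, one_smul] at h
  exact (isSEP_ba hKP hW hτ hΨ).sepEqOsc h

theorem sepEqOsc_baAdj (hKP : WilsonSato W) (hW : IsDressing W) (hτ : TauForm W τ) {Φ : Fun R}
    (hΦ : IsSolution 1 W Φ) :
    SEPEqOsc (-1) (PDO.lift W) (lift Φ) (baAdj W) (-(lamInv * baAdj W * shift 1 Φ)) := by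
  have h := isOscillating_potential (W := W) (-1) Φ
  rw [wave_neg_one, Units.val_neg, Units.val_one, neg_smul, one_smul, neg_neg] at h
  exact (isSEP_baAdj hKP hW hτ hΦ).sepEqOsc h

theorem TauForm.lift (hW : IsDressing W) (hτ : TauForm W τ) :
    TauForm (PDO.lift W) (Units.map (KP.lift : Fun R →+* _).toMonoidHom τ : (Fun (LaurentSeries R))ˣ) :=
  hτ.map _ hW

theorem isSolution_ba (hKP : WilsonSato W) (hW : IsDressing W) :
    IsSolution 1 (PDO.lift W) (ba W) := by
  rw [← wave_one]; exact hKP.isSolution_wave hW 1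

theorem isSolution_baAdj (hKP : WilsonSato W) (hW : IsDressing W) :
    IsSolution (-1) (PDO.lift W) (baAdj W) := by
  rw [← wave_neg_one]; exact hKP.isSolution_wave hW (-1)

/-- The denominator of ψ(t + [λ⁻¹], μ) and the numerator of ψ⋆(t, λ) are both τ(t + [λ⁻¹]) and
cancel; what remains is the vertex operator acting on τ, divided by τ. -/
theorem potential_eq_vertexRatio (hW : IsDressing W) (hτ : TauForm W τ) :
    lamInv * shift 1 (ba W) * baAdj (PDO.lift W) = vertexRatio τ := by
  have h1 := congrArg (shift 1) (hτ.wave hW 1)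
  have h2 := (hτ.lift hW).wave (hW.baseChange _) (-1)
  rw [wave_one, shift_mul, shift_mul] at h1
  rw [wave_neg_one, neg_neg] at h2
  have h3 : KP.lift (KP.lift (τ : Fun R)) * KP.lift (KP.lift ((τ⁻¹ : (Fun R)ˣ) : Fun R)) = 1 := by
    rw [← map_mul, ← map_mul, Units.mul_inv, map_one, map_one]
  refine (((Units.isUnit τ).map KP.lift).map KP.lift).mul_left_cancel ?_
  rw [vertexRatio, vertex]
  change KP.lift (KP.lift (τ : Fun R)) * baAdj (PDO.lift W) = shift 1 (KP.lift (τ : Fun R)) * _ at h2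
  linear_combination lamInv * shift 1 (ba W) * h2 + lamInv * expXi (LaurentSeries R) (-1) * h1
    - lamInv * (shift 1 (expXi R 1) * expXi (LaurentSeries R) (-1)) * shift 1 (shift (-1) (τ : Fun R)) * h3

end Potentials

/-! ### Comparison of the two expansions -/

section Expansions

theorem lamCoeff_resTerm_right {R : Type u} [CommRing R] (n : ℤ) (j : ℕ) (a : Fun R)
    (f : Fun (LaurentSeries R)) :
    lamCoeff n (resTerm j (lift a) f) = resTerm j a (lamCoeff n f) := by
  induction j generalizing a with
  | zero => exact map_zero _
  | succ j ih => rw [resTerm, resTerm, map_sub, lamCoeff_lift_mul, lamCoeff_dx, ddt_lift, ih]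

theorem lamCoeff_resTerm_left {R : Type u} [CommRing R] (n : ℤ) (j : ℕ) (a : Fun R)
    (f : Fun (LaurentSeries R)) :
    lamCoeff n (resTerm j f (lift a)) = resTerm j (lamCoeff n f) a := by
  induction j generalizing f with
  | zero => exact map_zero _
  | succ j ih =>
    rw [resTerm, resTerm, map_sub, dx_lift, mul_comm, lamCoeff_lift_mul, ih, lamCoeff_ddt, mul_comm]

section

variable {R : Type u} [CommRing R] {B : PDO R}

theorem lamCoeff_sepRes_left (hB : IsDiff B) (n : ℤ) (a : Fun R) (f : Fun (LaurentSeries R)) :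
    lamCoeff n (sepRes (PDO.lift B) f (lift a)) = sepRes B (lamCoeff n f) a := by
  obtain ⟨K, hK⟩ := exists_nat_bound B
  rw [sepRes_eq_sum hB hK, PDO.lift, sepRes_eq_sum (hB.baseChange _) (K := K)
    (fun i hi => by rw [co_baseChange, hK i hi, map_zero]), map_sum]
  refine Finset.sum_congr rfl fun j _ => ?_
  rw [← lamCoeff_resTerm_right, map_mul]
  rfl

theorem lamCoeff_sepRes_right (hB : IsDiff B) (n : ℤ) (a : Fun R) (f : Fun (LaurentSeries R)) :
    lamCoeff n (sepRes (PDO.lift B) (lift a) f) = sepRes B a (lamCoeff n f) := by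
  obtain ⟨K, hK⟩ := exists_nat_bound B
  rw [sepRes_eq_sum hB hK, PDO.lift, sepRes_eq_sum (hB.baseChange _) (K := K)
    (fun i hi => by rw [co_baseChange, hK i hi, map_zero]), map_sum]
  refine Finset.sum_congr rfl fun j _ => ?_
  rw [lamCoeff_resTerm_left, mul_comm, mul_comm _ (B.co j), ← lamCoeff_lift_mul]
  rfl

end

variable {R : Type u} [CommRing R] [Algebra ℚ R]

theorem hs_comm (ε ε' : ℤˣ) (m n : ℕ) (f : Fun R) :
    hs ε m (hs ε' n f) = hs ε' n (hs ε m f) := by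
  induction m using Nat.strong_induction_on generalizing f with
  | _ m ih =>
    cases m with
    | zero => rw [hs_zero, hs_zero]
    | succ m =>
      refine nsmul_left_cancel (n := m) ?_
      rw [succ_smul_hs, ← hs_nsmul, succ_smul_hs, hs_zsmul, hs_sum]
      congr 1
      refine Finset.sum_congr rfl fun p hp => ?_
      rw [ddt_hs, ih p.2 (Nat.lt_succ_of_le (Finset.HasAntidiagonal.antidiagonal.snd_le hp))]

theorem lamCoeff_shift (ε : ℤˣ) (f : Fun R) (n : ℤ) :
    lamCoeff n (shift ε f) = if n < 0 then 0 else hs ε n.natAbs f := by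
  rw [shift_eq, seriesHom_apply, lamCoeff_swap, ofPowerSeries_coeff, coeff_shiftHom]

theorem applyExp_lift (ε : ℤˣ) (P : PDO R) : applyExp ε (PDO.lift P)
    = MvPowerSeries.map (laurentMap (HahnSeries.C : R →+* LaurentSeries R)) (applyExp ε P) := by
  rw [applyExp_eq, applyExp_eq, map_mul]
  congr 1
  · refine MvPowerSeries.ext fun α => HahnSeries.ext (funext fun k => ?_)
    rw [coeff_swap, coeff_twist, MvPowerSeries.coeff_map]
    change _ = (HahnSeries.C : R →+* LaurentSeries R) ((MvPowerSeries.coeff α (swap (twist ε P))).coeff k)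
    rw [coeff_swap, coeff_twist, map_zsmul, map_zsmul, map_zsmul, ← MvPowerSeries.coeff_map]
    rfl
  · refine MvPowerSeries.ext fun α => HahnSeries.ext (funext fun k => ?_)
    rw [coeff_expXi, MvPowerSeries.coeff_map, coeff_expXi]
    change _ = (HahnSeries.C : R →+* LaurentSeries R) ((HahnSeries.single _ _).coeff k)
    rw [HahnSeries.coeff_single, HahnSeries.coeff_single]
    split_ifs
    · exact (RingHom.map_rat_algebraMap _ _).symm
    · exact (map_zero _).symm

theorem wave_lift (ε : ℤˣ) {W : PDO R} (hW : IsDressing W) : wave ε (PDO.lift W)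
    = MvPowerSeries.map (laurentMap (HahnSeries.C : R →+* LaurentSeries R)) (wave ε W) := by
  rw [wave, PDO.lift, dress_baseChange _ hW, ← PDO.lift, applyExp_lift, ← wave]

theorem lamCoeff_map_laurentMap {R : Type u} [CommRing R] (n : ℤ) (f : Fun (LaurentSeries R)) :
    lamCoeff n (MvPowerSeries.map (laurentMap (HahnSeries.C : R →+* LaurentSeries R)) f)
      = lift (lamCoeff n f) := rfl

theorem lamCoeff_wave_lift (n : ℤ) (ε : ℤˣ) {W : PDO R} (hW : IsDressing W) :
    lamCoeff n (wave ε (PDO.lift W)) = lift (lamCoeff n (wave ε W)) := by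
  rw [wave_lift ε hW, lamCoeff_map_laurentMap]

/-- The quotient of a two-parameter shift of `τ` by `τ`. -/
def shiftRatio (ε : ℤˣ) (τ : (Fun R)ˣ) : Fun (LaurentSeries (LaurentSeries R)) :=
  lamInv * expXi (LaurentSeries R) (-ε) * shift ε (expXi R ε * shift (-ε) (τ : Fun R))
    * lift (lift ((τ⁻¹ : (Fun R)ˣ) : Fun R))

theorem vertexRatio_eq (τ : (Fun R)ˣ) : vertexRatio τ = shiftRatio 1 τ := by
  rw [vertexRatio, vertex, shiftRatio, shift_mul]
  ring

theorem potential_eq_shiftRatio {W : PDO R} {τ : (Fun R)ˣ} (hW : IsDressing W)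
    (hτ : TauForm W τ) :
    lamInv * ba (PDO.lift W) * shift (-1) (baAdj W) = shiftRatio (-1) τ := by
  have h1 := congrArg (shift (-1)) (hτ.wave hW (-1))
  have h2 := (hτ.lift hW).wave (hW.baseChange _) 1
  rw [wave_neg_one, shift_mul, neg_neg] at h1
  rw [wave_one] at h2
  have h3 : lift (lift (τ : Fun R)) * lift (lift ((τ⁻¹ : (Fun R)ˣ) : Fun R)) = 1 := by
    rw [← map_mul, ← map_mul, Units.mul_inv, map_one, map_one]
  refine (((Units.isUnit τ).map lift).map lift).mul_left_cancel ?_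
  rw [shiftRatio, neg_neg, mul_comm (expXi R (-1))]
  change lift (lift (τ : Fun R)) * ba (PDO.lift W) = shift (-1) (lift (τ : Fun R)) * _ at h2
  linear_combination lamInv * shift (-1) (baAdj W) * h2 + lamInv * expXi (LaurentSeries R) 1 * h1
    - lamInv * expXi (LaurentSeries R) 1 * shift (-1) (shift 1 (τ : Fun R) * expXi R (-1)) * h3

theorem constantCoeff_lamCoeff {R : Type u} [CommRing R] (n : ℤ) (f : Fun (LaurentSeries R)) :
    (MvPowerSeries.constantCoeff f).coeff n = MvPowerSeries.constantCoeff (lamCoeff n f) := rfl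

/-- The double shift of `τ` at the origin, extended by zero. -/
def shiftValue (τ : Fun R) (u v : ℤ) : R :=
  if u < 0 ∨ v < 0 then 0 else MvPowerSeries.constantCoeff (hs 1 u.natAbs (hs (-1) v.natAbs τ))

/-- At t = 0 the exponentials are 1, and only the geometric series ∑ (μ/λ)ⁿ from the shifted
exponential and the double shift of τ remain. The prefactor λ⁻¹ limits n to at most −i − 1. -/
theorem constantCoeff_biCoeff_shiftRatio (ε : ℤˣ) (τ : (Fun R)ˣ) (i j : ℤ) :
    MvPowerSeries.constantCoeff (biCoeff (shiftRatio ε τ) i j)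
      = (∑ n ∈ Finset.range (-i).toNat, if (n : ℤ) < j then 0 else
          MvPowerSeries.constantCoeff (hs ε ((-i).toNat - 1 - n) (hs (-ε) ((n : ℤ) - j).natAbs (τ : Fun R))))
        * MvPowerSeries.constantCoeff ((τ⁻¹ : (Fun R)ˣ) : Fun R) := by
  change ((MvPowerSeries.constantCoeff (shiftRatio ε τ)).coeff (-i)).coeff (-j) = _
  set F := expXi R ε * shift (-ε) (τ : Fun R) with hF
  have h1 : MvPowerSeries.constantCoeff (shiftRatio ε τ)
      = HahnSeries.C (HahnSeries.C (MvPowerSeries.constantCoeff ((τ⁻¹ : (Fun R)ˣ) : Fun R)))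
        * (HahnSeries.single 1 1 * MvPowerSeries.constantCoeff (shift ε F)) := by
    rw [shiftRatio, map_mul, map_mul, map_mul, constantCoeff_expXi, mul_one, mul_comm, lift, lift,
      MvPowerSeries.constantCoeff_map, MvPowerSeries.constantCoeff_map, lamInv,
      MvPowerSeries.constantCoeff_C]
  rw [h1, HahnSeries.C_mul_eq_smul, HahnSeries.coeff_smul, smul_eq_mul, HahnSeries.C_mul_eq_smul,
    HahnSeries.coeff_smul, smul_eq_mul, mul_comm, HahnSeries.coeff_single_mul, one_mul,
    constantCoeff_lamCoeff, lamCoeff_shift]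
  congr 1
  split_ifs with h
  · rw [show (-i).toNat = 0 by omega]
    simp
  · obtain ⟨N, hN⟩ : ∃ N : ℕ, -i = N + 1 := ⟨(-i - 1).toNat, by omega⟩
    rw [show (-i).toNat = N + 1 by omega, show (-i - 1).natAbs = N by omega, hF, hs_mul,
      Finset.Nat.sum_antidiagonal_eq_sum_range_succ_mk, map_sum, coeff_sum_laurent]
    refine Finset.sum_congr rfl fun n _ => ?_
    rw [hs_expXi, map_mul, map_mul, constantCoeff_expXi, mul_one, lam, MvPowerSeries.constantCoeff_C,
      HahnSeries.coeff_single_mul, one_mul, constantCoeff_lamCoeff, lamCoeff_hs, lamCoeff_shift,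
      show -j - -(n : ℤ) = n - j by ring, Nat.add_sub_cancel]
    split_ifs with h2 h3 h3
    · rw [hs_zero_right, map_zero]
    · omega
    · omega
    · rfl

/-- The full sum over u + v = M is a coefficient of the composition of two inverse shifts; the
interval is long enough to contain all nonzero terms. -/
theorem sum_shiftValue (τ : Fun R) (M K : ℤ) (hK : M ≤ K) :
    ∑ u ∈ Finset.Icc (-K) K, shiftValue τ u (M - u)
      = if M = 0 then MvPowerSeries.constantCoeff τ else 0 := by
  by_cases hM : M < 0
  · rw [if_neg hM.ne, Finset.sum_eq_zero]
    intro u _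
    rw [shiftValue, if_pos (by omega)]
  · obtain ⟨m, rfl⟩ := Int.eq_ofNat_of_zero_le (not_lt.mp hM)
    have h := congrArg MvPowerSeries.constantCoeff (sum_hs_hs_neg 1 m τ)
    rw [map_sum, Finset.Nat.sum_antidiagonal_eq_sum_range_succ_mk] at h
    have h2 : (if (m : ℤ) = 0 then MvPowerSeries.constantCoeff τ else 0)
        = MvPowerSeries.constantCoeff (if m = 0 then τ else 0) := by
      split_ifs <;> first | rfl | omega
    rw [h2, ← h]
    symm
    refine Finset.sum_of_injOn (fun n : ℕ => (n : ℤ)) (fun a _ b _ hab => Int.ofNat_inj.mp hab) ?_ ?_ ?_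
    · intro n hn
      simp only [Finset.coe_range, Set.mem_Iio, Finset.coe_Icc, Set.mem_Icc] at hn ⊢
      omega
    · intro u _ hu
      rw [shiftValue, if_pos]
      by_contra! hc
      refine hu ⟨u.toNat, ?_, Int.toNat_of_nonneg hc.1⟩
      simp only [Finset.coe_range, Set.mem_Iio]
      omega
    · intro n hn
      rw [Finset.mem_range] at hn
      rw [shiftValue, if_neg (by omega), Int.natAbs_natCast, show ((m : ℤ) - n).natAbs = m - n by omega]

/-- Both expansions sum the same double-shift values with u + v = M = −i − 1 − j, one over u ≥ −j
and the other over u < −j. Together they give the full sum, which is τ(0) for M = 0 and zero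
otherwise; division by τ(0) leaves the coefficient of δ. -/
theorem constantCoeff_shiftRatio_add (τ : (Fun R)ˣ) (i j : ℤ) :
    MvPowerSeries.constantCoeff (biCoeff (shiftRatio (-1) τ) i j)
      + MvPowerSeries.constantCoeff (biCoeff (shiftRatio 1 τ) j i) = if j + i = -1 then 1 else 0 := by
  rw [constantCoeff_biCoeff_shiftRatio, constantCoeff_biCoeff_shiftRatio, ← add_mul]
  set M := -i - 1 - j with hM
  set K : ℤ := i.natAbs + j.natAbs + 1 with hK
  have h1 : (∑ n ∈ Finset.range (-i).toNat, if (n : ℤ) < j then 0 else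
      MvPowerSeries.constantCoeff (hs (-1) ((-i).toNat - 1 - n)
        (hs (- -1) ((n : ℤ) - j).natAbs (τ : Fun R))))
      = ∑ u ∈ Finset.Icc (-K) K with ¬ u < -j, shiftValue (τ : Fun R) u (M - u) := by
    refine Finset.sum_of_injOn (fun n : ℕ => (n : ℤ) - j) (fun a _ b _ hab => by
      have : (a : ℤ) - j = b - j := hab
      omega) ?_ ?_ ?_
    · intro n hn
      simp only [Finset.coe_range, Set.mem_Iio, Finset.coe_filter, Finset.mem_Icc, Set.mem_ofPred_eq] at hn ⊢
      omega
    · intro u hu hu'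
      rw [Finset.mem_filter] at hu
      rw [shiftValue, if_pos]
      by_contra! hc
      refine hu' ⟨(u + j).toNat, ?_, ?_⟩
      · simp only [Finset.coe_range, Set.mem_Iio]
        omega
      · change ((u + j).toNat : ℤ) - j = u
        omega
    · intro n hn
      rw [Finset.mem_range] at hn
      rw [shiftValue]
      split_ifs with h2 h3 h3
      · rfl
      · omega
      · omega
      · rw [hs_comm, neg_neg, show (M - ((n : ℤ) - j)).natAbs = (-i).toNat - 1 - n by omega]
  have h2 : (∑ n ∈ Finset.range (-j).toNat, if (n : ℤ) < i then 0 else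
      MvPowerSeries.constantCoeff (hs 1 ((-j).toNat - 1 - n)
        (hs (-1) ((n : ℤ) - i).natAbs (τ : Fun R))))
      = ∑ u ∈ Finset.Icc (-K) K with u < -j, shiftValue (τ : Fun R) u (M - u) := by
    refine Finset.sum_of_injOn (fun n : ℕ => -j - 1 - (n : ℤ)) (fun a _ b _ hab => by
      have : -j - 1 - (a : ℤ) = -j - 1 - b := hab
      omega) ?_ ?_ ?_
    · intro n hn
      simp only [Finset.coe_range, Set.mem_Iio, Finset.coe_filter, Finset.mem_Icc, Set.mem_ofPred_eq] at hn ⊢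
      omega
    · intro u hu hu'
      rw [Finset.mem_filter] at hu
      rw [shiftValue, if_pos]
      by_contra! hc
      refine hu' ⟨(-j - 1 - u).toNat, ?_, ?_⟩
      · simp only [Finset.coe_range, Set.mem_Iio]
        omega
      · change -j - 1 - ((-j - 1 - u).toNat : ℤ) = u
        omega
    · intro n hn
      rw [Finset.mem_range] at hn
      rw [shiftValue]
      split_ifs with h2 h3 h3
      · rfl
      · omega
      · omega
      · rw [show (M - (-j - 1 - (n : ℤ))).natAbs = ((n : ℤ) - i).natAbs by omega,
          show (-j - 1 - (n : ℤ)).natAbs = (-j).toNat - 1 - n by omega]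
  rw [h1, h2, add_comm (∑ u ∈ _ with ¬ _, _), Finset.sum_filter_add_sum_filter_not,
    sum_shiftValue _ _ _ (by omega)]
  split_ifs with h3 h4 h4
  · rw [← map_mul, Units.mul_inv, map_one]
  · omega
  · omega
  · rw [zero_mul]

/-- Extraction of the coefficients in λ and μ commutes with the residue. The coefficients of the two
potentials are therefore potentials of the same pair of coefficients of ψ and ψ⋆, and their
difference is a constant, found at t = 0. -/
theorem biCoeff_potential {W : PDO R} {τ : (Fun R)ˣ} (hKP : WilsonSato W) (hW : IsDressing W)
    (hτ : TauForm W τ) (i j : ℤ) :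
    biCoeff (lamInv * ba (PDO.lift W) * shift (-1) (baAdj W)) i j
      = -biCoeff (vertexRatio τ) j i + deltaCoeff R j i := by
  set A := lamInv * ba (PDO.lift W) * shift (-1) (baAdj W) with hA
  set G := -(lamInv * baAdj (PDO.lift W) * shift 1 (ba W)) with hG
  have hKP' : WilsonSato (PDO.lift W) := hKP.baseChange _ hW
  have hW' : IsDressing (PDO.lift W) := hW.baseChange _
  have hSA := isSEP_ba hKP' hW' (hτ.lift hW) (isSolution_baAdj hKP hW)
  have hSG := isSEP_baAdj hKP' hW' (hτ.lift hW) (isSolution_ba hKP hW)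
  have hGv : G = -vertexRatio τ := by
    rw [hG, ← potential_eq_vertexRatio hW hτ, mul_right_comm]
  have hbi : ∀ (X : Fun (LaurentSeries (LaurentSeries R))) (a b : ℤ),
      biCoeff X a b = lamCoeff (-b) (lamCoeff (-a) X) := fun _ _ _ => rfl
  have hd : ∀ n, ddt n (biCoeff A i j - biCoeff G j i) = 0 := fun n => by
    have hB : IsDiff (plus (laxPow W n)) := isDiff_plus _
    have hB' : IsDiff (PDO.lift (plus (laxPow W n))) := hB.baseChange _
    rw [hbi, hbi, ddt_sub, ← lamCoeff_ddt, ← lamCoeff_ddt, ← lamCoeff_ddt, ← lamCoeff_ddt,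
      isSEP_iff.mp hSA n, isSEP_iff.mp hSG n, plus_laxPow_lift hW', plus_laxPow_lift hW,
      lamCoeff_sepRes_left hB', lamCoeff_sepRes_right hB', ← wave_neg_one,
      ← wave_neg_one, ← wave_one, ← wave_one, lamCoeff_wave_lift _ _ hW, lamCoeff_wave_lift _ _ hW,
      lamCoeff_sepRes_left hB, lamCoeff_sepRes_right hB, sub_self]
  have hG2 : biCoeff G j i = -biCoeff (vertexRatio τ) j i := by
    rw [hbi, hGv, map_neg, map_neg, hbi]
  have h0 := eq_C_of_ddt_eq_zero hd
  rw [hG2, sub_neg_eq_add, hA, potential_eq_shiftRatio hW hτ, vertexRatio_eq, map_add,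
    constantCoeff_shiftRatio_add] at h0
  rw [hA, potential_eq_shiftRatio hW hτ, vertexRatio_eq, deltaCoeff, neg_add_eq_sub, eq_sub_iff_add_eq, h0]
  split_ifs
  · exact map_one _
  · exact map_zero _

end Expansions

/-! ### Spectral densities -/

section Parameters

variable {A : Type u} [CommRing A] {σ : Type}

/-- The coefficient of a monomial in the parameters. -/
def paramCoeff (β : σ →₀ ℕ) : Fun (MvPowerSeries σ A) →+ Fun A where
  toFun f := fun α => MvPowerSeries.coeff β (MvPowerSeries.coeff α f)
  map_zero' := rfl
  map_add' _ _ := rfl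

theorem coeff_paramCoeff (β : σ →₀ ℕ) (f : Fun (MvPowerSeries σ A)) (α : ℕ+ →₀ ℕ) :
    MvPowerSeries.coeff α (paramCoeff β f) = MvPowerSeries.coeff β (MvPowerSeries.coeff α f) := rfl

theorem ext_paramCoeff {f g : Fun (MvPowerSeries σ A)} (h : ∀ β, paramCoeff β f = paramCoeff β g) :
    f = g :=
  MvPowerSeries.ext fun α => MvPowerSeries.ext fun β => by
    rw [← coeff_paramCoeff, h, coeff_paramCoeff]

theorem paramCoeff_ddt (β : σ →₀ ℕ) (n : ℕ+) (f : Fun (MvPowerSeries σ A)) :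
    paramCoeff β (ddt n f) = ddt n (paramCoeff β f) := by
  refine MvPowerSeries.ext fun α => ?_
  rw [coeff_paramCoeff, coeff_ddt, coeff_ddt, coeff_paramCoeff]
  have : ((α n : MvPowerSeries σ A) + 1) = MvPowerSeries.C ((α n : A) + 1) := by
    rw [map_add, map_one, map_natCast]
  rw [this, MvPowerSeries.coeff_mul_C]

theorem paramCoeff_withParams [DecidableEq σ] (β : σ →₀ ℕ) (f : Fun A) :
    paramCoeff β (withParams σ f) = if β = 0 then f else 0 := by
  refine MvPowerSeries.ext fun α => ?_
  rw [coeff_paramCoeff, withParams, MvPowerSeries.coeff_map, MvPowerSeries.coeff_C]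
  split_ifs <;> simp

theorem paramCoeff_C_mul_withParams (β : σ →₀ ℕ) (X : MvPowerSeries σ A) (f : Fun A) :
    paramCoeff β (MvPowerSeries.C X * withParams σ f)
      = MvPowerSeries.C (MvPowerSeries.coeff β X) * f := by
  refine MvPowerSeries.ext fun α => ?_
  rw [coeff_paramCoeff, MvPowerSeries.coeff_C_mul, MvPowerSeries.coeff_C_mul, withParams,
    MvPowerSeries.coeff_map, MvPowerSeries.coeff_mul_C]

theorem paramCoeff_spectralInt (β : σ →₀ ℕ) (f : Fun (MvPowerSeries σ (LaurentSeries A))) :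
    paramCoeff β (spectralInt f) = lamCoeff 1 (paramCoeff β f) := rfl

theorem hasDensity_iff [DecidableEq σ] {χ : Fun (LaurentSeries A)} {Φ : Fun A}
    {φ : MvPowerSeries σ (LaurentSeries A)} : HasDensity χ Φ φ ↔ ∀ β,
      lamCoeff 1 (MvPowerSeries.C (MvPowerSeries.coeff β φ) * χ) = if β = 0 then Φ else 0 := by
  constructor
  · intro h β
    rw [← paramCoeff_withParams, h, paramCoeff_spectralInt, paramCoeff_C_mul_withParams]
  · intro h
    refine ext_paramCoeff fun β => ?_
    rw [paramCoeff_withParams, paramCoeff_spectralInt, paramCoeff_C_mul_withParams, h]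

/-- Used to give the densities of Φ and Ψ disjoint sets of parameters t′ and t″; monomials outside
the image have coefficient zero, consistent with Φ being free of the parameters. -/
theorem HasDensity.rename {σ' : Type} {χ : Fun (LaurentSeries A)} {Φ : Fun A}
    {φ : MvPowerSeries σ (LaurentSeries A)} (h : HasDensity χ Φ φ) (e : σ ↪ σ') :
    HasDensity χ Φ (MvPowerSeries.rename e φ) := by
  classical
  rw [hasDensity_iff] at h ⊢
  intro β
  by_cases hβ : β ∈ Set.range (Finsupp.mapDomain e)
  · obtain ⟨β', rfl⟩ := hβ
    have h0 : Finsupp.mapDomain e β' = 0 ↔ β' = 0 := by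
      rw [← Finsupp.embDomain_eq_mapDomain, Finsupp.embDomain_eq_zero]
    rw [← Finsupp.embDomain_eq_mapDomain, MvPowerSeries.coeff_embDomain_rename, h,
      Finsupp.embDomain_eq_mapDomain]
    simp only [h0]
  · rw [MvPowerSeries.coeff_rename_eq_zero _ _ hβ, map_zero, zero_mul, map_zero, if_neg]
    rintro rfl
    exact hβ ⟨0, Finsupp.mapDomain_zero⟩

end Parameters

/-! ### Spectral integrals of the potentials -/

section DoubleIntegral

variable {R : Type u} [CommRing R]

theorem dx_C_mul (k : ℕ) (r : R) (f : Fun R) :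
    dx k (MvPowerSeries.C r * f) = MvPowerSeries.C r * dx k f := by
  induction k with
  | zero => rfl
  | succ k ih => rw [dx_succ', dx_succ', ih, ddt_C_mul]

theorem resTerm_C_mul (j : ℕ) (r : R) (f g : Fun R) :
    resTerm j (MvPowerSeries.C r * f) g = MvPowerSeries.C r * resTerm j f g := by
  induction j generalizing f with
  | zero => exact (mul_zero _).symm
  | succ j ih => rw [resTerm, resTerm, ddt_C_mul, ih, mul_sub, mul_assoc]

theorem resTerm_C_mul_right (j : ℕ) (r : R) (f g : Fun R) :
    resTerm j f (MvPowerSeries.C r * g) = MvPowerSeries.C r * resTerm j f g := by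
  induction j generalizing f with
  | zero => exact (mul_zero _).symm
  | succ j ih => rw [resTerm, resTerm, ih, dx_C_mul, mul_sub, mul_left_comm]

theorem sepRes_C_mul_left {B : PDO R} (hB : IsDiff B) (r : R) (f g : Fun R) :
    sepRes B (MvPowerSeries.C r * f) g = MvPowerSeries.C r * sepRes B f g := by
  obtain ⟨K, hK⟩ := exists_nat_bound B
  rw [sepRes_eq_sum hB hK, sepRes_eq_sum hB hK, Finset.mul_sum]
  exact Finset.sum_congr rfl fun j _ => resTerm_C_mul_right _ _ _ _

theorem sepRes_C_mul_right {B : PDO R} (hB : IsDiff B) (r : R) (f g : Fun R) :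
    sepRes B f (MvPowerSeries.C r * g) = MvPowerSeries.C r * sepRes B f g := by
  obtain ⟨K, hK⟩ := exists_nat_bound B
  rw [sepRes_eq_sum hB hK, sepRes_eq_sum hB hK, Finset.mul_sum]
  refine Finset.sum_congr rfl fun j _ => ?_
  rw [mul_assoc, resTerm_C_mul]

theorem sepRes_zero_left {B : PDO R} (hB : IsDiff B) (g : Fun R) : sepRes B 0 g = 0 := by
  have h := sepRes_C_mul_left hB 0 0 g
  rwa [map_zero, zero_mul, zero_mul] at h

theorem sepRes_zero_right {B : PDO R} (hB : IsDiff B) (f : Fun R) : sepRes B f 0 = 0 := by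
  have h := sepRes_C_mul_right hB 0 f 0
  rwa [map_zero, zero_mul, zero_mul] at h

variable [Algebra ℚ R]

/-- Spectral integration of the residues of the wave functions. -/
theorem lamCoeff_sepRes_wave {W B : PDO R} (hW : IsDressing W) (hB : IsDiff B)
    (a b : LaurentSeries R) :
    lamCoeff 1 (lamCoeff 1 (MvPowerSeries.C (laurentMap HahnSeries.C a * HahnSeries.C b)
        * sepRes (PDO.lift (PDO.lift B)) (lift (ba W)) (baAdj (PDO.lift W))))
      = sepRes B (lamCoeff 1 (MvPowerSeries.C b * ba W))
        (lamCoeff 1 (MvPowerSeries.C a * baAdj W)) := by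
  have hB' : IsDiff (PDO.lift B) := hB.baseChange _
  have hB'' : IsDiff (PDO.lift (PDO.lift B)) := hB'.baseChange _
  have hb : (MvPowerSeries.C (HahnSeries.C b) : Fun (LaurentSeries (LaurentSeries R)))
      = lift (MvPowerSeries.C b) := (MvPowerSeries.map_C _ _).symm
  rw [map_mul MvPowerSeries.C, mul_comm (MvPowerSeries.C (laurentMap _ _)), hb, mul_assoc, lamCoeff_lift_mul,
    ← sepRes_C_mul_right hB'', lamCoeff_sepRes_right hB', ← wave_neg_one, wave_lift _ hW,
    ← MvPowerSeries.map_C, ← map_mul, lamCoeff_map_laurentMap, ← sepRes_C_mul_left hB',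
    lamCoeff_sepRes_left hB, wave_neg_one]

variable {σ : Type}

theorem paramCoeff_doubleInt (W : PDO R) (φs φ : MvPowerSeries σ (LaurentSeries R)) (β : σ →₀ ℕ) :
    paramCoeff β (doubleInt W φs φ) = lamCoeff 1 (lamCoeff 1
      (MvPowerSeries.C (MvPowerSeries.coeff β (outer φs * inner φ))
        * (lamInv * baAdj (PDO.lift W) * shift 1 (ba W)))) := by
  rw [doubleInt, paramCoeff_spectralInt, paramCoeff_spectralInt, paramCoeff_C_mul_withParams]

/-- Under the integral, ∂ₙ turns the kernel into the residue of ψ(t, μ) and ψ⋆(t, λ). Being linear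
in each argument over the constants, the residue lets both integrals pass inside, where they produce
Φ and Ψ. -/
theorem isSEP_doubleInt {W : PDO R} {τ : (Fun R)ˣ} (hKP : WilsonSato W) (hW : IsDressing W)
    (hτ : TauForm W τ) {Φ Ψ : Fun R} {φ φs : MvPowerSeries σ (LaurentSeries R)}
    (hΦ : HasDensity (ba W) Φ φ) (hΨ : HasDensity (baAdj W) Ψ φs) :
    IsSEP (PDO.baseChange (MvPowerSeries.C : R →+* MvPowerSeries σ R) W) (withParams σ Φ)
      (withParams σ Ψ) (-doubleInt W φs φ) := by
  classical
  rw [hasDensity_iff] at hΦ hΨ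
  have hKP' : WilsonSato (PDO.lift W) := hKP.baseChange _ hW
  have hW' : IsDressing (PDO.lift W) := hW.baseChange _
  have hS := isSEP_iff.mp (isSEP_baAdj hKP' hW' (hτ.lift hW) (isSolution_ba hKP hW))
  refine isSEP_iff.mpr fun n => ext_paramCoeff fun β => ?_
  have hB : IsDiff (plus (laxPow W n)) := isDiff_plus _
  have hSn := hS n
  rw [plus_laxPow_lift hW', plus_laxPow_lift hW, ddt_neg] at hSn
  rw [laxPow_baseChange _ hW, ← baseChange_plus, withParams, withParams, sepRes_map _ hB,
    ← withParams, paramCoeff_withParams, paramCoeff_ddt, map_neg, paramCoeff_doubleInt, ddt_neg,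
    ← lamCoeff_ddt, ← lamCoeff_ddt, ddt_C_mul, neg_eq_iff_eq_neg.mp hSn, mul_neg, map_neg, map_neg,
    neg_neg, MvPowerSeries.coeff_mul, map_sum, Finset.sum_mul, map_sum, map_sum]
  -- Only the parameter-free coefficients of the two densities reproduce Φ and Ψ; the others
  -- integrate to zero, so every mixed term of the convolution vanishes.
  have hterm : ∀ p ∈ antidiagonal β, lamCoeff 1 (lamCoeff 1
      (MvPowerSeries.C (MvPowerSeries.coeff p.1 (outer φs) * MvPowerSeries.coeff p.2 (inner φ))
        * sepRes (PDO.lift (PDO.lift (plus (laxPow W n)))) (lift (ba W)) (baAdj (PDO.lift W))))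
      = if p = (0, 0) then sepRes (plus (laxPow W n)) Φ Ψ else 0 := fun p _ => by
    have h1 : MvPowerSeries.coeff p.2 (inner φ) = HahnSeries.C (MvPowerSeries.coeff p.2 φ) :=
      MvPowerSeries.coeff_map _ _ _
    have h2 : MvPowerSeries.coeff p.1 (outer φs)
        = laurentMap HahnSeries.C (MvPowerSeries.coeff p.1 φs) := rfl
    rw [h1, h2, lamCoeff_sepRes_wave hW hB, hΦ, hΨ]
    by_cases h3 : p.2 = 0
    · by_cases h4 : p.1 = 0
      · rw [if_pos h3, if_pos h4, if_pos (Prod.ext h4 h3)]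
      · rw [if_neg h4, if_neg fun h => h4 (congrArg Prod.fst h), sepRes_zero_right hB]
    · rw [if_neg h3, if_neg fun h => h3 (congrArg Prod.snd h), sepRes_zero_left hB]
  rw [Finset.sum_congr rfl hterm, Finset.sum_ite_eq' (antidiagonal β) (0, 0)]
  refine if_congr ?_ rfl rfl
  rw [mem_antidiagonal, add_zero]
  exact eq_comm

theorem sepEqParams_doubleInt {W : PDO R} {τ : (Fun R)ˣ} (hKP : WilsonSato W) (hW : IsDressing W)
    (hτ : TauForm W τ) {Φ Ψ : Fun R} {φ φs : MvPowerSeries σ (LaurentSeries R)}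
    (hΦ : HasDensity (ba W) Φ φ) (hΨ : HasDensity (baAdj W) Ψ φs) :
    SEPEqParams σ W Φ Ψ (-doubleInt W φs φ) :=
  (isSEP_doubleInt hKP hW hτ hΦ hΨ).sepEq

end DoubleIntegral

/-! ### The densities obtained from the shifted eigenfunctions -/

section ShiftDensity

variable {R : Type u} [CommRing R]

/-- All coefficients of `g` in `t'` and of `χ` in `t` are orthogonal for the residue pairing. -/
def Orthogonal (χ g : Fun (LaurentSeries R)) : Prop := ∀ β α : ℕ+ →₀ ℕ,
  (MvPowerSeries.coeff β g * MvPowerSeries.coeff α χ).coeff 1 = 0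

variable {χ f g : Fun (LaurentSeries R)}

theorem Orthogonal.sub (hf : Orthogonal χ f) (hg : Orthogonal χ g) : Orthogonal χ (f - g) :=
  fun β α => by rw [map_sub, sub_mul, HahnSeries.coeff_sub, hf, hg, sub_zero]

theorem orthogonal_zero (χ : Fun (LaurentSeries R)) : Orthogonal χ 0 := fun β α => by
  rw [map_zero, zero_mul, HahnSeries.coeff_zero]

theorem Orthogonal.neg (hf : Orthogonal χ f) : Orthogonal χ (-f) := by
  rw [← zero_sub]; exact (orthogonal_zero χ).sub hf

theorem Orthogonal.sum {ι : Type*} {s : Finset ι} {F : ι → Fun (LaurentSeries R)}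
    (h : ∀ i ∈ s, Orthogonal χ (F i)) : Orthogonal χ (∑ i ∈ s, F i) :=
  Finset.sum_induction F _ (fun a b ha hb => by rw [← sub_neg_eq_add]; exact ha.sub hb.neg)
    (orthogonal_zero χ) h

theorem Orthogonal.ddt (hf : Orthogonal χ f) (n : ℕ+) : Orthogonal χ (ddt n f) := fun β α => by
  rw [coeff_ddt, mul_right_comm, ← Nat.cast_succ, mul_comm _ ((_ : ℕ) : LaurentSeries R),
    ← nsmul_eq_mul, HahnSeries.coeff_smul, hf, smul_zero]

theorem Orthogonal.dx (hf : Orthogonal χ f) (k : ℕ) : Orthogonal χ (dx k f) := by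
  induction k with
  | zero => exact hf
  | succ k ih => rw [dx_succ']; exact ih.ddt 1

theorem Orthogonal.lift_mul (hf : Orthogonal χ f) (a : Fun R) : Orthogonal χ (lift a * f) := by
  classical
  intro β α
  rw [MvPowerSeries.coeff_mul, Finset.sum_mul, coeff_sum_laurent]
  refine Finset.sum_eq_zero fun p _ => ?_
  rw [lift, MvPowerSeries.coeff_map, mul_assoc, HahnSeries.C_mul_eq_smul, HahnSeries.coeff_smul, hf,
    smul_zero]

theorem Orthogonal.resTerm_lift (hf : Orthogonal χ f) (j : ℕ) (a : Fun R) :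
    Orthogonal χ (resTerm j f (lift a)) := by
  induction j generalizing f with
  | zero => exact orthogonal_zero χ
  | succ j ih =>
    rw [resTerm, dx_lift, mul_comm]
    exact (hf.lift_mul _).sub (ih (hf.ddt 1))

theorem Orthogonal.resTerm_lift_left (hf : Orthogonal χ f) (j : ℕ) (a : Fun R) :
    Orthogonal χ (resTerm j (lift a) f) := by
  induction j generalizing a with
  | zero => exact orthogonal_zero χ
  | succ j ih =>
    rw [resTerm, ddt_lift]
    exact ((hf.dx j).lift_mul _).sub (ih _)

theorem Orthogonal.sepRes_left {B : PDO R} (hB : IsDiff B) (hf : Orthogonal χ f) (a : Fun R) :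
    Orthogonal χ (sepRes (PDO.lift B) f (lift a)) := by
  obtain ⟨K, hK⟩ := exists_nat_bound B
  rw [PDO.lift, sepRes_eq_sum (hB.baseChange _) (K := K)
    (fun i hi => by rw [co_baseChange, hK i hi, map_zero])]
  refine Orthogonal.sum fun j _ => ?_
  rw [co_baseChange, lift, ← map_mul]
  exact hf.resTerm_lift_left _ _

theorem Orthogonal.sepRes_right {B : PDO R} (hB : IsDiff B) (hf : Orthogonal χ f) (a : Fun R) :
    Orthogonal χ (sepRes (PDO.lift B) (lift a) f) := by
  obtain ⟨K, hK⟩ := exists_nat_bound B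
  rw [PDO.lift, sepRes_eq_sum (hB.baseChange _) (K := K)
    (fun i hi => by rw [co_baseChange, hK i hi, map_zero])]
  refine Orthogonal.sum fun j _ => ?_
  rw [co_baseChange, mul_comm]
  exact (hf.lift_mul _).resTerm_lift _ _

variable [Algebra ℚ R]

/-- Each coefficient of f of positive degree in t′ is, up to a nonzero integer, a coefficient of
some ∂ₙf, hence orthogonal to χ. The integral of f(t′) χ(t) is therefore independent of t′ and can
be computed at t′ = t. -/
theorem hasDensity_of_orthogonal {Φ : Fun R} (h : ∀ n, Orthogonal χ (ddt n f))
    (h0 : lamCoeff 1 (f * χ) = Φ) : HasDensity χ Φ f := by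
  classical
  have := IsAddTorsionFree.of_module_rat R
  have h1 : ∀ β ≠ 0, ∀ α, (MvPowerSeries.coeff β f * MvPowerSeries.coeff α χ).coeff 1 = 0 := by
    intro β hβ α
    obtain ⟨n, hn⟩ : ∃ n, β n ≠ 0 := by
      by_contra! h
      exact hβ (Finsupp.ext h)
    obtain ⟨β', rfl⟩ : ∃ β', β = β' + Finsupp.single n 1 :=
      ⟨β - Finsupp.single n 1, (tsub_add_cancel_of_le (by rw [Finsupp.single_le_iff]; omega)).symm⟩
    have h2 := h n β' α
    rw [coeff_ddt, mul_right_comm, ← Nat.cast_succ, mul_comm _ ((_ : ℕ) : LaurentSeries R),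
      ← nsmul_eq_mul, HahnSeries.coeff_smul] at h2
    exact (smul_eq_zero.mp h2).resolve_left (by omega)
  refine hasDensity_iff.mpr fun β => MvPowerSeries.ext fun α => ?_
  rw [coeff_lamCoeff, MvPowerSeries.coeff_C_mul]
  split_ifs with hβ
  · subst hβ
    rw [← h0, coeff_lamCoeff, MvPowerSeries.coeff_mul, coeff_sum_laurent,
      Finset.sum_eq_single_of_mem (0, α) (by simp)]
    rintro ⟨a, b⟩ hab hne
    rw [mem_antidiagonal] at hab
    refine h1 a (fun ha => hne ?_) b
    simp only at hab
    rw [ha, zero_add] at hab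
    rw [ha, hab]
  · rw [map_zero]
    exact h1 β hβ α

/-- At equal times the exponentials cancel and λ⁻¹(f + O(λ⁻¹)) remains, all leading coefficients
being 1. -/
theorem lamCoeff_wave_mul_wave {W : PDO R} (hW : IsDressing W) (ε ε' : ℤˣ) (f : Fun R) :
    lamCoeff 1 (lamInv * wave ε W * shift ε' f * wave (-ε) W) = f := by
  have h : lamInv * wave ε W * shift ε' f * wave (-ε) W
      = lam R (-1) * seriesHom R (waveSeries ε W * shiftHom R ε' f * waveSeries (-ε) W) := by
    rw [wave_eq ε hW, wave_eq (-ε) hW, shift_eq, map_mul, map_mul, lamInv_eq]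
    linear_combination lam R (-1) * seriesHom R (waveSeries ε W) * seriesHom R (shiftHom R ε' f)
      * seriesHom R (waveSeries (-ε) W) * expXi_mul_expXi_neg (R := R) ε
  rw [h, lamCoeff_lam_mul, show (1 : ℤ) + -1 = ((0 : ℕ) : ℤ) by norm_num, lamCoeff_seriesHom,
    coeff_zero_mul, coeff_zero_mul, coeff_zero_waveSeries ε hW, coeff_zero_waveSeries (-ε) hW,
    coeff_shiftHom, hs_zero, one_mul, mul_one]

variable {W : PDO R} {τ : (Fun R)ˣ}

/-- The density is minus the potential of Φ and ψ⋆, so its derivatives are residues formed from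
ψ⋆(t′, μ) with coefficients free of μ. The bilinear identity makes these orthogonal to ψ(t, μ). -/
theorem hasDensity_density (hKP : WilsonSato W) (hW : IsDressing W) (hτ : TauForm W τ) {Φ : Fun R}
    (hΦ : IsSolution 1 W Φ) : HasDensity (ba W) Φ (density W Φ) := by
  have horth : Orthogonal (ba W) (baAdj W) := fun β α => by
    rw [mul_comm]; exact (isWaveMultiple_ba W).residue_coeff hKP hW α β
  have h1 := lamCoeff_wave_mul_wave hW (-1) 1 Φ
  rw [neg_neg, wave_one, wave_neg_one] at h1
  refine hasDensity_of_orthogonal (fun n => ?_) h1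
  have h2 := isSEP_iff.mp (isSEP_baAdj hKP hW hτ hΦ) n
  rw [ddt_neg, neg_eq_iff_eq_neg, plus_laxPow_lift hW] at h2
  rw [density, h2]
  exact (horth.sepRes_right (isDiff_plus _) Φ).neg

theorem hasDensity_densityAdj (hKP : WilsonSato W) (hW : IsDressing W) (hτ : TauForm W τ)
    {Ψ : Fun R} (hΨ : IsSolution (-1) W Ψ) : HasDensity (baAdj W) Ψ (densityAdj W Ψ) := by
  have horth : Orthogonal (baAdj W) (ba W) := (isWaveMultiple_ba W).residue_coeff hKP hW
  have h1 := lamCoeff_wave_mul_wave hW 1 (-1) Ψ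
  rw [wave_one, wave_neg_one] at h1
  refine hasDensity_of_orthogonal (fun n => ?_) h1
  have h2 := isSEP_iff.mp (isSEP_ba hKP hW hτ hΨ) n
  rw [plus_laxPow_lift hW] at h2
  rw [densityAdj, h2]
  exact horth.sepRes_left (isDiff_plus _) Ψ

end ShiftDensity

end KP

end

/-! ### Assembly of the five statements -/

theorem mainTheorem2 {R : Type*} [CommRing R] [Algebra ℚ R]
    (W : KP.PDO R) (hW : KP.PDO.IsDressing W) (hKP : KP.WilsonSato W)
    (τ : (KP.Fun R)ˣ) (hτ : KP.IsTau W τ) :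
    -- S(ψ(t,μ), ψ⋆(t,λ)) = -λ⁻¹ ψ(t+[λ⁻¹],μ) ψ⋆(t,λ) = -X(λ,μ)τ(t)/τ(t), for |λ| > |μ|
    (KP.SEPEqOsc (-1) (KP.PDO.lift (KP.PDO.lift W)) (KP.lift (KP.ba W)) (KP.baAdj (KP.PDO.lift W))
        (-(KP.lamInv * KP.shift 1 (KP.ba W) * KP.baAdj (KP.PDO.lift W))) ∧
      -(KP.lamInv * KP.shift 1 (KP.ba W) * KP.baAdj (KP.PDO.lift W)) = -KP.vertexRatio τ) ∧
    -- S(ψ(t,λ), ψ⋆(t,μ)) = λ⁻¹ ψ(t,λ) ψ⋆(t-[λ⁻¹],μ) = -X(μ,λ)τ(t)/τ(t) + δ(μ,λ);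
    -- X(μ,λ) is expanded for |μ| > |λ|, so the second equality is one of bilateral series
    (KP.SEPEqOsc 1 (KP.PDO.lift (KP.PDO.lift W)) (KP.ba (KP.PDO.lift W)) (KP.lift (KP.baAdj W))
        (KP.lamInv * KP.ba (KP.PDO.lift W) * KP.shift (-1) (KP.baAdj W)) ∧
      ∀ i j : ℤ,
        KP.biCoeff (KP.lamInv * KP.ba (KP.PDO.lift W) * KP.shift (-1) (KP.baAdj W)) i j
          = -KP.biCoeff (KP.vertexRatio τ) j i + KP.deltaCoeff R j i) ∧
    -- S(Φ, ψ⋆(t,λ)) = -λ⁻¹ ψ⋆(t,λ) Φ(t+[λ⁻¹])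
    (∀ Φ : KP.Fun R, KP.IsEigenfunction W Φ →
      KP.SEPEqOsc (-1) (KP.PDO.lift W) (KP.lift Φ) (KP.baAdj W)
        (-(KP.lamInv * KP.baAdj W * KP.shift 1 Φ))) ∧
    -- S(ψ(t,λ), Ψ) = λ⁻¹ ψ(t,λ) Ψ(t-[λ⁻¹])
    (∀ Ψ : KP.Fun R, KP.IsAdjointEigenfunction W Ψ →
      KP.SEPEqOsc 1 (KP.PDO.lift W) (KP.ba W) (KP.lift Ψ)
        (KP.lamInv * KP.ba W * KP.shift (-1) Ψ)) ∧
    -- S(Φ, Ψ) = -∫∫ dλ dμ φ⋆(λ) φ(μ) λ⁻¹ ψ⋆(t,λ) ψ(t+[λ⁻¹],μ), for all spectral densities of Φ, Ψ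
    (∀ Φ Ψ : KP.Fun R, KP.IsEigenfunction W Φ → KP.IsAdjointEigenfunction W Ψ →
      (∀ (σ : Type) (φ φs : MvPowerSeries σ (LaurentSeries R)),
        KP.HasDensity (KP.ba W) Φ φ → KP.HasDensity (KP.baAdj W) Ψ φs →
        KP.SEPEqParams σ W Φ Ψ (-KP.doubleInt W φs φ)) ∧
      -- and with φ(μ) = μ⁻¹ ψ⋆(t',μ) Φ(t'+[μ⁻¹]) and φ⋆(λ) = λ⁻¹ ψ(t'',λ) Ψ(t''-[λ⁻¹])
      KP.SEPEqParams (ℕ+ ⊕ ℕ+) W Φ Ψ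
        (-KP.doubleInt W (MvPowerSeries.rename Function.Embedding.inr (KP.densityAdj W Ψ))
          (MvPowerSeries.rename Function.Embedding.inl (KP.density W Φ)))) := by
  have hτ' := hτ.tauForm hKP hW
  have hKP' : KP.WilsonSato (KP.PDO.lift W) := hKP.baseChange _ hW
  have hW' : KP.PDO.IsDressing (KP.PDO.lift W) := hW.baseChange _
  refine ⟨⟨?_, ?_⟩, ⟨?_, KP.biCoeff_potential hKP hW hτ'⟩, fun Φ hΦ => ?_, fun Ψ hΨ => ?_,
    fun Φ Ψ hΦ hΨ => ⟨fun σ φ φs hφ hφs => KP.sepEqParams_doubleInt hKP hW hτ' hφ hφs, ?_⟩⟩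
  · rw [mul_right_comm]
    -- This is (3) over the constants R((μ⁻¹)), with ψ(t, μ) as the eigenfunction; (2) is obtained
    -- from (4) in the same way with ψ⋆(t, μ).
    exact KP.sepEqOsc_baAdj hKP' hW' (hτ'.lift hW) (KP.isSolution_ba hKP hW)
  · rw [KP.potential_eq_vertexRatio hW hτ']
  · exact KP.sepEqOsc_ba hKP' hW' (hτ'.lift hW) (KP.isSolution_baAdj hKP hW)
  · exact KP.sepEqOsc_baAdj hKP hW hτ' (KP.isEigenfunction_iff.mp hΦ)
  · exact KP.sepEqOsc_ba hKP hW hτ' (KP.isAdjointEigenfunction_iff.mp hΨ)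
  · exact KP.sepEqParams_doubleInt hKP hW hτ'
      ((KP.hasDensity_density hKP hW hτ' (KP.isEigenfunction_iff.mp hΦ)).rename _)
      ((KP.hasDensity_densityAdj hKP hW hτ' (KP.isAdjointEigenfunction_iff.mp hΨ)).rename _)
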